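/- **Theorem 3.2** (spatial Plancherel formula for the $q$-Hahn eigenfunctions). Let $k\ge 1$ be an integer, $q\in\mathbb C$ with $0<|q|<1$, and $0\le\nu<1$. Put $(a;q)_n=\prod_{j=0}^{n-1}(1-aq^j)$ and $\xi(z)=\frac{1-z}{1-\nu z}$. *Spaces.* Let $\mathbb W^k=\{\vec n\in\mathbb Z^k: n_1\ge\dots\ge n_k\}$, let $\mathcal W^k$ be the space of finitely supported functions $\mathbb W^k\to\mathbb C$, with the pairing $\langle f,g\rangle_{\mathcal W}=\sum_{\vec n}f(\vec n)g(\vec n)$ (used also when only one of $f,g$ has finite support), and let $\mathcal C^k_z$ be the space of symmetric functions of $\vec z\in(\mathbb C\setminus\{1,\nu^{-1}\})^k$ that are Laurent polynomials in $\xi(z_1),\dots,\xi(z_k)$. *Eigenfunctions.* For $\vec n\in\mathbb W^k$ with cluster sizes (multiplicities of its distinct coordinates) $c_1,\dots,c_M$ let $\mathfrak m(\vec n)=\prod_{j=1}^M\frac{(\nu;q)_{c_j}}{(q;q)_{c_j}}$, and let $$\Psi^{\ell}_{\vec z}(\vec n)=\sum_{\sigma\in S(k)}\prod_{B<A}\frac{z_{\sigma(A)}-qz_{\sigma(B)}}{z_{\sigma(A)}-z_{\sigma(B)}}\prod_{j=1}^k\xi(z_{\sigma(j)})^{-n_j},$$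 $$\Psi^{r}_{\vec z}(\vec n)=(-1)^k(1-q)^kq^{\frac{k(k-1)}2}\,\mathfrak m(\vec n)\sum_{\sigma\in S(k)}\prod_{B<A}\frac{z_{\sigma(A)}-q^{-1}z_{\sigma(B)}}{z_{\sigma(A)}-z_{\sigma(B)}}\prod_{j=1}^k\xi(z_{\sigma(j)})^{n_j},$$ extended by continuity to the diagonals $z_i=z_j$. *Contours.* Let $\gamma_1,\dots,\gamma_k$ be positively oriented closed contours (piecewise $C^1$ closed curves; a point is contained in a contour, or not contained in it, if it is off the contour and the winding number is $1$, respectively $0$) such that all $\gamma_j$ contain $1$ and do not contain $\nu^{-1}$ (no condition if $\nu=0$), $\gamma_A$ contains every point of $q\gamma_B$ for all $A<B$, and $\gamma_k$ is a small enough circle around $1$: its closed disc $D$ satisfies $q^mD\cap D=\emptyset$ for $1\le m\le k$ and $\nu^{-1}\notin q^mD$ for $0\le m<k$. *Transforms.* For $f\in\mathcal W^k$ and $G\in\mathcal C^k_z$ let $(\mathcal Ff)(\vec z)=\langle f,\Psi^r_{\vec z}\rangle_{\mathcal W}$ and $$(\mathcal JG)(\vec n)=\oint_{\gamma_1}\frac{dz_1}{2\pi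 i}\cdots\oint_{\gamma_k}\frac{dz_k}{2\pi i}\prod_{A<B}\frac{z_A-z_B}{z_A-qz_B}\prod_{j=1}^k\frac{\xi(z_j)^{-n_j}}{(1-z_j)(1-\nu z_j)}\,G(\vec z).$$ *Spectral pairing.* For $F,G\in\mathcal C^k_z$ let $$\langle F,G\rangle_{\mathcal C}=\sum_{\lambda\vdash k}\oint_{\gamma_k}\!\cdots\oint_{\gamma_k}\frac{(1-q)^k(-1)^kq^{-k^2/2}}{m_1!m_2!\cdots}\det\Big[\frac1{w_iq^{\lambda_i}-w_j}\Big]_{i,j=1}^{\ell(\lambda)}\prod_{j=1}^{\ell(\lambda)}\frac{w_j^{\lambda_j}q^{\lambda_j^2/2}}{(w_j;q)_{\lambda_j}(\nu w_j;q)_{\lambda_j}}\,F(\vec w\circ\lambda)\,G(\vec w\circ\lambda)\prod_{j=1}^{\ell(\lambda)}\frac{dw_j}{2\pi i},$$ where $m_i$ is the number of parts of $\lambda$ equal to $i$, $\ell(\lambda)$ is the number of parts, and $\vec w\circ\lambda=(w_1,qw_1,\dots,q^{\lambda_1-1}w_1,w_2,qw_2,\dots,q^{\lambda_2-1}w_2,\dots)\in\mathbb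 C^k$ (the powers of $q$ combine to the integer power $q^{(\sum_j\lambda_j^2-k^2)/2}$). *Swapping operator.* Let $(Sf)(\vec n)=(-1)^k(1-q)^{-k}\,\mathfrak m(\vec n)^{-1}f(-n_k,\dots,-n_1)$. Then $\mathcal F$ maps $\mathcal W^k$ into $\mathcal C^k_z$ and is a linear isomorphism from $\mathcal W^k$ onto its image, with inverse given by $\mathcal J$; equivalently, $\mathcal J\mathcal F f=f$ for all $f\in\mathcal W^k$. The operator $S$ turns right eigenfunctions into left ones: $(S\Psi^r_{\vec z})(\vec n)=\Psi^\ell_{\vec z}(\vec n)$. Moreover, $$\langle f,g\rangle_{\mathcal W}=\langle \mathcal Ff,\mathcal F(Sg)\rangle_{\mathcal C}\qquad\text{for all } f,g\in\mathcal W^k.$$ -/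

import Mathlib

namespace QHahn

noncomputable section

/-! ### Spatial variables -/

/-- The Weyl chamber `{n ∈ ℤ^k : n_1 ≥ ⋯ ≥ n_k}`. -/
abbrev WeylChamber (k : ℕ) : Type := {n : Fin k → ℤ // Antitone n}

/-- The space of complex functions of finite (that is, compact) support on the Weyl chamber. -/
def Wc (k : ℕ) : Submodule ℂ (WeylChamber k → ℂ) where
  carrier := {f | f.support.Finite}
  add_mem' := fun {f g} hf hg => (hf.union hg).subset (Function.support_add f g)
  zero_mem' := by simp
  smul_mem' := fun c f hf => Set.Finite.subset hf (Function.support_const_smul_subset c f)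

/-- The bilinear pairing `∑_n f(n) g(n)` over the Weyl chamber. It is used only when one of the
two functions has finite support, so that the sum is finite. -/
def pairW {k : ℕ} (f g : WeylChamber k → ℂ) : ℂ := ∑ᶠ n, f n * g n

/-- The `q`-Pochhammer symbol `(a; q)_n = (1 - a)(1 - aq) ⋯ (1 - aq^{n-1})`. -/
def qPoch (a q : ℂ) (n : ℕ) : ℂ := ∏ j ∈ Finset.range n, (1 - a * q ^ j)

/-- `∏ (ν; q)_c / (q; q)_c` over the cluster sizes `c` of `n`. The clusters are the maximal groups
of equal coordinates, so there is one for each value `v` taken by `n`, and its size is the number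
of coordinates equal to `v`. -/
def stat (q : ℂ) (ν : ℝ) {k : ℕ} (n : WeylChamber k) : ℂ :=
  ∏ v ∈ Finset.univ.image n.1,
    qPoch ν q (Finset.univ.filter fun j => n.1 j = v).card /
      qPoch q q (Finset.univ.filter fun j => n.1 j = v).card

/-- The reflection `(n_1, …, n_k) ↦ (-n_k, …, -n_1)` of the Weyl chamber. -/
def reflPt {k : ℕ} (n : WeylChamber k) : WeylChamber k :=
  ⟨fun j => -n.1 j.rev, fun _ _ h => neg_le_neg (n.2 (Fin.rev_le_rev.mpr h))⟩

theorem reflPt_reflPt {k : ℕ} (n : WeylChamber k) : reflPt (reflPt n) = n := by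
  ext j; simp [reflPt]

/-- The swapping operator
`(S f)(n) = (-1)^k (1-q)^{-k} stat(n)^{-1} f(-n_k, …, -n_1)`, on all functions. -/
def swap (q : ℂ) (ν : ℝ) (k : ℕ) : (WeylChamber k → ℂ) →ₗ[ℂ] (WeylChamber k → ℂ) where
  toFun f n := (-1) ^ k * ((1 - q) ^ k)⁻¹ * (stat q ν n)⁻¹ * f (reflPt n)
  map_add' f g := by ext n; simp [mul_add]
  map_smul' c f := by ext n; simp; ring

theorem swap_mem (q : ℂ) (ν : ℝ) (k : ℕ) (f : WeylChamber k → ℂ) (hf : f ∈ Wc k) :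
    swap q ν k f ∈ Wc k := by
  refine Set.Finite.subset (Set.Finite.image reflPt hf) fun n hn => ?_
  refine ⟨reflPt n, ?_, reflPt_reflPt n⟩
  intro h
  exact hn (by simp [swap, h])

/-- The swapping operator on finitely supported functions. -/
def swapW (q : ℂ) (ν : ℝ) (k : ℕ) : Wc k →ₗ[ℂ] Wc k :=
  (swap q ν k).restrict (swap_mem q ν k)

/-! ### Spectral variables -/

/-- `ξ(z) = (1 - z) / (1 - ν z)`. -/
def xi (ν : ℝ) (z : ℂ) : ℂ := (1 - z) / (1 - ν * z)

/-- The domain `(ℂ \ {1, ν⁻¹})^k`; for `ν = 0` the point `ν⁻¹ = ∞` excludes nothing. -/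
def specDomain (ν : ℝ) (k : ℕ) : Set (Fin k → ℂ) :=
  {z | ∀ j, z j ≠ 1 ∧ (ν : ℂ) * z j ≠ 1}

/-- The value at `z` of the Laurent polynomial `∑_m P_m ∏_j ξ(z_j)^{m_j}`. -/
def laurentEval (ν : ℝ) {k : ℕ} (P : (Fin k → ℤ) →₀ ℂ) (z : Fin k → ℂ) : ℂ :=
  P.sum fun m c => c * ∏ j, xi ν (z j) ^ m j

/-- The space of symmetric functions on `specDomain ν k` that are Laurent polynomials in
`ξ(z_1), …, ξ(z_k)`. A function on `specDomain ν k` is represented by its extension by `0`. -/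
def Cz (ν : ℝ) (k : ℕ) : Submodule ℂ ((Fin k → ℂ) → ℂ) where
  carrier := {G | (∀ (σ : Equiv.Perm (Fin k)) (z : Fin k → ℂ), G (z ∘ σ) = G z) ∧
    (∃ P : (Fin k → ℤ) →₀ ℂ, ∀ z ∈ specDomain ν k, G z = laurentEval ν P z) ∧
    ∀ z ∉ specDomain ν k, G z = 0}
  add_mem' := by
    rintro F G ⟨hF, ⟨P, hP⟩, hF0⟩ ⟨hG, ⟨Q, hQ⟩, hG0⟩
    refine ⟨fun σ z => by simp [hF, hG], ⟨P + Q, fun z hz => ?_⟩, fun z hz => by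
      simp [hF0 z hz, hG0 z hz]⟩
    rw [Pi.add_apply, hP z hz, hQ z hz, laurentEval, laurentEval, laurentEval,
      Finsupp.sum_add_index'] <;> intros <;> ring
  zero_mem' := ⟨fun _ _ => rfl, ⟨0, fun _ _ => by simp [laurentEval]⟩, fun _ _ => rfl⟩
  smul_mem' := by
    rintro c G ⟨hG, ⟨P, hP⟩, hG0⟩
    refine ⟨fun σ z => by simp [hG], ⟨c • P, fun z hz => ?_⟩, fun z hz => by simp [hG0 z hz]⟩
    rw [Pi.smul_apply, hP z hz, laurentEval, laurentEval, Finsupp.sum_smul_index' (by simp)]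
    simp only [smul_eq_mul, mul_assoc]
    exact Finsupp.mul_sum _ _

/-! ### Eigenfunctions -/

/-- The formula for the left eigenfunction, meaningful at `z` with distinct coordinates. -/
def eigenLFormula (q : ℂ) (ν : ℝ) {k : ℕ} (n : WeylChamber k) (z : Fin k → ℂ) : ℂ :=
  ∑ σ : Equiv.Perm (Fin k),
    (∏ A, ∏ B ∈ Finset.Iio A, (z (σ A) - q * z (σ B)) / (z (σ A) - z (σ B))) *
      ∏ j, xi ν (z (σ j)) ^ (-n.1 j)

/-- The formula for the right eigenfunction, meaningful at `z` with distinct coordinates. -/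
def eigenRFormula (q : ℂ) (ν : ℝ) {k : ℕ} (n : WeylChamber k) (z : Fin k → ℂ) : ℂ :=
  (-1) ^ k * (1 - q) ^ k * q ^ (k * (k - 1) / 2) * stat q ν n *
    ∑ σ : Equiv.Perm (Fin k),
      (∏ A, ∏ B ∈ Finset.Iio A, (z (σ A) - q⁻¹ * z (σ B)) / (z (σ A) - z (σ B))) *
        ∏ j, xi ν (z (σ j)) ^ n.1 j

/-- A function given by a formula at points with distinct coordinates is extended by continuity to
the diagonals `z_i = z_j` within `specDomain ν k` (and by `0` outside `specDomain ν k`). -/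
def extendDiag (ν : ℝ) {k : ℕ} (F : (Fin k → ℂ) → ℂ) : (Fin k → ℂ) → ℂ :=
  (specDomain ν k).indicator (extendFrom {z | Function.Injective z} F)

/-- The left eigenfunction `Ψ^ℓ_z(n)` as a function of `z`. -/
def eigenL (q : ℂ) (ν : ℝ) {k : ℕ} (n : WeylChamber k) : (Fin k → ℂ) → ℂ :=
  extendDiag ν (eigenLFormula q ν n)

/-- The right eigenfunction `Ψ^r_z(n)` as a function of `z`. -/
def eigenR (q : ℂ) (ν : ℝ) {k : ℕ} (n : WeylChamber k) : (Fin k → ℂ) → ℂ :=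
  extendDiag ν (eigenRFormula q ν n)

theorem support_mul_finite {k : ℕ} {f : WeylChamber k → ℂ} (hf : f ∈ Wc k)
    (g : WeylChamber k → ℂ) : (Function.support fun n => f n * g n).Finite :=
  Set.Finite.subset hf (Function.support_mul_subset_left f g)

/-- The direct transform `(P f)(z) = ⟨f, Ψ^r_z⟩`. -/
def direct (q : ℂ) (ν : ℝ) (k : ℕ) : Wc k →ₗ[ℂ] ((Fin k → ℂ) → ℂ) where
  toFun f z := pairW f.1 fun n => eigenR q ν n z
  map_add' f g := by
    ext z
    simp only [pairW, Submodule.coe_add, Pi.add_apply, add_mul]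
    exact finsum_add_distrib (support_mul_finite f.2 _) (support_mul_finite g.2 _)
  map_smul' c f := by
    ext z
    simp only [pairW, Submodule.coe_smul, Pi.smul_apply, smul_eq_mul, RingHom.id_apply, mul_assoc]
    exact (mul_finsum' _ c (support_mul_finite f.2 _)).symm

/-! ### Contours -/

/-- A closed piecewise continuously differentiable curve in the plane, parametrized by `[0, 1]`:
continuous, and off finitely many parameters continuously differentiable with bounded derivative. -/
structure Contour where
  /-- the parametrization (only its restriction to `[0, 1]` matters) -/
  toFun : ℝ → ℂ
  continuousOn : ContinuousOn toFun (Set.Icc 0 1)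
  closed : toFun 0 = toFun 1
  piecewise : ∃ (s : Finset ℝ) (C : ℝ), ∀ t ∈ Set.Ioo (0 : ℝ) 1, t ∉ s →
    ContDiffAt ℝ 1 toFun t ∧ ‖deriv toFun t‖ ≤ C

/-- The points on the contour. -/
def Contour.range (γ : Contour) : Set ℂ := γ.toFun '' Set.Icc 0 1

/-- The winding number `(2πi)⁻¹ ∮_γ dz / (z - p)` around a point `p` off the contour. -/
def Contour.winding (γ : Contour) (p : ℂ) : ℂ :=
  (2 * Real.pi * Complex.I)⁻¹ * ∫ t in (0 : ℝ)..1, (γ.toFun t - p)⁻¹ * deriv γ.toFun t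

/-- The positively oriented contour `γ` contains the point `p` (inside it, and not on it). -/
def Contour.Contains (γ : Contour) (p : ℂ) : Prop := p ∉ γ.range ∧ γ.winding p = 1

/-- The contour `γ` does not contain the point `p` (neither inside it nor on it). -/
def Contour.Avoids (γ : Contour) (p : ℂ) : Prop := p ∉ γ.range ∧ γ.winding p = 0

/-- The multiple contour integral
`∮_{γ_1} dz_1/(2πi) ⋯ ∮_{γ_m} dz_m/(2πi) f(z_1, …, z_m)`, over the cube of parameters. -/
def multiIntegral {m : ℕ} (γ : Fin m → Contour) (f : (Fin m → ℂ) → ℂ) : ℂ :=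
  ((2 * Real.pi * Complex.I) ^ m)⁻¹ *
    ∫ t in Set.Icc (0 : Fin m → ℝ) 1,
      f (fun j => (γ j).toFun (t j)) * ∏ j, deriv (γ j).toFun (t j)

/-- The closed disc of radius `r` around `1` is small enough: its multiples by `q, q², …, q^k` are
disjoint from it (in particular it does not contain `q`), and neither it nor its multiples by
`q, …, q^{k-1}` contain `ν⁻¹`. Every small enough `r > 0` has this property. -/
def SmallRadius (q : ℂ) (ν : ℝ) (k : ℕ) (r : ℝ) : Prop :=
  0 < r ∧
  (∀ m ∈ Finset.Icc 1 k, ∀ w ∈ Metric.closedBall (1 : ℂ) r, q ^ m * w ∉ Metric.closedBall 1 r) ∧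
  ∀ m ∈ Finset.range k, ∀ w ∈ Metric.closedBall (1 : ℂ) r, (ν : ℂ) * (q ^ m * w) ≠ 1

/-- Admissible nested contours `γ_1, …, γ_k`: each contains `1` and does not contain `ν⁻¹` (an
empty condition for `ν = 0`, when `ν⁻¹ = ∞`), `γ_A` contains the image `q γ_B` for all `B > A`, and
the last contour is a small enough positively oriented circle around `1`. -/
structure Nested (q : ℂ) (ν : ℝ) {k : ℕ} (γ : Fin k → Contour) : Prop where
  contains_one : ∀ j, (γ j).Contains 1
  avoids_inv : ν ≠ 0 → ∀ j, (γ j).Avoids (ν : ℂ)⁻¹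
  nested : ∀ A B, A < B → ∀ w ∈ (γ B).range, (γ A).Contains (q * w)
  last_circle : ∃ r, SmallRadius q ν k r ∧ ∀ j : Fin k, (j : ℕ) + 1 = k →
    ∀ t ∈ Set.Icc (0 : ℝ) 1, (γ j).toFun t = circleMap 1 r (2 * Real.pi * t)

/-! ### The inverse transform and the spectral pairing -/

/-- The inverse transform: the nested contour integral of
`∏_{A<B} (z_A - z_B)/(z_A - q z_B) ∏_j ξ(z_j)^{-n_j} / ((1 - z_j)(1 - ν z_j)) G(z)`. -/
def inverse (q : ℂ) (ν : ℝ) {k : ℕ} (γ : Fin k → Contour) (G : (Fin k → ℂ) → ℂ)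
    (n : WeylChamber k) : ℂ :=
  multiIntegral γ fun z =>
    (∏ A, ∏ B ∈ Finset.Ioi A, (z A - z B) / (z A - q * z B)) *
      (∏ j, 1 / ((1 - z j) * (1 - ν * z j)) * xi ν (z j) ^ (-n.1 j)) * G z

/-- The partitions of `k`, as the weakly decreasing compositions
`k = l_1 + ⋯ + l_ℓ` into positive parts. -/
def partitions (k : ℕ) : Finset (Composition k) :=
  Finset.univ.filter fun l => Antitone l.blocksFun

/-- The density of the Plancherel measure attached to a partition `l` with `ℓ` parts, with respect
to `∏ dw_j/(2πi)`:
`(1-q)^k (-1)^k q^{-k²/2} / (m_1! m_2! ⋯) det[1/(w_i q^{l_i} - w_j)] ∏_j w_j^{l_j} q^{l_j²/2}`.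
The total exponent `(∑ l_j² - k²)/2` of `q` is an integer, as `l_1 + ⋯ + l_ℓ = k`. -/
def plancherelDensity (q : ℂ) {k : ℕ} (l : Composition k) (w : Fin l.length → ℂ) : ℂ :=
  (1 - q) ^ k * (-1) ^ k * q ^ (((∑ j, (l.blocksFun j : ℤ) ^ 2) - (k : ℤ) ^ 2) / 2) /
      (∏ i ∈ Finset.Icc 1 k, ((l.blocks.count i).factorial : ℂ)) *
    (Matrix.of fun i j => 1 / (w i * q ^ l.blocksFun i - w j)).det *
    ∏ j, w j ^ l.blocksFun j

/-- The vector of strings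
`w ∘ l = (w_1, q w_1, …, q^{l_1 - 1} w_1, w_2, q w_2, …, q^{l_2 - 1} w_2, …)`. -/
def strings (q : ℂ) {k : ℕ} (l : Composition k) (w : Fin l.length → ℂ) : Fin k → ℂ :=
  fun j => q ^ (l.invEmbedding j : ℕ) * w (l.index j)

/-- The bilinear pairing in the spectral variables, a sum over partitions of `k` of integrals with
all variables on the contour `γ` (the small circle around `1`). -/
def pairC (q : ℂ) (ν : ℝ) {k : ℕ} (γ : Contour) (F G : (Fin k → ℂ) → ℂ) : ℂ :=
  ∑ l ∈ partitions k, multiIntegral (fun _ : Fin l.length => γ) fun w =>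
    plancherelDensity q l w *
      (∏ j, 1 / (qPoch (w j) q (l.blocksFun j) * qPoch (ν * w j) q (l.blocksFun j))) *
      F (strings q l w) * G (strings q l w)

end

end QHahn

/-! Two facts give everything: J F f = f, and the identity (J G)(n) = ⟨G, Ψ^ℓ(n)⟩ in the spectral
pairing for G in `Cz` (`pairC_sum_eigenL`). The first makes F injective with inverse J. Together
they give ⟨f, g⟩ = Σ g(n) (J F f)(n) = ⟨F f, Σ g(n) Ψ^ℓ(n)⟩, and the last sum is F(S g) because S
exchanges the two families of eigenfunctions.

Both eigenfunctions are multiples of one Bethe sum (`bethe`). In the variables ξ(z_j) it is, up to a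
monomial, an antisymmetric polynomial divided by the Vandermonde product, hence a symmetric Laurent
polynomial (`exists_laurent_bethe`).

Inversion: apply J to Ψ^r(x) and evaluate at y. Against the nested kernel, each term of the Bethe
sum keeps scattering factors only at the inversions of a permutation τ (`pairKernel_mul_bethe`). If
j is a right-to-left minimum of τ and ξ(z_j) has positive exponent, no pole in z_j is enclosed. If j
is a left-to-right maximum and the exponent is negative, all poles are enclosed and the integrand
decays quadratically at infinity. Such integrals vanish, and the inequalities left for the other
terms force x = y and x ∘ τ = x (`eq_and_comp_eq_of_records`). The surviving terms add up, by a
Hall–Littlewood symmetrization (`sum_cluster_perm`), to a kernel that is integrated one residue at a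
time (`multiIntegral_clusterKernel`); the result cancels `stat`.

Pairing: all contours of J are moved to the small circle C, by induction on their number
(`multiIntegral_pairKernel`). Once the inner variables have been arranged in strings w, qw, … based
on C, moving the outermost contour to C either leaves its variable there, as a new string of length
one, or takes a residue at the point q^l w following a string of length l, which prolongs that
string. These cases match the recursion of the Bethe sum on a union of strings, where only the end
of a string can come first in an ordering (`betheSet_stringSet`). A Cauchy determinant identifies
the resulting density (`density_eq_det`), and sorting the string lengths turns 1/p! into 1/(m_1!
m_2! ⋯).

The complex analysis is algebraic. Only rational functions are integrated; powers z^n and (z -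
p)^(-n-2) have primitives, and partial fractions reduce the rest to winding numbers
(`IsContourFunctional`). Relations between winding numbers of different contours come from Fubini's
theorem. -/

namespace QHahn

open MeasureTheory Set Filter Topology

noncomputable section

/-! ### Contour integrals -/

/-- The normalized contour integral `(2πi)⁻¹ ∮_γ f(z) dz`. -/
def cint (γ : Contour) (f : ℂ → ℂ) : ℂ :=
  (2 * Real.pi * Complex.I)⁻¹ * ∫ t in Icc (0 : ℝ) 1, f (γ.toFun t) * deriv γ.toFun t

theorem winding_eq_cint (γ : Contour) (p : ℂ) : γ.winding p = cint γ fun z => (z - p)⁻¹ := by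
  rw [Contour.winding, cint, intervalIntegral.integral_of_le zero_le_one, integral_Icc_eq_integral_Ioc]

theorem Contour.isCompact_range (γ : Contour) : IsCompact γ.range :=
  isCompact_Icc.image_of_continuousOn γ.continuousOn

theorem Contour.mem_range (γ : Contour) {t : ℝ} (ht : t ∈ Icc (0 : ℝ) 1) : γ.toFun t ∈ γ.range :=
  ⟨t, ht, rfl⟩

theorem Contour.exists_deriv_bound (γ : Contour) :
    ∃ C : ℝ, 0 ≤ C ∧ ∀ᵐ t : ℝ, t ∈ Icc (0 : ℝ) 1 → ‖deriv γ.toFun t‖ ≤ C := by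
  obtain ⟨s, C, h⟩ := γ.piecewise
  refine ⟨max C 0, le_max_right _ _, ?_⟩
  have hs : ∀ᵐ t : ℝ, t ∉ ((insert 0 (insert 1 s) : Finset ℝ) : Set ℝ) :=
    (Finset.countable_toSet _).ae_notMem _
  filter_upwards [hs] with t ht ht'
  simp only [Finset.coe_insert, mem_insert_iff, not_or, Finset.mem_coe] at ht
  exact ((h t ⟨lt_of_le_of_ne ht'.1 (Ne.symm ht.1), lt_of_le_of_ne ht'.2 ht.2.1⟩ ht.2.2).2).trans
    (le_max_left _ _)

/-- The product of the ranges of several contours. -/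
def ranges {m : ℕ} (γ : Fin m → Contour) : Set (Fin m → ℂ) := {z | ∀ j, z j ∈ (γ j).range}

/-- The derivatives are controlled only off finitely many parameters, so they are treated as
measurable factors that are bounded almost everywhere, multiplying a continuous function on a
compact cube. -/
theorem integrableOn_multi {m : ℕ} (γ : Fin m → Contour) {f : (Fin m → ℂ) → ℂ}
    (hf : ContinuousOn f (ranges γ)) :
    IntegrableOn (fun t : Fin m → ℝ => f (fun j => (γ j).toFun (t j)) *
      ∏ j, deriv (γ j).toFun (t j)) (Icc 0 1) := by
  choose C hC0 hC using fun j => (γ j).exists_deriv_bound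
  have hcont : ContinuousOn (fun t : Fin m → ℝ => f (fun j => (γ j).toFun (t j))) (Icc 0 1) := by
    refine hf.comp ?_ fun t ht j => (γ j).mem_range ⟨ht.1 j, ht.2 j⟩
    refine continuousOn_pi.2 fun j => (γ j).continuousOn.comp (continuous_apply j).continuousOn ?_
    exact fun t ht => ⟨ht.1 j, ht.2 j⟩
  have hint := hcont.integrableOn_compact (μ := volume) isCompact_Icc
  refine Integrable.mul_bdd (c := ∏ j, C j) hint ?_ ?_
  · refine (Finset.measurable_fun_prod _ fun j _ => ?_).aestronglyMeasurable
    exact (measurable_deriv _).comp (measurable_pi_apply j)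
  · have h1 : ∀ j, ∀ᵐ t : Fin m → ℝ, t j ∈ Icc (0 : ℝ) 1 → ‖deriv (γ j).toFun (t j)‖ ≤ C j :=
      fun j => (Measure.quasiMeasurePreserving_eval (fun _ : Fin m => (volume : Measure ℝ)) j).ae
        (hC j)
    filter_upwards [ae_restrict_of_ae (ae_all_iff.2 h1), ae_restrict_mem measurableSet_Icc]
      with t ht ht'
    rw [norm_prod]
    exact Finset.prod_le_prod (fun _ _ => norm_nonneg _) fun j _ => ht j ⟨ht'.1 j, ht'.2 j⟩

theorem integrableOn_cint (γ : Contour) {f : ℂ → ℂ} (hf : ContinuousOn f γ.range) :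
    IntegrableOn (fun t => f (γ.toFun t) * deriv γ.toFun t) (Icc 0 1) := by
  obtain ⟨C, hC0, hC⟩ := γ.exists_deriv_bound
  have hcont : ContinuousOn (fun t => f (γ.toFun t)) (Icc 0 1) :=
    hf.comp γ.continuousOn fun t ht => γ.mem_range ht
  refine Integrable.mul_bdd (c := C) (hcont.integrableOn_compact (μ := volume) isCompact_Icc)
    (measurable_deriv _).aestronglyMeasurable ?_
  filter_upwards [ae_restrict_of_ae hC, ae_restrict_mem measurableSet_Icc] with t h h' using h h'

theorem cint_congr {γ : Contour} {f g : ℂ → ℂ} (h : ∀ z ∈ γ.range, f z = g z) :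
    cint γ f = cint γ g := by
  rw [cint, cint]; congr 1
  exact setIntegral_congr_fun measurableSet_Icc fun t ht => by
    simp only [h _ (γ.mem_range ht)]

theorem cint_const_mul (γ : Contour) (c : ℂ) (f : ℂ → ℂ) :
    cint γ (fun z => c * f z) = c * cint γ f := by
  simp only [cint, mul_assoc, integral_const_mul]; ring

theorem cint_add {γ : Contour} {f g : ℂ → ℂ} (hf : ContinuousOn f γ.range)
    (hg : ContinuousOn g γ.range) : cint γ (fun z => f z + g z) = cint γ f + cint γ g := by
  simp only [cint, add_mul]
  rw [integral_add (integrableOn_cint γ hf) (integrableOn_cint γ hg), mul_add]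

theorem cint_sum {γ : Contour} {ι : Type*} (s : Finset ι) {f : ι → ℂ → ℂ}
    (hf : ∀ i ∈ s, ContinuousOn (f i) γ.range) :
    cint γ (fun z => ∑ i ∈ s, f i z) = ∑ i ∈ s, cint γ (f i) := by
  simp only [cint, Finset.sum_mul]
  rw [integral_finsetSum s fun i hi => integrableOn_cint γ (hf i hi), Finset.mul_sum]

theorem multiIntegral_congr {m : ℕ} {γ : Fin m → Contour} {f g : (Fin m → ℂ) → ℂ}
    (h : ∀ z ∈ ranges γ, f z = g z) : multiIntegral γ f = multiIntegral γ g := by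
  rw [multiIntegral, multiIntegral]; congr 1
  exact setIntegral_congr_fun measurableSet_Icc fun t ht => by
    simp only [h _ fun j => (γ j).mem_range ⟨ht.1 j, ht.2 j⟩]

theorem multiIntegral_const_mul {m : ℕ} (γ : Fin m → Contour) (c : ℂ) (f : (Fin m → ℂ) → ℂ) :
    multiIntegral γ (fun z => c * f z) = c * multiIntegral γ f := by
  simp only [multiIntegral, mul_assoc, integral_const_mul]; ring

theorem multiIntegral_zero_dim (γ : Fin 0 → Contour) (f : (Fin 0 → ℂ) → ℂ) :
    multiIntegral γ f = f default := by
  have h0 : (Icc (0 : Fin 0 → ℝ) 1) = univ := by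
    ext t; simp [Subsingleton.elim t 0, Subsingleton.elim (1 : Fin 0 → ℝ) 0]
  rw [multiIntegral, h0]
  have : ∀ t : Fin 0 → ℝ, f (fun j => (γ j).toFun (t j)) = f default :=
    fun t => congrArg f (Subsingleton.elim _ _)
  simp [this, Measure.volume_pi_eq_dirac 0]

/-- The integrand of an iterated integral in one distinguished variable and the others. -/
theorem multiIntegral_aux {m : ℕ} (γ : Fin (m + 1) → Contour) (i : Fin (m + 1))
    {f : (Fin (m + 1) → ℂ) → ℂ} (hf : ContinuousOn f (ranges γ)) :
    let F : ℝ × (Fin m → ℝ) → ℂ := fun p =>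
      f (i.insertNth ((γ i).toFun p.1) fun j => (γ (i.succAbove j)).toFun (p.2 j)) *
        (deriv (γ i).toFun p.1 * ∏ j, deriv (γ (i.succAbove j)).toFun (p.2 j))
    IntegrableOn F (Icc 0 1 ×ˢ Icc 0 1) (volume.prod volume) ∧
      ∫ t in Icc (0 : Fin (m + 1) → ℝ) 1, f (fun j => (γ j).toFun (t j)) *
        ∏ j, deriv (γ j).toFun (t j) = ∫ p in Icc 0 1 ×ˢ Icc 0 1, F p ∂(volume.prod volume) := by
  intro F
  set e := MeasurableEquiv.piFinSuccAbove (fun _ : Fin (m + 1) => ℝ) i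
  have hem : MeasurePreserving e := volume_preserving_piFinSuccAbove (fun _ => ℝ) i
  have hpre : (Icc (0 : Fin (m + 1) → ℝ) 1) = e ⁻¹' (Icc 0 1 ×ˢ Icc 0 1) := by
    ext t
    simp only [e, mem_preimage, mem_prod, MeasurableEquiv.piFinSuccAbove_apply, mem_Icc,
      Pi.le_def, Fin.insertNthEquiv_symm_apply, Pi.zero_apply, Pi.one_apply, Fin.removeNth]
    rw [Fin.forall_iff_succAbove (P := fun j => (0 : ℝ) ≤ t j) i,
      Fin.forall_iff_succAbove (P := fun j => t j ≤ (1 : ℝ)) i]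
    tauto
  have hfun : (fun t : Fin (m + 1) → ℝ => f (fun j => (γ j).toFun (t j)) *
      ∏ j, deriv (γ j).toFun (t j)) = F ∘ e := by
    funext t
    simp only [F, e, Function.comp, MeasurableEquiv.piFinSuccAbove_apply,
      Fin.insertNthEquiv_symm_apply, Fin.removeNth]
    rw [Fin.prod_univ_succAbove _ i]
    congr 2
    funext j
    refine Fin.succAboveCases i ?_ (fun j => ?_) j <;> simp
  have hI := integrableOn_multi γ hf
  rw [hfun, hpre, hem.integrableOn_comp_preimage e.measurableEmbedding] at hI
  refine ⟨hI, ?_⟩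
  rw [hfun, hpre]
  exact hem.setIntegral_preimage_emb e.measurableEmbedding F _

theorem multiIntegral_insertNth {m : ℕ} (γ : Fin (m + 1) → Contour) (i : Fin (m + 1))
    {f : (Fin (m + 1) → ℂ) → ℂ} (hf : ContinuousOn f (ranges γ)) :
    multiIntegral γ f = cint (γ i) fun z =>
      multiIntegral (fun j => γ (i.succAbove j)) fun w => f (i.insertNth z w) := by
  obtain ⟨hI, h⟩ := multiIntegral_aux γ i hf
  rw [multiIntegral, h, setIntegral_prod _ hI, cint]
  simp only [multiIntegral]
  rw [pow_succ', mul_inv, mul_assoc, ← integral_const_mul]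
  congr 2
  funext x
  rw [mul_assoc (((2 * Real.pi * Complex.I) ^ m)⁻¹), ← integral_mul_const]
  congr 2
  funext y
  ring

theorem multiIntegral_insertNth' {m : ℕ} (γ : Fin (m + 1) → Contour) (i : Fin (m + 1))
    {f : (Fin (m + 1) → ℂ) → ℂ} (hf : ContinuousOn f (ranges γ)) :
    multiIntegral γ f = multiIntegral (fun j => γ (i.succAbove j)) fun w =>
      cint (γ i) fun z => f (i.insertNth z w) := by
  obtain ⟨hI, h⟩ := multiIntegral_aux γ i hf
  rw [multiIntegral, h, ← Measure.prod_restrict, integral_prod_symm, multiIntegral]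
  · simp only [cint]
    rw [pow_succ, mul_inv, mul_assoc, ← integral_const_mul]
    congr 2
    funext x
    rw [mul_assoc ((2 * Real.pi * Complex.I)⁻¹), ← integral_mul_const]
    congr 2
    funext y
    ring
  · rwa [Measure.prod_restrict]

/-- Both iterated integrals equal the integral over the single family `Fin.cons α γ`, so this is
`multiIntegral_insertNth` compared with its primed version. -/
theorem cint_multiIntegral_swap {m : ℕ} (α : Contour) (γ : Fin m → Contour)
    {f : ℂ → (Fin m → ℂ) → ℂ}
    (hf : ContinuousOn (fun p : ℂ × (Fin m → ℂ) => f p.1 p.2) (α.range ×ˢ ranges γ)) :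
    cint α (fun z => multiIntegral γ (f z)) = multiIntegral γ fun w => cint α fun z => f z w := by
  have hc : ContinuousOn (fun z : Fin (m + 1) → ℂ => f (z 0) (Fin.tail z))
      (ranges (Fin.cons α γ : Fin (m + 1) → Contour)) := by
    refine hf.comp (g := fun p : ℂ × (Fin m → ℂ) => f p.1 p.2)
      (f := fun z : Fin (m + 1) → ℂ => (z 0, Fin.tail z)) ?_ ?_
    · exact (Continuous.prodMk (continuous_apply 0)
        (continuous_pi fun j => continuous_apply j.succ)).continuousOn
    · exact fun z hz => ⟨by simpa using hz 0, fun j => by simpa [Fin.tail] using hz j.succ⟩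
  have h1 := multiIntegral_insertNth (Fin.cons α γ : Fin (m + 1) → Contour) 0 hc
  rw [multiIntegral_insertNth' (Fin.cons α γ : Fin (m + 1) → Contour) 0 hc] at h1
  simpa [Fin.tail] using h1.symm

theorem multiIntegral_fin_one (β : Contour) (g : ℂ → ℂ) :
    multiIntegral (fun _ : Fin 1 => β) (fun w => g (w 0)) = cint β g := by
  have h := (volume_preserving_funUnique (Fin 1) ℝ).setIntegral_preimage_emb
    (MeasurableEquiv.funUnique (Fin 1) ℝ).measurableEmbedding
    (fun t => g (β.toFun t) * deriv β.toFun t) (Icc 0 1)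
  have hpre : MeasurableEquiv.funUnique (Fin 1) ℝ ⁻¹' Icc 0 1 = Icc (0 : Fin 1 → ℝ) 1 := by
    ext t
    simp [Pi.le_def]
  rw [multiIntegral, cint, ← h, hpre]
  simp
  rfl

theorem cint_cint_swap {α β : Contour} {f : ℂ → ℂ → ℂ}
    (hf : ContinuousOn (fun p : ℂ × ℂ => f p.1 p.2) (α.range ×ˢ β.range)) :
    cint α (fun z => cint β (f z)) = cint β fun w => cint α fun z => f z w := by
  have h := cint_multiIntegral_swap α (fun _ : Fin 1 => β) (f := fun z w => f z (w 0)) ?_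
  · rw [multiIntegral_fin_one β fun w => cint α fun z => f z w] at h
    simpa only [multiIntegral_fin_one] using h
  · exact hf.comp (f := fun p : ℂ × (Fin 1 → ℂ) => (p.1, p.2 0)) (by fun_prop)
      fun p hp => ⟨hp.1, hp.2 0⟩

/-! ### Integrals of rational functions -/

theorem cint_eq_zero_of_hasDerivAt {γ : Contour} {F f : ℂ → ℂ}
    (hF : ∀ z ∈ γ.range, HasDerivAt F (f z) z) (hf : ContinuousOn f γ.range) : cint γ f = 0 := by
  obtain ⟨s, C, hs⟩ := γ.piecewise
  have hI := integrableOn_cint γ hf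
  have h := integral_eq_of_hasDerivAt_off_countable_of_le (fun t => F (γ.toFun t))
    (fun t => f (γ.toFun t) * deriv γ.toFun t) zero_le_one (s := s) s.countable_toSet ?_ ?_ ?_
  · rw [cint, integral_Icc_eq_integral_Ioc, ← intervalIntegral.integral_of_le zero_le_one, h,
      γ.closed, sub_self, mul_zero]
  · intro t ht
    exact (hF _ (γ.mem_range ht)).continuousAt.comp_continuousWithinAt (γ.continuousOn t ht)
  · intro t ht
    have hd : HasDerivAt γ.toFun (deriv γ.toFun t) t :=
      ((hs t ht.1 ht.2).1.differentiableAt one_ne_zero).hasDerivAt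
    exact (hF _ (γ.mem_range (Ioo_subset_Icc_self ht.1))).comp t hd
  · exact (intervalIntegrable_iff_integrableOn_Icc_of_le zero_le_one).2 hI

theorem continuousOn_inv_sub {T : Set ℂ} {p : ℂ} (hp : p ∉ T) :
    ContinuousOn (fun z => (z - p)⁻¹) T :=
  (continuousOn_id.sub continuousOn_const).inv₀ fun _ hz =>
    sub_ne_zero.2 (ne_of_mem_of_not_mem hz hp)

theorem cint_pow (γ : Contour) (n : ℕ) : cint γ (fun z => z ^ n) = 0 := by
  refine cint_eq_zero_of_hasDerivAt (F := fun z => ((n : ℂ) + 1)⁻¹ * z ^ (n + 1))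
    (fun z _ => ?_) (by fun_prop)
  have h := (hasDerivAt_pow (n + 1) z).const_mul ((n : ℂ) + 1)⁻¹
  have hn : (n : ℂ) + 1 ≠ 0 := Nat.cast_add_one_ne_zero n
  refine h.congr_deriv ?_
  push_cast
  rw [← mul_assoc, inv_mul_cancel₀ hn, one_mul]

theorem cint_inv_pow (γ : Contour) {p : ℂ} (hp : p ∉ γ.range) (n : ℕ) :
    cint γ (fun z => ((z - p)⁻¹) ^ (n + 2)) = 0 := by
  refine cint_eq_zero_of_hasDerivAt (F := fun z => -((n : ℂ) + 1)⁻¹ * ((z - p)⁻¹) ^ (n + 1))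
    (fun z hz => ?_) ((continuousOn_inv_sub hp).pow _)
  have hz : z - p ≠ 0 := sub_ne_zero.2 (ne_of_mem_of_not_mem hz hp)
  have hn : (n : ℂ) + 1 ≠ 0 := Nat.cast_add_one_ne_zero n
  have h := (((hasDerivAt_id z).sub_const p).inv hz).pow (n + 1) |>.const_mul (-((n : ℂ) + 1)⁻¹)
  refine h.congr_deriv ?_
  simp only [id, Pi.inv_apply]
  push_cast
  rw [pow_add]
  field_simp

/-- The formal properties of a linear combination of contour integrals over curves in `T`. -/
structure IsContourFunctional (T : Set ℂ) (L : (ℂ → ℂ) → ℂ) : Prop where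
  congr : ∀ {f g : ℂ → ℂ}, (∀ z ∈ T, f z = g z) → L f = L g
  add : ∀ {f g : ℂ → ℂ}, ContinuousOn f T → ContinuousOn g T → L (fun z => f z + g z) = L f + L g
  const_mul : ∀ (c : ℂ) (f : ℂ → ℂ), L (fun z => c * f z) = c * L f
  pow : ∀ n : ℕ, L (fun z => z ^ n) = 0
  inv_pow : ∀ {p : ℂ}, p ∉ T → ∀ n : ℕ, L (fun z => ((z - p)⁻¹) ^ (n + 2)) = 0

theorem isContourFunctional_cint (γ : Contour) : IsContourFunctional γ.range (cint γ) where
  congr := cint_congr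
  add := cint_add
  const_mul := cint_const_mul γ
  pow := cint_pow γ
  inv_pow := cint_inv_pow γ

/-- Differences are included because moving a contour is a residue computation for this functional:
a pole around which both curves wind equally has weight 0, a pole that is crossed has weight 1. -/
theorem isContourFunctional_sub (γ δ : Contour) :
    IsContourFunctional (γ.range ∪ δ.range) (fun f => cint γ f - cint δ f) where
  congr h := by
    simp only [cint_congr fun z hz => h z (Or.inl hz), cint_congr fun z hz => h z (Or.inr hz)]
  add hf hg := by
    simp only [cint_add (hf.mono subset_union_left) (hg.mono subset_union_left),
      cint_add (hf.mono subset_union_right) (hg.mono subset_union_right)]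
    ring
  const_mul c f := by simp only [cint_const_mul]; ring
  pow n := by simp only [cint_pow, sub_zero]
  inv_pow hp n := by
    simp only [mem_union, not_or] at hp
    simp only [cint_inv_pow _ hp.1, cint_inv_pow _ hp.2, sub_zero]

/-- The algebra of rational functions with poles in `S`. -/
def Rat (S : Set ℂ) : Subalgebra ℂ (ℂ → ℂ) :=
  Algebra.adjoin ℂ ({fun z => z} ∪ (fun p z => (z - p)⁻¹) '' S)

/-- The algebra of rational functions with poles in `S` and finite at infinity. -/
def BRat (S : Set ℂ) : Subalgebra ℂ (ℂ → ℂ) :=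
  Algebra.adjoin ℂ ((fun p z => (z - p)⁻¹) '' S)

theorem id_mem_Rat (S : Set ℂ) : (fun z => z) ∈ Rat S := Algebra.subset_adjoin (Or.inl rfl)

theorem inv_mem_Rat {S : Set ℂ} {p : ℂ} (hp : p ∈ S) : (fun z => (z - p)⁻¹) ∈ Rat S :=
  Algebra.subset_adjoin (Or.inr ⟨p, hp, rfl⟩)

theorem inv_mem_BRat {S : Set ℂ} {p : ℂ} (hp : p ∈ S) : (fun z => (z - p)⁻¹) ∈ BRat S :=
  Algebra.subset_adjoin ⟨p, hp, rfl⟩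

theorem const_mem_subalgebra (A : Subalgebra ℂ (ℂ → ℂ)) (c : ℂ) : (fun _ => c) ∈ A :=
  A.algebraMap_mem c

theorem Rat_mono {S S' : Set ℂ} (h : S ⊆ S') : Rat S ≤ Rat S' :=
  Algebra.adjoin_mono (union_subset_union_right _ (image_mono h))

theorem continuousOn_of_mem_Rat {S T : Set ℂ} (hST : ∀ p ∈ S, p ∉ T) {f : ℂ → ℂ} (hf : f ∈ Rat S) :
    ContinuousOn f T := by
  induction hf using Algebra.adjoin_induction with
  | mem f hf =>
    rcases hf with rfl | ⟨p, hp, rfl⟩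
    · exact continuousOn_id
    · exact continuousOn_inv_sub (hST p hp)
  | algebraMap c => exact continuousOn_const
  | add f g _ _ hf hg => exact hf.add hg
  | mul f g _ _ hf hg => exact hf.mul hg

theorem BRat_le_Rat (S : Set ℂ) : BRat S ≤ Rat S := Algebra.adjoin_mono subset_union_right

/-- The quotient stays in the same algebra, so subtracting the value at `p` removes a simple pole at
`p` without creating new ones. -/
theorem exists_quotient_of_mem_Rat {S : Set ℂ} {p : ℂ} (hp : p ∉ S) {f : ℂ → ℂ} (hf : f ∈ Rat S) :
    ∃ g ∈ Rat S, ∀ z ∉ S, f z = f p + (z - p) * g z := by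
  induction hf using Algebra.adjoin_induction with
  | mem f hf =>
    rcases hf with rfl | ⟨a, ha, rfl⟩
    · exact ⟨1, one_mem _, fun z _ => by simp⟩
    · refine ⟨fun z => -(p - a)⁻¹ * (z - a)⁻¹,
        mul_mem (const_mem_subalgebra _ _) (inv_mem_Rat ha), fun z hz => ?_⟩
      have h1 : z - a ≠ 0 := sub_ne_zero.2 (ne_of_mem_of_not_mem ha hz).symm
      have h2 : p - a ≠ 0 := sub_ne_zero.2 (ne_of_mem_of_not_mem ha hp).symm
      field_simp
      ring
  | algebraMap c => exact ⟨0, zero_mem _, fun z _ => by simp⟩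
  | add f g _ _ hf hg =>
    obtain ⟨f', hf', h1⟩ := hf
    obtain ⟨g', hg', h2⟩ := hg
    refine ⟨f' + g', add_mem hf' hg', fun z hz => ?_⟩
    simp only [Pi.add_apply, h1 z hz, h2 z hz]
    ring
  | mul f g hfm hgm hf hg =>
    obtain ⟨f', hf', h1⟩ := hf
    obtain ⟨g', hg', h2⟩ := hg
    refine ⟨f' * g + (fun _ => f p) * g', add_mem (mul_mem hf' hgm)
      (mul_mem (const_mem_subalgebra _ _) hg'), fun z hz => ?_⟩
    simp only [Pi.add_apply, Pi.mul_apply, h1 z hz, h2 z hz]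
    ring

theorem continuousOn_multiset_prod_inv {T : Set ℂ} {s : Multiset ℂ} (hs : ∀ p ∈ s, p ∉ T) :
    ContinuousOn (fun z => (s.map fun p => (z - p)⁻¹).prod) T := by
  induction s using Multiset.induction_on with
  | empty => simpa using continuousOn_const
  | cons p s ih =>
    simp only [Multiset.map_cons, Multiset.prod_cons]
    exact (continuousOn_inv_sub (hs p (Multiset.mem_cons_self _ _))).mul
      (ih fun p hp => hs p (Multiset.mem_cons_of_mem hp))

namespace IsContourFunctional

variable {T : Set ℂ} {L : (ℂ → ℂ) → ℂ}

theorem sum (hL : IsContourFunctional T L) {ι : Type*} (s : Finset ι) {f : ι → ℂ → ℂ}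
    (hf : ∀ i ∈ s, ContinuousOn (f i) T) :
    L (fun z => ∑ i ∈ s, f i z) = ∑ i ∈ s, L (f i) := by
  classical
  induction s using Finset.induction_on with
  | empty => simpa using hL.const_mul 0 0
  | insert a s ha ih =>
    simp only [Finset.sum_insert ha]
    rw [hL.add (hf a (Finset.mem_insert_self _ _)) (continuousOn_finsetSum _ fun i hi =>
      hf i (Finset.mem_insert_of_mem hi)), ih fun i hi => hf i (Finset.mem_insert_of_mem hi)]

/-- Vanishing of the residue at infinity. If two poles differ, partial fractions remove one factor;
if all coincide, there is a primitive. With two distinct simple factors left, the two terms cancel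
because all poles have the same weight `c`. -/
theorem prod_inv_eq_zero (hL : IsContourFunctional T L) {c : ℂ} (n : ℕ) :
    ∀ s : Multiset ℂ, s.card = n + 2 → (∀ p ∈ s, p ∉ T ∧ L (fun z => (z - p)⁻¹) = c) →
      L (fun z => (s.map fun p => (z - p)⁻¹).prod) = 0 := by
  induction n with
  | zero =>
    intro s hs h
    obtain ⟨a, b, rfl⟩ := Multiset.card_eq_two.1 hs
    have ha := h a (by simp)
    have hb := h b (by simp)
    by_cases hab : a = b
    · subst hab
      rw [← hL.inv_pow ha.1 0]
      congr 1; funext z; simp [pow_two]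
    · have e : ∀ z ∈ T, (({a, b} : Multiset ℂ).map fun p => (z - p)⁻¹).prod =
          (a - b)⁻¹ * ((z - a)⁻¹ + (-1) * (z - b)⁻¹) := by
        intro z hz
        have h1 : z - a ≠ 0 := sub_ne_zero.2 (ne_of_mem_of_not_mem hz ha.1)
        have h2 : z - b ≠ 0 := sub_ne_zero.2 (ne_of_mem_of_not_mem hz hb.1)
        have h3 : a - b ≠ 0 := sub_ne_zero.2 hab
        simp only [Multiset.insert_eq_cons, Multiset.map_cons, Multiset.map_singleton,
          Multiset.prod_cons, Multiset.prod_singleton]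
        field_simp
        ring
      rw [hL.congr e, hL.const_mul, hL.add (continuousOn_inv_sub ha.1)
        (continuousOn_const.fun_mul (continuousOn_inv_sub hb.1)), hL.const_mul, ha.2, hb.2]
      ring
  | succ n ih =>
    intro s hs h
    by_cases hall : ∃ a ∈ s, ∃ b ∈ s, a ≠ b
    · obtain ⟨a, has, b, hbs, hab⟩ := hall
      obtain ⟨s₁, rfl⟩ := Multiset.exists_cons_of_mem has
      rw [Multiset.mem_cons] at hbs
      obtain ⟨s₂, rfl⟩ := Multiset.exists_cons_of_mem (hbs.resolve_left hab.symm)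
      have ha := h a (by simp)
      have hb := h b (by simp)
      have hs2 : ∀ p ∈ s₂, p ∉ T ∧ L (fun z => (z - p)⁻¹) = c := fun p hp => h p (by simp [hp])
      have e : ∀ z ∈ T, ((a ::ₘ b ::ₘ s₂).map fun p => (z - p)⁻¹).prod =
          (a - b)⁻¹ * (((a ::ₘ s₂).map fun p => (z - p)⁻¹).prod +
            (-1) * ((b ::ₘ s₂).map fun p => (z - p)⁻¹).prod) := by
        intro z hz
        have h1 : z - a ≠ 0 := sub_ne_zero.2 (ne_of_mem_of_not_mem hz ha.1)
        have h2 : z - b ≠ 0 := sub_ne_zero.2 (ne_of_mem_of_not_mem hz hb.1)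
        have h3 : a - b ≠ 0 := sub_ne_zero.2 hab
        simp only [Multiset.map_cons, Multiset.prod_cons]
        field_simp
        ring
      simp only [Multiset.card_cons] at hs
      have ca : ∀ p ∈ a ::ₘ s₂, p ∉ T ∧ L (fun z => (z - p)⁻¹) = c := by
        intro p hp
        rcases Multiset.mem_cons.1 hp with rfl | hp
        exacts [ha, hs2 p hp]
      have cb : ∀ p ∈ b ::ₘ s₂, p ∉ T ∧ L (fun z => (z - p)⁻¹) = c := by
        intro p hp
        rcases Multiset.mem_cons.1 hp with rfl | hp
        exacts [hb, hs2 p hp]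
      rw [hL.congr e, hL.const_mul, hL.add (continuousOn_multiset_prod_inv fun p hp => (ca p hp).1)
        (continuousOn_const.fun_mul (continuousOn_multiset_prod_inv fun p hp => (cb p hp).1)),
        hL.const_mul, ih _ (by simp; omega) ca, ih _ (by simp; omega) cb]
      ring
    · push Not at hall
      obtain ⟨p, hp⟩ := Multiset.card_pos_iff_exists_mem.1 (by omega : 0 < s.card)
      have hrep : s = Multiset.replicate (n + 1 + 2) p :=
        Multiset.eq_replicate.2 ⟨hs, fun b hb => hall b hb p hp⟩
      rw [← hL.inv_pow (h p hp).1 (n + 1), hrep]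
      simp only [Multiset.map_replicate, Multiset.prod_replicate]

/-- Here the weights are 0, so growth at infinity is harmless: z = (z - p) + p lowers the power of z
until `prod_inv_eq_zero` or a primitive applies. -/
theorem pow_mul_prod_inv_eq_zero (hL : IsContourFunctional T L) (n : ℕ) :
    ∀ s : Multiset ℂ, (∀ p ∈ s, p ∉ T ∧ L (fun z => (z - p)⁻¹) = 0) →
      L (fun z => z ^ n * (s.map fun p => (z - p)⁻¹).prod) = 0 := by
  induction n with
  | zero =>
    intro s h
    simp only [pow_zero, one_mul]
    rcases hc : s.card with _ | _ | m
    · rw [Multiset.card_eq_zero.1 hc]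
      simpa using hL.pow 0
    · obtain ⟨p, rfl⟩ := Multiset.card_eq_one.1 hc
      simpa using (h p (by simp)).2
    · exact hL.prod_inv_eq_zero m s hc h
  | succ n ih =>
    intro s
    induction s using Multiset.induction_on with
    | empty => intro _; simpa using hL.pow (n + 1)
    | cons p s _ =>
      intro h
      have e : ∀ z ∈ T, z ^ (n + 1) * ((p ::ₘ s).map fun p => (z - p)⁻¹).prod =
          z ^ n * (s.map fun p => (z - p)⁻¹).prod +
            p * (z ^ n * ((p ::ₘ s).map fun p => (z - p)⁻¹).prod) := by
        intro z hz
        have h1 : z - p ≠ 0 := sub_ne_zero.2 (ne_of_mem_of_not_mem hz (h p (by simp)).1)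
        simp only [Multiset.map_cons, Multiset.prod_cons]
        field_simp
        ring
      have h2 : ∀ p ∈ s, p ∉ T ∧ L (fun z => (z - p)⁻¹) = 0 := fun p' hp =>
        h p' (Multiset.mem_cons_of_mem hp)
      have c1 : ContinuousOn (fun z : ℂ => z ^ n) T := by fun_prop
      rw [hL.congr e, hL.add (c1.fun_mul (continuousOn_multiset_prod_inv fun p hp => (h2 p hp).1))
        (continuousOn_const.fun_mul (c1.fun_mul (continuousOn_multiset_prod_inv fun p hp => (h p hp).1))),
        hL.const_mul, ih s h2, ih _ h]
      ring

/-- Cauchy's theorem for rational functions: the algebra is the linear span of the products treated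
above. Continuity is carried through the induction because `L` is additive only on continuous
functions. -/
theorem eq_zero_of_mem_Rat (hL : IsContourFunctional T L) {S : Set ℂ}
    (hS : ∀ p ∈ S, p ∉ T ∧ L (fun z => (z - p)⁻¹) = 0) {f : ℂ → ℂ} (hf : f ∈ Rat S) : L f = 0 := by
  suffices h : ContinuousOn f T ∧ L f = 0 from h.2
  rw [Rat, ← Subalgebra.mem_toSubmodule, Algebra.adjoin_eq_span] at hf
  induction hf using Submodule.span_induction with
  | mem f hf =>
    refine ⟨continuousOn_of_mem_Rat (S := S) (fun p hp => (hS p hp).1) ?_, ?_⟩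
    · exact Submonoid.closure_le.2 (Algebra.subset_adjoin (R := ℂ)) hf
    · suffices h : ∃ (n : ℕ) (s : Multiset ℂ), (∀ p ∈ s, p ∈ S) ∧
          f = fun z => z ^ n * (s.map fun p => (z - p)⁻¹).prod by
        obtain ⟨n, s, hs, rfl⟩ := h
        exact hL.pow_mul_prod_inv_eq_zero n s fun p hp => hS p (hs p hp)
      induction hf using Submonoid.closure_induction with
      | mem f hf =>
        rcases hf with rfl | ⟨a, ha, rfl⟩
        · exact ⟨1, 0, by simp, by simp⟩
        · exact ⟨0, {a}, by simpa using ha, by simp⟩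
      | one => exact ⟨0, 0, by simp, by ext; simp⟩
      | mul f g _ _ hf hg =>
        obtain ⟨n, s, hs, rfl⟩ := hf
        obtain ⟨m, t, ht, rfl⟩ := hg
        refine ⟨n + m, s + t, fun p hp => ?_, ?_⟩
        · rcases Multiset.mem_add.1 hp with hp | hp
          exacts [hs p hp, ht p hp]
        · ext z
          simp only [Pi.mul_apply, Multiset.map_add, Multiset.prod_add]
          ring
  | zero => exact ⟨continuousOn_const, by
      have := hL.const_mul 0 0
      simp only [zero_mul] at this
      exact this⟩
  | add f g _ _ hf hg =>
    exact ⟨hf.1.add hg.1, by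
      have := hL.add hf.1 hg.1
      rw [hf.2, hg.2, add_zero] at this
      exact this⟩
  | smul c f _ hf =>
    exact ⟨hf.1.const_smul c, by
      have := hL.const_mul c f
      rw [hf.2, mul_zero] at this
      exact this⟩

/-- All poles lie on the same side of the contour. A member of `BRat S` is bounded near infinity and
the two extra factors supply quadratic decay, so there is no residue at infinity. -/
theorem eq_zero_of_mem_BRat (hL : IsContourFunctional T L) {S : Set ℂ} {c : ℂ}
    (hS : ∀ p ∈ S, p ∉ T ∧ L (fun z => (z - p)⁻¹) = c) {a b : ℂ} (ha : a ∈ S) (hb : b ∈ S)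
    {f : ℂ → ℂ} (hf : f ∈ BRat S) : L (fun z => (z - a)⁻¹ * (z - b)⁻¹ * f z) = 0 := by
  suffices h : ContinuousOn f T ∧ L (fun z => (z - a)⁻¹ * (z - b)⁻¹ * f z) = 0 from h.2
  have hab : ContinuousOn (fun z => (z - a)⁻¹ * (z - b)⁻¹) T :=
    (continuousOn_inv_sub (hS a ha).1).mul (continuousOn_inv_sub (hS b hb).1)
  rw [BRat, ← Subalgebra.mem_toSubmodule, Algebra.adjoin_eq_span] at hf
  induction hf using Submodule.span_induction with
  | mem f hf =>
    refine ⟨continuousOn_of_mem_Rat (S := S) (fun p hp => (hS p hp).1) (BRat_le_Rat S ?_), ?_⟩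
    · exact Submonoid.closure_le.2 (Algebra.subset_adjoin (R := ℂ)) hf
    · suffices h : ∃ s : Multiset ℂ, (∀ p ∈ s, p ∈ S) ∧
          f = fun z => (s.map fun p => (z - p)⁻¹).prod by
        obtain ⟨s, hs, rfl⟩ := h
        have := hL.prod_inv_eq_zero (c := c) s.card (a ::ₘ b ::ₘ s) (by simp) ?_
        · rw [← this]
          congr 1; funext z; simp [mul_assoc]
        · intro p hp
          rcases Multiset.mem_cons.1 hp with rfl | hp
          · exact hS _ ha
          rcases Multiset.mem_cons.1 hp with rfl | hp
          exacts [hS _ hb, hS _ (hs p hp)]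
      induction hf using Submonoid.closure_induction with
      | mem f hf =>
        obtain ⟨a, ha, rfl⟩ := hf
        exact ⟨{a}, by simpa using ha, by simp⟩
      | one => exact ⟨0, by simp, by ext; simp⟩
      | mul f g _ _ hf hg =>
        obtain ⟨s, hs, rfl⟩ := hf
        obtain ⟨t, ht, rfl⟩ := hg
        refine ⟨s + t, fun p hp => ?_, ?_⟩
        · rcases Multiset.mem_add.1 hp with hp | hp
          exacts [hs p hp, ht p hp]
        · ext z
          simp only [Pi.mul_apply, Multiset.map_add, Multiset.prod_add]
  | zero => exact ⟨continuousOn_const, by simpa using hL.const_mul 0 0⟩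
  | add f g _ _ hf hg =>
    refine ⟨hf.1.add hg.1, ?_⟩
    have := hL.add (hab.fun_mul hf.1) (hab.fun_mul hg.1)
    rw [hf.2, hg.2, add_zero] at this
    simpa only [Pi.add_apply, mul_add] using this
  | smul d f _ hf =>
    refine ⟨hf.1.const_smul d, ?_⟩
    have := hL.const_mul d (fun z => (z - a)⁻¹ * (z - b)⁻¹ * f z)
    rw [hf.2, mul_zero] at this
    rw [← this]
    congr 1; funext z
    simp only [Pi.smul_apply, smul_eq_mul]
    ring

theorem eq_value_of_simple_pole (hL : IsContourFunctional T L) {S : Set ℂ}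
    (hS : ∀ p ∈ S, p ∉ T ∧ L (fun z => (z - p)⁻¹) = 0) {H : ℂ → ℂ} (hH : H ∈ Rat S) {a : ℂ}
    (haT : a ∉ T) (haS : a ∉ S) : L (fun z => H z * (z - a)⁻¹) = H a * L (fun z => (z - a)⁻¹) := by
  obtain ⟨g, hg, h⟩ := exists_quotient_of_mem_Rat haS hH
  have e : ∀ z ∈ T, H z * (z - a)⁻¹ = H a * (z - a)⁻¹ + g z := by
    intro z hz
    have h1 : z - a ≠ 0 := sub_ne_zero.2 (ne_of_mem_of_not_mem hz haT)
    rw [h z fun hzS => (hS z hzS).1 hz]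
    field_simp
  rw [hL.congr e, hL.add (continuousOn_const.fun_mul (continuousOn_inv_sub haT))
    (continuousOn_of_mem_Rat (fun p hp => (hS p hp).1) hg), hL.const_mul,
    hL.eq_zero_of_mem_Rat hS hg, add_zero]

/-- The residue theorem for simple poles `v i` enclosed once, the other poles not contributing. -/
theorem eq_sum_residues (hL : IsContourFunctional T L) {S : Set ℂ}
    (hS : ∀ p ∈ S, p ∉ T ∧ L (fun z => (z - p)⁻¹) = 0) {H : ℂ → ℂ} (hH : H ∈ Rat S)
    {ι : Type*} [DecidableEq ι] (s : Finset ι) {v : ι → ℂ} (hv : Set.InjOn v s)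
    (h1 : ∀ i ∈ s, v i ∉ T ∧ v i ∉ S ∧ L (fun z => (z - v i)⁻¹) = 1) :
    L (fun z => H z * ∏ i ∈ s, (z - v i)⁻¹) =
      ∑ i ∈ s, H (v i) * ∏ j ∈ s.erase i, (v i - v j)⁻¹ := by
  rcases s.eq_empty_or_nonempty with rfl | hne
  · simpa using hL.eq_zero_of_mem_Rat hS hH
  have e : ∀ z ∈ T, H z * ∏ i ∈ s, (z - v i)⁻¹ =
      ∑ i ∈ s, (∏ j ∈ s.erase i, (v i - v j)⁻¹) * (H z * (z - v i)⁻¹) := by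
    intro z hz
    have hz' : ∀ i ∈ s, z ≠ v i := fun i hi => ne_of_mem_of_not_mem hz (h1 i hi).1
    -- The partial fraction expansion of the product of the (z - v i)⁻¹ is Lagrange interpolation of
    -- the constant 1 at the nodes `v i`.
    have h := Lagrange.eval_interpolate_not_at_node (r := 1) hz'
    rw [Lagrange.interpolate_one hv hne, Polynomial.eval_one, Lagrange.eval_nodal] at h
    rw [Finset.prod_inv_distrib, ← eq_inv_of_mul_eq_one_right h.symm, Finset.mul_sum]
    refine Finset.sum_congr rfl fun i hi => ?_
    simp only [Lagrange.nodalWeight, Pi.one_apply]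
    ring
  have hHc := continuousOn_of_mem_Rat (fun p hp => (hS p hp).1) hH
  rw [hL.congr e, hL.sum s fun i hi => continuousOn_const.fun_mul
    (hHc.fun_mul (continuousOn_inv_sub (h1 i hi).1))]
  refine Finset.sum_congr rfl fun i hi => ?_
  rw [hL.const_mul, hL.eq_value_of_simple_pole hS hH (h1 i hi).1 (h1 i hi).2.1, (h1 i hi).2.2]
  ring

end IsContourFunctional

/-! ### Winding numbers -/

theorem exists_norm_cint_le (γ : Contour) :
    ∃ K : ℝ, ∀ (f : ℂ → ℂ) (M : ℝ), 0 ≤ M → (∀ z ∈ γ.range, ‖f z‖ ≤ M) → ‖cint γ f‖ ≤ K * M := by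
  obtain ⟨C, hC0, hC⟩ := γ.exists_deriv_bound
  refine ⟨‖(2 * Real.pi * Complex.I : ℂ)⁻¹‖ * C, fun f M hM hf => ?_⟩
  have h : ‖∫ t in Icc (0 : ℝ) 1, f (γ.toFun t) * deriv γ.toFun t‖ ≤
      C * M * volume.real (Icc (0 : ℝ) 1) := by
    refine norm_setIntegral_le_of_norm_le_const_ae' measure_Icc_lt_top ?_
    filter_upwards [hC] with t ht ht'
    rw [norm_mul, mul_comm]
    exact mul_le_mul (ht ht') (hf _ (γ.mem_range ht')) (norm_nonneg _) hC0
  rw [Real.volume_real_Icc_of_le zero_le_one, sub_zero, mul_one] at h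
  rw [cint, norm_mul]
  exact (mul_le_mul_of_nonneg_left h (norm_nonneg _)).trans_eq (mul_assoc _ _ _).symm

/-- First-order expansion of (z - a')⁻¹ in a' - a with exact remainder. The linear term has a
primitive and integrates to 0, so the difference is quadratic. -/
theorem winding_sub_winding (β : Contour) {a a' : ℂ} (ha : a ∉ β.range) (ha' : a' ∉ β.range) :
    β.winding a' - β.winding a =
      (a' - a) ^ 2 * cint β fun z => ((z - a)⁻¹) ^ 2 * (z - a')⁻¹ := by
  have hL := isContourFunctional_cint β
  have c1 := continuousOn_inv_sub ha
  have c2 := continuousOn_inv_sub ha'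
  have e : ∀ z ∈ β.range, (z - a')⁻¹ = (z - a)⁻¹ + ((a' - a) * ((z - a)⁻¹) ^ (0 + 2) +
      (a' - a) ^ 2 * (((z - a)⁻¹) ^ 2 * (z - a')⁻¹)) := by
    intro z hz
    have h1 : z - a ≠ 0 := sub_ne_zero.2 (ne_of_mem_of_not_mem hz ha)
    have h2 : z - a' ≠ 0 := sub_ne_zero.2 (ne_of_mem_of_not_mem hz ha')
    simp only [zero_add, inv_pow]
    field_simp
    ring
  rw [winding_eq_cint, winding_eq_cint, hL.congr e,
    hL.add c1 ((continuousOn_const.fun_mul (c1.fun_pow _)).fun_add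
      (continuousOn_const.fun_mul ((c1.fun_pow _).fun_mul c2))),
    hL.add (continuousOn_const.fun_mul (c1.fun_pow _))
      (continuousOn_const.fun_mul ((c1.fun_pow _).fun_mul c2)),
    hL.const_mul, hL.const_mul, hL.inv_pow ha]
  ring

theorem hasDerivAt_winding (β : Contour) {a : ℂ} (ha : a ∉ β.range) :
    HasDerivAt β.winding 0 a := by
  obtain ⟨K, hK⟩ := exists_norm_cint_le β
  obtain ⟨d, hd, hball⟩ := Metric.isOpen_iff.1 β.isCompact_range.isClosed.isOpen_compl a ha
  have hfar : ∀ z ∈ β.range, d ≤ ‖z - a‖ := by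
    intro z hz
    by_contra h
    exact hball (by simpa [dist_eq_norm] using h) hz
  have hO : (fun x => β.winding x - β.winding a) =O[𝓝 a] fun x => ‖x - a‖ ^ 2 := by
    refine Asymptotics.IsBigO.of_bound (K * ((d⁻¹) ^ 2 * (d / 2)⁻¹)) ?_
    filter_upwards [Metric.ball_mem_nhds a (half_pos hd)] with x hx
    have hx' : ‖x - a‖ < d / 2 := by simpa [dist_eq_norm] using hx
    have hfar' : ∀ z ∈ β.range, d / 2 ≤ ‖z - x‖ := by
      intro z hz
      have h1 := hfar z hz
      have h2 : ‖z - a‖ ≤ ‖z - x‖ + ‖x - a‖ := norm_sub_le_norm_sub_add_norm_sub _ _ _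
      linarith
    have hxr : x ∉ β.range := fun h => by
      have := hfar' x h
      simp at this
      linarith
    rw [winding_sub_winding β ha hxr, norm_mul, norm_pow, norm_pow, norm_norm, mul_comm]
    refine mul_le_mul_of_nonneg_right (hK _ _ (by positivity) fun z hz => ?_) (by positivity)
    rw [norm_mul, norm_pow, norm_inv, norm_inv]
    have h1 := hfar z hz
    have h2 := hfar' z hz
    gcongr
  have h : HasFDerivAt _ (0 : ℂ →L[ℂ] ℂ) a := hO.hasFDerivAt (by norm_num)
  have h' := h.hasDerivAt.add_const (β.winding a)
  simpa using h'

/-- The winding number of `β` has zero derivative off `β`, so it is constant along the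
parametrization of `α`; that it is an integer is never needed. -/
theorem winding_eq_of_mem_range {α β : Contour} (h : ∀ a ∈ α.range, a ∉ β.range) {a b : ℂ}
    (ha : a ∈ α.range) (hb : b ∈ α.range) : β.winding a = β.winding b := by
  suffices H : ∀ t ∈ Icc (0 : ℝ) 1, β.winding (α.toFun t) = β.winding (α.toFun 0) by
    obtain ⟨t, ht, rfl⟩ := ha
    obtain ⟨s, hs, rfl⟩ := hb
    rw [H t ht, H s hs]
  intro t ht
  obtain ⟨s, C, hs⟩ := α.piecewise
  have h := integral_eq_of_hasDerivAt_off_countable_of_le (fun t => β.winding (α.toFun t))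
    (fun _ => 0) ht.1 (s := s) s.countable_toSet ?_ ?_ (by simp)
  · rw [intervalIntegral.integral_zero] at h
    exact (sub_eq_zero.1 h.symm)
  · intro x hx
    have hx' : x ∈ Icc (0 : ℝ) 1 := ⟨hx.1, hx.2.trans ht.2⟩
    exact (hasDerivAt_winding β (h _ (α.mem_range hx'))).continuousAt.comp_continuousWithinAt
      ((α.continuousOn x hx').mono (Icc_subset_Icc_right ht.2))
  · intro x hx
    have hx' : x ∈ Ioo (0 : ℝ) 1 := ⟨hx.1.1, hx.1.2.trans_le ht.2⟩
    have hd : HasDerivAt α.toFun (deriv α.toFun x) x :=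
      ((hs x hx' hx.2).1.differentiableAt one_ne_zero).hasDerivAt
    have hc := (hasDerivAt_winding β (h _ (α.mem_range (Ioo_subset_Icc_self hx')))).comp x hd
    rw [zero_mul] at hc
    exact hc

/-- If `α` winds once around each point of the disjoint curve `β`, then `β` does not wind around
the points of `α`. -/
theorem winding_eq_zero_of_surrounds {α β : Contour} (h : ∀ b ∈ β.range, α.Contains b) :
    ∀ a ∈ α.range, β.Avoids a := by
  have hdis : ∀ a ∈ α.range, a ∉ β.range := fun a ha hb => (h a hb).1 ha
  intro a ha
  refine ⟨hdis a ha, ?_⟩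
  have hcont : ContinuousOn (fun p : ℂ × ℂ => (p.1 - p.2)⁻¹ * (p.2 - a)⁻¹)
      (α.range ×ˢ β.range) := by
    refine ContinuousOn.mul (ContinuousOn.inv₀ (by fun_prop) fun p hp => ?_)
      (ContinuousOn.inv₀ (by fun_prop) fun p hp => ?_)
    · exact sub_ne_zero.2 fun e => hdis _ hp.1 (e ▸ hp.2)
    · exact sub_ne_zero.2 fun e => hdis _ ha (e ▸ hp.2)
  -- The double integral is computed in both orders. With the integral over `β` inside, partial
  -- fractions give the difference of the windings of `β` around `a` and `z`, which is 0 since both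
  -- lie on `α`. With `α` inside, the factor (z - w)⁻¹ integrates to 1 and the winding of `β` around
  -- `a` remains.
  have hswap := cint_cint_swap (f := fun z w => (z - w)⁻¹ * (w - a)⁻¹) hcont
  have hL := isContourFunctional_cint β
  have h1 : ∀ z ∈ α.range, cint β (fun w => (z - w)⁻¹ * (w - a)⁻¹) = 0 := by
    intro z hz
    have cz := continuousOn_inv_sub (hdis z hz)
    have ca := continuousOn_inv_sub (hdis a ha)
    by_cases hza : z = a
    · subst hza
      have e : ∀ w ∈ β.range, (z - w)⁻¹ * (w - z)⁻¹ = (-1) * ((w - z)⁻¹) ^ (0 + 2) := by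
        intro w _
        rw [← neg_sub w z, inv_neg]
        ring
      rw [hL.congr e, hL.const_mul, hL.inv_pow (hdis z hz), mul_zero]
    · have e : ∀ w ∈ β.range, (z - w)⁻¹ * (w - a)⁻¹ =
          (z - a)⁻¹ * ((w - a)⁻¹ + (-1) * (w - z)⁻¹) := by
        intro w hw
        have e1 : w - a ≠ 0 := sub_ne_zero.2 (ne_of_mem_of_not_mem hw (hdis a ha))
        have e2 : w - z ≠ 0 := sub_ne_zero.2 (ne_of_mem_of_not_mem hw (hdis z hz))
        have e3 : z - a ≠ 0 := sub_ne_zero.2 hza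
        rw [← neg_sub w z, inv_neg]
        field_simp
        ring
      rw [hL.congr e, hL.const_mul, hL.add ca (continuousOn_const.fun_mul cz), hL.const_mul,
        ← winding_eq_cint, ← winding_eq_cint, winding_eq_of_mem_range hdis hz ha]
      ring
  have h2 : ∀ w ∈ β.range, cint α (fun z => (z - w)⁻¹ * (w - a)⁻¹) = (w - a)⁻¹ := by
    intro w hw
    simp only [mul_comm _ (w - a)⁻¹]
    rw [cint_const_mul, ← winding_eq_cint, (h w hw).2, mul_one]
  rw [cint_congr h1, cint_congr h2, ← winding_eq_cint] at hswap
  rw [← hswap]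
  simpa using cint_const_mul α 0 0

/-- If `α` surrounds `β` and `β` contains `p`, then `α` contains `p`. -/
theorem Contour.Contains.of_surrounds {α β : Contour} (h : ∀ b ∈ β.range, α.Contains b) {p : ℂ}
    (hp : β.Contains p) : α.Contains p := by
  have hdis := winding_eq_zero_of_surrounds h
  have hpα : p ∉ α.range := fun hpa => by
    have := (hdis p hpa).2
    rw [hp.2] at this
    exact one_ne_zero this
  refine ⟨hpα, ?_⟩
  have hcont : ContinuousOn (fun p' : ℂ × ℂ => (p'.1 - p'.2)⁻¹ * (p'.2 - p)⁻¹)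
      (α.range ×ˢ β.range) := by
    refine ContinuousOn.mul (ContinuousOn.inv₀ (by fun_prop) fun p' hp' => ?_)
      (ContinuousOn.inv₀ (by fun_prop) fun p' hp' => ?_)
    · exact sub_ne_zero.2 fun e => (hdis _ hp'.1).1 (e ▸ hp'.2)
    · exact sub_ne_zero.2 fun e => hp.1 (e ▸ hp'.2)
  -- Now `β` contains `p` and avoids `z`, so the two orders of integration give the windings of `α`
  -- and of `β` around `p`.
  have hswap := cint_cint_swap (f := fun z w => (z - w)⁻¹ * (w - p)⁻¹) hcont
  have hL := isContourFunctional_cint β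
  have h1 : ∀ z ∈ α.range, cint β (fun w => (z - w)⁻¹ * (w - p)⁻¹) = (z - p)⁻¹ := by
    intro z hz
    have e3 : z - p ≠ 0 := sub_ne_zero.2 (ne_of_mem_of_not_mem hz hpα)
    have e : ∀ w ∈ β.range, (z - w)⁻¹ * (w - p)⁻¹ =
        (z - p)⁻¹ * ((w - p)⁻¹ + (-1) * (w - z)⁻¹) := by
      intro w hw
      have e1 : w - p ≠ 0 := sub_ne_zero.2 (ne_of_mem_of_not_mem hw hp.1)
      have e2 : w - z ≠ 0 := sub_ne_zero.2 (ne_of_mem_of_not_mem hw (hdis z hz).1)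
      rw [← neg_sub w z, inv_neg]
      field_simp
      ring
    rw [hL.congr e, hL.const_mul, hL.add (continuousOn_inv_sub hp.1)
      (continuousOn_const.fun_mul (continuousOn_inv_sub (hdis z hz).1)), hL.const_mul,
      ← winding_eq_cint, ← winding_eq_cint, (hdis z hz).2, hp.2]
    ring
  have h2 : ∀ w ∈ β.range, cint α (fun z => (z - w)⁻¹ * (w - p)⁻¹) = (w - p)⁻¹ := by
    intro w hw
    simp only [mul_comm _ (w - p)⁻¹]
    rw [cint_const_mul, ← winding_eq_cint, (h w hw).2, mul_one]
  rw [cint_congr h1, cint_congr h2, ← winding_eq_cint, ← winding_eq_cint, hp.2] at hswap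
  exact hswap

/-- The contour `cγ`. -/
def Contour.scale (c : ℂ) (γ : Contour) : Contour where
  toFun t := c * γ.toFun t
  continuousOn := continuousOn_const.mul γ.continuousOn
  closed := by rw [γ.closed]
  piecewise := by
    obtain ⟨s, C, h⟩ := γ.piecewise
    refine ⟨s, ‖c‖ * C, fun t ht hts => ?_⟩
    obtain ⟨h1, h2⟩ := h t ht hts
    refine ⟨contDiffAt_const.mul h1, ?_⟩
    rw [deriv_const_mul _ (h1.differentiableAt one_ne_zero), norm_mul]
    exact mul_le_mul_of_nonneg_left h2 (norm_nonneg _)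

theorem Contour.mem_range_scale {c : ℂ} (hc : c ≠ 0) {γ : Contour} {p : ℂ} :
    c * p ∈ (γ.scale c).range ↔ p ∈ γ.range := by
  simp [Contour.range, Contour.scale, hc]

theorem Contour.range_scale {c : ℂ} {γ : Contour} :
    (γ.scale c).range = (fun z => c * z) '' γ.range := by
  simp [Contour.range, Contour.scale, image_image]

theorem Contour.winding_scale {c : ℂ} (hc : c ≠ 0) (γ : Contour) (p : ℂ) :
    (γ.scale c).winding (c * p) = γ.winding p := by
  rw [winding, winding]
  congr 1
  refine intervalIntegral.integral_congr fun t _ => ?_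
  simp only [scale]
  have : deriv (fun t => c * γ.toFun t) t = c * deriv γ.toFun t := deriv_const_mul_field c
  rw [this, ← mul_sub, mul_inv]
  field_simp

/-- The points a/q are the poles in the inner variable of the factor 1/(z_A - q z_B). Surrounding
the scaled curve qβ by α and undoing the scaling shows that they are not enclosed. -/
theorem avoids_div_of_nested {q : ℂ} (hq : q ≠ 0) {α β : Contour}
    (h : ∀ w ∈ β.range, α.Contains (q * w)) {a : ℂ} (ha : a ∈ α.range) : β.Avoids (a / q) := by
  have h' : ∀ b ∈ (β.scale q).range, α.Contains b := by
    rw [Contour.range_scale]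
    rintro _ ⟨w, hw, rfl⟩
    exact h w hw
  have h2 := winding_eq_zero_of_surrounds h' a ha
  rw [← mul_div_cancel₀ a hq] at h2
  rwa [Contour.Avoids, Contour.mem_range_scale hq, Contour.winding_scale hq] at h2

theorem contains_mul_of_nested {q : ℂ} (hq : q ≠ 0) {α β : Contour}
    (h : ∀ w ∈ β.range, α.Contains (q * w)) {p : ℂ} (hp : β.Contains p) : α.Contains (q * p) := by
  have h' : ∀ b ∈ (β.scale q).range, α.Contains b := by
    rw [Contour.range_scale]
    rintro _ ⟨w, hw, rfl⟩
    exact h w hw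
  refine Contour.Contains.of_surrounds h' ?_
  rwa [Contour.Contains, Contour.mem_range_scale hq, Contour.winding_scale hq]

/-- The parametrization of a contour agrees with that of a circle around `1`. -/
def Contour.IsCircle (γ : Contour) (r : ℝ) : Prop :=
  0 < r ∧ ∀ t ∈ Icc (0 : ℝ) 1, γ.toFun t = circleMap 1 r (2 * Real.pi * t)

theorem Contour.IsCircle.range_eq {γ : Contour} {r : ℝ} (h : γ.IsCircle r) :
    γ.range = Metric.sphere 1 r := by
  ext z
  constructor
  · rintro ⟨t, ht, rfl⟩
    rw [h.2 t ht]
    exact circleMap_mem_sphere _ h.1.le _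
  · intro hz
    rw [← abs_of_pos h.1, ← image_circleMap_Ioc] at hz
    obtain ⟨θ, hθ, rfl⟩ := hz
    have hp : (0 : ℝ) < 2 * Real.pi := by positivity
    have ht : θ / (2 * Real.pi) ∈ Icc (0 : ℝ) 1 :=
      ⟨by have := hθ.1; positivity, by rw [div_le_one hp]; exact hθ.2⟩
    refine ⟨_, ht, ?_⟩
    rw [h.2 _ ht, mul_div_cancel₀ _ hp.ne']

/-- For p outside the disc, (z - 1)/(p - 1) has norm less than 1 on the circle, so log(1 - (z -
1)/(p - 1)) is a single-valued primitive of 1/(z - p). -/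
theorem Contour.IsCircle.avoids {γ : Contour} {r : ℝ} (h : γ.IsCircle r) {p : ℂ}
    (hp : p ∉ Metric.closedBall (1 : ℂ) r) : γ.Avoids p := by
  have hpr : p ∉ γ.range := fun hpr => hp (Metric.sphere_subset_closedBall (h.range_eq ▸ hpr))
  refine ⟨hpr, ?_⟩
  rw [Metric.mem_closedBall, not_le, dist_eq_norm] at hp
  have hp1 : p - 1 ≠ 0 := norm_pos_iff.1 (h.1.trans hp)
  rw [winding_eq_cint]
  refine cint_eq_zero_of_hasDerivAt (F := fun z => Complex.log (1 + -(z - 1) / (p - 1)))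
    (fun z hz => ?_) (continuousOn_inv_sub hpr)
  have hz1 : ‖z - 1‖ = r := by simpa [h.range_eq, dist_eq_norm] using hz
  have hzp : z - p ≠ 0 := sub_ne_zero.2 (ne_of_mem_of_not_mem hz hpr)
  have hs : 1 + -(z - 1) / (p - 1) ∈ Complex.slitPlane := by
    refine Complex.mem_slitPlane_of_norm_lt_one ?_
    rw [norm_div, norm_neg, hz1, div_lt_one (h.1.trans hp)]
    exact hp
  have hd := ((((hasDerivAt_id z).sub_const 1).neg.div_const (p - 1)).const_add 1).clog hs
  refine hd.congr_deriv ?_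
  have e : 1 + -(z - 1) / (p - 1) = -(z - p) / (p - 1) := by field_simp; ring
  simp only [id, Pi.neg_apply] at *
  rw [e]
  field_simp

/-! ### Antisymmetric polynomials -/

section Antisymmetric

open MvPolynomial

variable {k : ℕ}

/-- The change of variables `X_a ↦ X_a + c X_b`. -/
def shear (a b : Fin k) (c : ℂ) : MvPolynomial (Fin k) ℂ →ₐ[ℂ] MvPolynomial (Fin k) ℂ :=
  aeval fun i => if i = a then X a + C c * X b else X i

theorem shear_comp {a b : Fin k} (hab : a ≠ b) (c d : ℂ) (h : c + d = 0) :
    (shear a b c).comp (shear a b d) = AlgHom.id ℂ _ := by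
  ext1 i
  by_cases hi : i = a
  · subst hi
    have h1 : shear i b c (X i) = X i + C c * X b := by simp [shear]
    have h2 : shear i b c (X b) = X b := by simp [shear, hab.symm]
    have h3 : shear i b d (X i) = X i + C d * X b := by simp [shear]
    have h4 : shear i b c (C d) = C d := (shear i b c).commutes d
    rw [AlgHom.comp_apply, h3, map_add, map_mul, h1, h2, h4, add_assoc, ← add_mul, ← C_add, h]
    simp
  · simp [shear, hi]

/-- The shear X_a ↦ X_a - X_b is an automorphism of the polynomial ring, so primality is inherited
from the variable X_a. -/
theorem prime_X_sub_X {a b : Fin k} (hab : a ≠ b) :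
    Prime (X a - X b : MvPolynomial (Fin k) ℂ) := by
  let e : MvPolynomial (Fin k) ℂ ≃ₐ[ℂ] MvPolynomial (Fin k) ℂ :=
    AlgEquiv.ofAlgHom (shear a b (-1)) (shear a b 1) (shear_comp hab _ _ (by ring))
      (shear_comp hab _ _ (by ring))
  have h : e (X a) = X a - X b := by
    simp [e, shear]
    ring
  rw [← h]
  exact (MulEquiv.prime_iff (e : MvPolynomial (Fin k) ℂ ≃* MvPolynomial (Fin k) ℂ)).2 X_prime

theorem X_sub_X_dvd_sub_rename_swap (a b : Fin k) (N : MvPolynomial (Fin k) ℂ) :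
    (X a - X b : MvPolynomial (Fin k) ℂ) ∣ N - rename (Equiv.swap a b) N := by
  induction N using MvPolynomial.induction_on with
  | C c => simp
  | add p r hp hr =>
    rw [map_add]
    convert! dvd_add hp hr using 1
    ring
  | mul_X p i hp =>
    rw [map_mul, rename_X]
    have e : p * X i - rename (Equiv.swap a b) p * X (Equiv.swap a b i) =
        (p - rename (Equiv.swap a b) p) * X i +
          rename (Equiv.swap a b) p * (X i - X (Equiv.swap a b i)) := by ring
    rw [e]
    refine dvd_add (hp.mul_right _) (Dvd.dvd.mul_left ?_ _)
    by_cases hi : i = a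
    · subst hi; simp
    by_cases hi' : i = b
    · subst hi'
      rw [Equiv.swap_apply_right]
      exact ⟨-1, by ring⟩
    · simp [Equiv.swap_apply_of_ne_of_ne hi hi']

/-- The factors X_i - X_j are pairwise coprime primes, so each may be treated alone; exchanging i
and j changes the sign of N, hence X_i - X_j divides N - (-N) = 2N. -/
theorem vandermonde_dvd_of_antisymmetric {N : MvPolynomial (Fin k) ℂ}
    (hN : ∀ τ : Equiv.Perm (Fin k), rename τ N = C ((Equiv.Perm.sign τ : ℤ) : ℂ) * N) :
    (∏ j, ∏ i ∈ Finset.Iio j, (X i - X j) : MvPolynomial (Fin k) ℂ) ∣ N := by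
  rw [Finset.prod_sigma']
  refine Finset.prod_dvd_of_isRelPrime ?_ ?_
  · rintro ⟨j, i⟩ hx ⟨j', i'⟩ hx' hne
    simp only [Finset.coe_sigma, Finset.coe_univ, Finset.coe_Iio, Set.mem_sigma_iff,
      Set.mem_univ, Set.mem_Iio, true_and] at hx hx'
    simp only [Function.onFun]
    rw [(prime_X_sub_X hx.ne).irreducible.isRelPrime_iff_not_dvd]
    rintro ⟨Q, hQ⟩
    -- The evaluation point has equal coordinates at `i` and `j` only: 0 there, and distinct
    -- positive values elsewhere. So no difference belonging to another pair vanishes at it.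
    have h := congrArg (eval fun l : Fin k => if l = i ∨ l = j then (0 : ℂ) else (l : ℕ) + 1) hQ
    simp only [map_sub, map_mul, eval_X, true_or, or_true, if_true, sub_self, zero_mul,
      sub_eq_zero] at h
    have hpos : ∀ l : Fin k, ((l : ℕ) : ℂ) + 1 ≠ 0 := fun l => Nat.cast_add_one_ne_zero _
    split_ifs at h with h1 h2 h2
    · rcases h1 with rfl | rfl <;> rcases h2 with rfl | rfl
      · exact lt_irrefl _ hx'
      · exact hne rfl
      · exact lt_asymm hx hx'
      · exact lt_irrefl _ hx'
    · exact hpos _ h.symm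
    · exact hpos _ h
    · have : i' = j' := by
        apply Fin.ext
        exact_mod_cast add_right_cancel h
      exact hx'.ne this
  · rintro ⟨j, i⟩ hx
    have hij : i < j := by simpa using hx
    have h := X_sub_X_dvd_sub_rename_swap i j N
    rw [hN, Equiv.Perm.sign_swap hij.ne] at h
    have e : N - C (((-1 : ℤˣ) : ℤ) : ℂ) * N = C 2 * N := by
      have : (C (2 : ℂ) : MvPolynomial (Fin k) ℂ) = 2 := rfl
      simp [this]
      ring
    rw [e] at h
    have h' := h.mul_left (C (2⁻¹ : ℂ))
    rwa [← mul_assoc, ← C_mul, inv_mul_cancel₀ two_ne_zero, C_1, one_mul] at h'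

/-- Symmetrizing a polynomial over the Vandermonde product gives a polynomial. -/
theorem exists_polynomial_of_symmetrization (R : Fin k → Fin k → MvPolynomial (Fin k) ℂ)
    (hR : ∀ (τ : Equiv.Perm (Fin k)) a b, rename τ (R a b) = R (τ a) (τ b)) (m : Fin k → ℕ) :
    ∃ Q : MvPolynomial (Fin k) ℂ, ∀ u : Fin k → ℂ, Function.Injective u →
      ∑ σ : Equiv.Perm (Fin k), (∏ A, ∏ B ∈ Finset.Iio A,
        eval u (R (σ A) (σ B)) / (u (σ B) - u (σ A))) * ∏ j, u (σ j) ^ m j = eval u Q := by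
  set N : MvPolynomial (Fin k) ℂ := ∑ σ : Equiv.Perm (Fin k), C ((Equiv.Perm.sign σ : ℤ) : ℂ) *
    ((∏ A, ∏ B ∈ Finset.Iio A, R (σ A) (σ B)) * ∏ j, X (σ j) ^ m j) with hNdef
  have hN : ∀ τ : Equiv.Perm (Fin k), rename τ N = C ((Equiv.Perm.sign τ : ℤ) : ℂ) * N := by
    intro τ
    rw [hNdef, map_sum, Finset.mul_sum, ← Equiv.sum_comp (Equiv.mulLeft τ)
      (fun σ : Equiv.Perm (Fin k) => C ((Equiv.Perm.sign τ : ℤ) : ℂ) *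
        (C ((Equiv.Perm.sign σ : ℤ) : ℂ) *
          ((∏ A, ∏ B ∈ Finset.Iio A, R (σ A) (σ B)) * ∏ j, X (σ j) ^ m j)))]
    refine Finset.sum_congr rfl fun σ _ => ?_
    have hs : (((Equiv.Perm.sign τ : ℤ) : ℂ)) * (((Equiv.Perm.sign (τ * σ) : ℤˣ) : ℤ) : ℂ) =
        ((Equiv.Perm.sign σ : ℤ) : ℂ) := by
      rw [Equiv.Perm.sign_mul, Units.val_mul, Int.cast_mul, ← mul_assoc, ← Int.cast_mul,
        ← Units.val_mul, Int.units_mul_self]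
      simp
    simp only [Equiv.coe_mulLeft, ← mul_assoc, ← C_mul, hs]
    simp only [map_mul, map_prod, map_pow, rename_C, rename_X, hR, Equiv.Perm.mul_apply]
  obtain ⟨Q, hQ⟩ := vandermonde_dvd_of_antisymmetric hN
  refine ⟨Q, fun u hu => ?_⟩
  have hV : (∏ j, ∏ i ∈ Finset.Iio j, (u i - u j)) ≠ 0 :=
    Finset.prod_ne_zero_iff.2 fun j _ => Finset.prod_ne_zero_iff.2 fun i hi =>
      sub_ne_zero.2 fun h => (Finset.mem_Iio.1 hi).ne (hu h)
  have h := congrArg (eval u) hQ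
  rw [map_mul, map_prod] at h
  simp only [map_prod, map_sub, eval_X] at h
  rw [← mul_right_inj' hV, ← h, hNdef, map_sum, Finset.mul_sum]
  refine Finset.sum_congr rfl fun σ _ => ?_
  -- The denominator of the σ-th term is the common Vandermonde product up to the sign of σ, which
  -- is the sign built into `N`.
  have hσ := σ.prod_Iio_comp_eq_sign_mul_prod (f := fun i j => u i - u j) fun i j => by ring
  have hs2 : (((Equiv.Perm.sign σ : ℤ) : ℂ)) * ((Equiv.Perm.sign σ : ℤ) : ℂ) = 1 := by
    rw [← Int.cast_mul, ← Units.val_mul, Int.units_mul_self]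
    simp
  have hσ' : ∏ j, ∏ i ∈ Finset.Iio j, (u i - u j) =
      ((Equiv.Perm.sign σ : ℤ) : ℂ) * ∏ j, ∏ i ∈ Finset.Iio j, (u (σ i) - u (σ j)) := by
    rw [hσ, ← mul_assoc, hs2, one_mul]
  have hV' : (∏ j, ∏ i ∈ Finset.Iio j, (u (σ i) - u (σ j))) ≠ 0 := by
    intro h0
    rw [hσ', h0, mul_zero] at hV
    exact hV rfl
  simp only [Finset.prod_div_distrib, map_mul, map_prod, map_pow, eval_X, eval_C]
  rw [hσ']
  field_simp

end Antisymmetric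

/-! ### Products over pairs -/

theorem prod_prod_eq_prod_Iio {k : ℕ} {M : Type*} [CommMonoid M] (h : Fin k → Fin k → M)
    (h1 : ∀ a, h a a = 1) :
    ∏ a, ∏ b, h a b = ∏ a, ∏ b ∈ Finset.Iio a, (h a b * h b a) := by
  have e : ∀ a, ∏ b, h a b = (∏ b ∈ Finset.Iio a, h a b) * ∏ b ∈ Finset.Ioi a, h a b := by
    intro a
    have hd : Disjoint (Finset.Iio a) (Finset.Ioi a) := by
      rw [Finset.disjoint_left]
      intro b hb hb'
      exact lt_asymm (Finset.mem_Iio.1 hb) (Finset.mem_Ioi.1 hb')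
    rw [← Finset.prod_union hd]
    refine (Finset.prod_subset (Finset.subset_univ _) fun b _ hb => ?_).symm
    simp only [Finset.mem_union, Finset.mem_Iio, Finset.mem_Ioi, not_or, not_lt] at hb
    rw [le_antisymm hb.2 hb.1, h1]
  simp only [e, Finset.prod_mul_distrib]
  congr 1
  exact Finset.prod_comm' (by simp)

/-- Reindexing a product over pairs by a permutation. -/
theorem prod_Iio_comp_perm {k : ℕ} {M : Type*} [CommMonoid M] (g : Fin k → Fin k → M)
    (σ : Equiv.Perm (Fin k)) :
    ∏ A, ∏ B ∈ Finset.Iio A, g (σ A) (σ B) =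
      ∏ a, ∏ b ∈ Finset.Iio a, if σ.symm b < σ.symm a then g a b else g b a := by
  have e1 : ∏ A, ∏ B ∈ Finset.Iio A, g (σ A) (σ B) =
      ∏ A, ∏ B, if B < A then g (σ A) (σ B) else 1 := by
    refine Finset.prod_congr rfl fun A _ => ?_
    rw [← Finset.prod_filter]
    refine Finset.prod_congr ?_ fun _ _ => rfl
    ext; simp
  have e2 : ∏ A, ∏ B, (if B < A then g (σ A) (σ B) else 1) =
      ∏ a, ∏ b, if σ.symm b < σ.symm a then g a b else 1 := by
    rw [← Equiv.prod_comp σ fun a => ∏ b, if σ.symm b < σ.symm a then g a b else 1]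
    refine Finset.prod_congr rfl fun A _ => ?_
    rw [← Equiv.prod_comp σ fun b => if σ.symm b < σ.symm (σ A) then g (σ A) b else 1]
    simp
  rw [e1, e2, prod_prod_eq_prod_Iio _ fun a => by simp]
  refine Finset.prod_congr rfl fun a _ => Finset.prod_congr rfl fun b hb => ?_
  have hne : σ.symm b ≠ σ.symm a := fun h => (Finset.mem_Iio.1 hb).ne (σ.symm.injective h)
  rcases lt_or_gt_of_ne hne with h | h
  · rw [if_pos h, if_neg h.not_gt, if_pos h, mul_one]
  · rw [if_neg h.not_gt, if_pos h, if_neg h.not_gt, one_mul]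

/-! ### Bethe sums -/

/-- The Bethe ansatz sum, of which the eigenfunctions are multiples. -/
def bethe (q : ℂ) (ν : ℝ) {k : ℕ} (n : Fin k → ℤ) (z : Fin k → ℂ) : ℂ :=
  ∑ σ : Equiv.Perm (Fin k),
    (∏ A, ∏ B ∈ Finset.Iio A, (z (σ A) - q * z (σ B)) / (z (σ A) - z (σ B))) *
      ∏ j, xi ν (z (σ j)) ^ n j

/-- The power of q supplies one factor q per pair, and q(z_A - z_B/q)/(z_A - z_B) = (z_B - q
z_A)/(z_B - z_A). Reversing the order of the positions restores the shape of the left eigenfunction,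
with reversed exponents. -/
theorem eigenRFormula_eq_bethe {q : ℂ} (hq : q ≠ 0) (ν : ℝ) {k : ℕ} (n : WeylChamber k)
    (z : Fin k → ℂ) : eigenRFormula q ν n z =
      (-1) ^ k * (1 - q) ^ k * stat q ν n * bethe q ν (fun j => n.1 j.rev) z := by
  have hpow : q ^ (k * (k - 1) / 2) = ∏ A : Fin k, ∏ B ∈ Finset.Iio A, q := by
    simp only [Finset.prod_const, Fin.card_Iio]
    rw [Finset.prod_pow_eq_pow_sum, Fin.sum_univ_eq_sum_range (fun i => i) k, Finset.sum_range_id]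
  have hterm : ∀ σ : Equiv.Perm (Fin k), q ^ (k * (k - 1) / 2) *
      (∏ A, ∏ B ∈ Finset.Iio A, (z (σ A) - q⁻¹ * z (σ B)) / (z (σ A) - z (σ B))) =
      ∏ A, ∏ B ∈ Finset.Iio A, (z (σ B) - q * z (σ A)) / (z (σ B) - z (σ A)) := by
    intro σ
    rw [hpow]
    simp only [← Finset.prod_mul_distrib]
    refine Finset.prod_congr rfl fun A _ => Finset.prod_congr rfl fun B _ => ?_
    rw [← neg_div_neg_eq (z (σ B) - q * z (σ A)), ← mul_div_assoc]
    congr 1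
    · field_simp
      ring
    · ring
  have hrev : ∀ σ : Equiv.Perm (Fin k),
      ∏ A, ∏ B ∈ Finset.Iio A, (z (σ B) - q * z (σ A)) / (z (σ B) - z (σ A)) =
      ∏ A, ∏ B ∈ Finset.Iio A, (z ((σ * (Fin.revPerm : Equiv.Perm (Fin k))) A) - q * z ((σ * (Fin.revPerm : Equiv.Perm (Fin k))) B)) /
        (z ((σ * (Fin.revPerm : Equiv.Perm (Fin k))) A) - z ((σ * (Fin.revPerm : Equiv.Perm (Fin k))) B)) := by
    intro σ
    have := prod_Iio_comp_perm (fun a b => (z (σ a) - q * z (σ b)) / (z (σ a) - z (σ b)))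
      Fin.revPerm
    simp only [Equiv.Perm.mul_apply]
    rw [this]
    refine Finset.prod_congr rfl fun A _ => Finset.prod_congr rfl fun B hB => ?_
    rw [if_neg]
    simpa using (Finset.mem_Iio.1 hB).le
  rw [eigenRFormula, bethe, mul_assoc _ (q ^ _) _, mul_comm (q ^ _) (stat q ν n), ← mul_assoc,
    mul_assoc _ (q ^ _), Finset.mul_sum,
    ← Equiv.sum_comp (Equiv.mulRight (Fin.revPerm : Equiv.Perm (Fin k)))
      fun σ : Equiv.Perm (Fin k) =>
        (∏ A, ∏ B ∈ Finset.Iio A, (z (σ A) - q * z (σ B)) / (z (σ A) - z (σ B))) *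
          ∏ j, xi ν (z (σ j)) ^ n.1 j.rev]
  congr 1
  refine Finset.sum_congr rfl fun σ _ => ?_
  rw [← mul_assoc, hterm, hrev]
  refine congrArg₂ (· * ·) rfl ?_
  rw [← Equiv.prod_comp Fin.revPerm]
  simp

theorem bethe_comp_perm (q : ℂ) (ν : ℝ) {k : ℕ} (n : Fin k → ℤ) (z : Fin k → ℂ)
    (τ : Equiv.Perm (Fin k)) : bethe q ν n (z ∘ τ) = bethe q ν n z := by
  exact Equiv.sum_comp (Equiv.mulLeft τ) fun σ : Equiv.Perm (Fin k) =>
    (∏ A, ∏ B ∈ Finset.Iio A, (z (σ A) - q * z (σ B)) / (z (σ A) - z (σ B))) *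
      ∏ j, xi ν (z (σ j)) ^ n j

/-! ### Laurent polynomials -/

theorem one_sub_nu_ne_zero {ν : ℝ} (hν : ν < 1) : (1 - ν : ℂ) ≠ 0 := by
  rw [sub_ne_zero]
  exact_mod_cast hν.ne'

theorem one_sub_nu_mul_xi {ν : ℝ} {z : ℂ} (hz : (ν : ℂ) * z ≠ 1) :
    1 - ν * xi ν z = (1 - ν) / (1 - ν * z) := by
  have : 1 - (ν : ℂ) * z ≠ 0 := sub_ne_zero.2 hz.symm
  rw [xi]
  field_simp
  ring

theorem xi_sub_xi {ν : ℝ} {z w : ℂ} (hz : (ν : ℂ) * z ≠ 1) (hw : (ν : ℂ) * w ≠ 1) :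
    xi ν w - xi ν z = (1 - ν) * (z - w) / ((1 - ν * z) * (1 - ν * w)) := by
  have h1 : 1 - (ν : ℂ) * z ≠ 0 := sub_ne_zero.2 hz.symm
  have h2 : 1 - (ν : ℂ) * w ≠ 0 := sub_ne_zero.2 hw.symm
  have h1' : 1 - z * (ν : ℂ) ≠ 0 := by rwa [mul_comm]
  have h2' : 1 - w * (ν : ℂ) ≠ 0 := by rwa [mul_comm]
  rw [xi, xi]
  field_simp
  ring

theorem xi_ne_zero {ν : ℝ} {z : ℂ} (h1 : z ≠ 1) (h2 : (ν : ℂ) * z ≠ 1) : xi ν z ≠ 0 :=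
  div_ne_zero (sub_ne_zero.2 h1.symm) (sub_ne_zero.2 h2.symm)

theorem xi_injOn {ν : ℝ} (hν : ν < 1) {z w : ℂ} (hz : (ν : ℂ) * z ≠ 1) (hw : (ν : ℂ) * w ≠ 1)
    (h : xi ν z = xi ν w) : z = w := by
  have h1 : 1 - (ν : ℂ) * z ≠ 0 := sub_ne_zero.2 hz.symm
  have h2 : 1 - (ν : ℂ) * w ≠ 0 := sub_ne_zero.2 hw.symm
  have e := xi_sub_xi hz hw
  rw [h, sub_self] at e
  have := one_sub_nu_ne_zero hν
  simpa [h1, h2, this, sub_eq_zero] using e.symm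

/-- Substituting z = (1 - ξ)/(1 - νξ), the ratio becomes a polynomial in ξ(z), ξ(w) over ξ(w) -
ξ(z), which is the shape required by `exists_polynomial_of_symmetrization`. -/
theorem pair_ratio_eq {ν : ℝ} (hν : ν < 1) (q : ℂ) {z w : ℂ} (hz : (ν : ℂ) * z ≠ 1)
    (hw : (ν : ℂ) * w ≠ 1) (hne : z ≠ w) :
    (z - q * w) / (z - w) = ((1 - ν : ℂ)⁻¹ * ((1 - xi ν z) * (1 - ν * xi ν w) -
      q * ((1 - xi ν w) * (1 - ν * xi ν z)))) / (xi ν w - xi ν z) := by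
  have h1 : 1 - (ν : ℂ) * z ≠ 0 := sub_ne_zero.2 hz.symm
  have h2 : 1 - (ν : ℂ) * w ≠ 0 := sub_ne_zero.2 hw.symm
  have h3 := one_sub_nu_ne_zero hν
  have h4 : z - w ≠ 0 := sub_ne_zero.2 hne
  have e : ∀ x : ℂ, 1 - (ν : ℂ) * x ≠ 0 → 1 - xi ν x = (1 - ν) * x / (1 - ν * x) := by
    intro x hx
    have hx' : 1 - x * (ν : ℂ) ≠ 0 := by rwa [mul_comm]
    rw [xi]
    field_simp
    ring
  have h1' : 1 - z * (ν : ℂ) ≠ 0 := by rwa [mul_comm]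
  have h2' : 1 - w * (ν : ℂ) ≠ 0 := by rwa [mul_comm]
  rw [xi_sub_xi hz hw, one_sub_nu_mul_xi hz, one_sub_nu_mul_xi hw, e z h1, e w h2]
  field_simp

theorem laurentEval_eq_linearCombination (ν : ℝ) {k : ℕ} (P : (Fin k → ℤ) →₀ ℂ) (z : Fin k → ℂ) :
    laurentEval ν P z = Finsupp.linearCombination ℂ (fun m => ∏ j, xi ν (z j) ^ m j) P := rfl

theorem laurentEval_smul (ν : ℝ) {k : ℕ} (c : ℂ) (P : (Fin k → ℤ) →₀ ℂ) (z : Fin k → ℂ) :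
    laurentEval ν (c • P) z = c * laurentEval ν P z := by
  simp [laurentEval_eq_linearCombination]

theorem exists_laurent_bethe {ν : ℝ} (hν : ν < 1) (q : ℂ) {k : ℕ} (n : Fin k → ℤ) :
    ∃ P : (Fin k → ℤ) →₀ ℂ, ∀ z ∈ specDomain ν k, Function.Injective z →
      bethe q ν n z = laurentEval ν P z := by
  -- A common shift makes all exponents natural numbers; the monomial ∏ ξ(z_j)^(-M) compensating it
  -- is symmetric and so leaves the sum over permutations.
  obtain ⟨M, hM⟩ : ∃ M : ℕ, ∀ j, 0 ≤ n j + M := by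
    refine ⟨∑ j, (n j).natAbs, fun j => ?_⟩
    have : (n j).natAbs ≤ ∑ j, (n j).natAbs :=
      Finset.single_le_sum (f := fun j => (n j).natAbs) (fun _ _ => Nat.zero_le _)
        (Finset.mem_univ j)
    omega
  obtain ⟨Q, hQ⟩ := exists_polynomial_of_symmetrization
    (fun a b : Fin k => MvPolynomial.C (1 - ν : ℂ)⁻¹ *
      ((1 - MvPolynomial.X a) * (1 - MvPolynomial.C (ν : ℂ) * MvPolynomial.X b) -
        MvPolynomial.C q * ((1 - MvPolynomial.X b) *
          (1 - MvPolynomial.C (ν : ℂ) * MvPolynomial.X a))))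
    (fun τ a b => by simp) (fun j => (n j + M).toNat)
  refine ⟨∑ m ∈ Q.support, Finsupp.single (fun j => (m j : ℤ) - M) (Q.coeff m), fun z hz hinj => ?_⟩
  have hu : Function.Injective fun j => xi ν (z j) := fun i j h =>
    hinj (xi_injOn hν (hz i).2 (hz j).2 h)
  have h0 : ∀ j, xi ν (z j) ≠ 0 := fun j => xi_ne_zero (hz j).1 (hz j).2
  have hprod : ∀ m : Fin k → ℤ, ∏ j, xi ν (z j) ^ (m j - M) =
      (∏ j, xi ν (z j) ^ (-(M : ℤ))) * ∏ j, xi ν (z j) ^ m j := by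
    intro m
    rw [← Finset.prod_mul_distrib]
    refine Finset.prod_congr rfl fun j _ => ?_
    rw [← zpow_add₀ (h0 j)]
    congr 1
    ring
  have hL : laurentEval ν (∑ m ∈ Q.support, Finsupp.single (fun j => (m j : ℤ) - M) (Q.coeff m)) z =
      (∏ j, xi ν (z j) ^ (-(M : ℤ))) * MvPolynomial.eval (fun j => xi ν (z j)) Q := by
    rw [laurentEval_eq_linearCombination, map_sum, MvPolynomial.eval_eq', Finset.mul_sum]
    refine Finset.sum_congr rfl fun m _ => ?_
    rw [Finsupp.linearCombination_single, hprod fun j => (m j : ℤ)]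
    simp only [zpow_natCast, smul_eq_mul]
    ring
  rw [hL, ← hQ _ hu, bethe, Finset.mul_sum]
  refine Finset.sum_congr rfl fun σ _ => ?_
  have e1 : ∏ j, xi ν (z (σ j)) ^ n j =
      (∏ j, xi ν (z j) ^ (-(M : ℤ))) * ∏ j, xi ν (z (σ j)) ^ (n j + M).toNat := by
    rw [← Equiv.prod_comp σ fun j => xi ν (z j) ^ (-(M : ℤ)), ← Finset.prod_mul_distrib]
    refine Finset.prod_congr rfl fun j _ => ?_
    rw [← zpow_natCast, ← zpow_add₀ (h0 _), Int.toNat_of_nonneg (hM j)]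
    congr 1
    ring
  have e2 : ∀ A, ∀ B ∈ Finset.Iio A, (z (σ A) - q * z (σ B)) / (z (σ A) - z (σ B)) =
      ((1 - ν : ℂ)⁻¹ * ((1 - xi ν (z (σ A))) * (1 - ν * xi ν (z (σ B))) -
      q * ((1 - xi ν (z (σ B))) * (1 - ν * xi ν (z (σ A)))))) /
        (xi ν (z (σ B)) - xi ν (z (σ A))) := fun A B hB =>
    pair_ratio_eq hν q (hz _).2 (hz _).2 fun h =>
      (Finset.mem_Iio.1 hB).ne (σ.injective (hinj h.symm))
  rw [e1, Finset.prod_congr rfl fun A _ => Finset.prod_congr rfl (e2 A)]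
  simp only [map_mul, map_sub, map_one, MvPolynomial.eval_C, MvPolynomial.eval_X]
  ring

/-! ### Density of the points with distinct coordinates -/

/-- Perturb z_j to z_j + t j. Each pair of coordinates coincides for at most one t, and that t is
either 0, which is excluded, or away from 0. -/
theorem mem_closure_injective {k : ℕ} (z : Fin k → ℂ) :
    z ∈ closure {z : Fin k → ℂ | Function.Injective z} := by
  have hc : Tendsto (fun t : ℝ => fun j : Fin k => z j + t * (j : ℕ)) (𝓝[≠] 0) (𝓝 z) := by
    have : Continuous (fun t : ℝ => fun j : Fin k => z j + t * (j : ℕ)) := by fun_prop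
    have h := this.tendsto 0
    simp only [Complex.ofReal_zero, zero_mul, add_zero] at h
    exact h.mono_left nhdsWithin_le_nhds
  refine mem_closure_of_tendsto hc ?_
  have h : ∀ i j : Fin k, i ≠ j →
      ∀ᶠ t : ℝ in 𝓝[≠] 0, z i + t * (i : ℕ) ≠ z j + t * (j : ℕ) := by
    intro i j hij
    have hne : ((i : ℕ) : ℂ) - (j : ℕ) ≠ 0 := by
      rw [sub_ne_zero]
      exact_mod_cast fun h => hij (Fin.ext h)
    have hfin : {t : ℝ | z i + t * (i : ℕ) = z j + t * (j : ℕ)}.Subsingleton := by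
      intro t ht s hs
      have h1 : ((t : ℂ) - s) * ((i : ℕ) - (j : ℕ)) = 0 := by
        simp only [mem_ofPred_eq] at ht hs
        linear_combination ht - hs
      have h2 := (mul_eq_zero.1 h1).resolve_right hne
      exact_mod_cast sub_eq_zero.1 h2
    by_cases h0 : z i = z j
    · filter_upwards [self_mem_nhdsWithin] with t ht heq
      exact ht (hfin heq (by simp [h0]))
    · refine nhdsWithin_le_nhds ?_
      have c1 : Continuous fun t : ℝ => z i + t * (i : ℕ) := by fun_prop
      have c2 : Continuous fun t : ℝ => z j + t * (j : ℕ) := by fun_prop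
      exact (isOpen_ne_fun c1 c2).mem_nhds (by simpa using h0)
  have h' : ∀ᶠ t : ℝ in 𝓝[≠] 0, ∀ i j : Fin k, i ≠ j →
      z i + t * (i : ℕ) ≠ z j + t * (j : ℕ) := by
    simp only [eventually_all]
    exact h
  filter_upwards [h'] with t ht i j hij
  by_contra hne
  exact ht i j hne hij

/-- Identities with denominators z_i - z_j are checked off the diagonals and carried to them by
continuity through this lemma. -/
theorem eq_of_eq_on_injective {k : ℕ} {U : Set (Fin k → ℂ)} (hU : IsOpen U)
    {f g : (Fin k → ℂ) → ℂ} (hf : ContinuousOn f U) (hg : ContinuousOn g U)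
    (h : ∀ z ∈ U, Function.Injective z → f z = g z) : ∀ z ∈ U, f z = g z := by
  intro z hz
  have := mem_closure_iff_nhdsWithin_neBot.1 (mem_closure_injective z)
  have hUn := hU.mem_nhds hz
  refine tendsto_nhds_unique_of_eventuallyEq
    ((hf.continuousAt hUn).tendsto.mono_left nhdsWithin_le_nhds)
    ((hg.continuousAt hUn).tendsto.mono_left nhdsWithin_le_nhds)
    (l := 𝓝[{z : Fin k → ℂ | Function.Injective z}] z) ?_
  filter_upwards [self_mem_nhdsWithin, nhdsWithin_le_nhds hUn] with w hw hwU using h w hwU hw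

theorem isOpen_specDomain (ν : ℝ) (k : ℕ) : IsOpen (specDomain ν k) := by
  have : specDomain ν k = ⋂ j, {z : Fin k → ℂ | z j ≠ 1} ∩ {z | (ν : ℂ) * z j ≠ 1} := by
    ext z; simp [specDomain]
  rw [this]
  exact isOpen_iInter_of_finite fun j => (isOpen_ne_fun (by fun_prop) continuous_const).inter
    (isOpen_ne_fun (by fun_prop) continuous_const)

theorem specDomain_comp_perm {ν : ℝ} {k : ℕ} (σ : Equiv.Perm (Fin k)) {z : Fin k → ℂ} :
    z ∘ σ ∈ specDomain ν k ↔ z ∈ specDomain ν k :=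
  ⟨fun h j => by simpa using h (σ.symm j), fun h j => h (σ j)⟩

theorem continuousOn_xi (ν : ℝ) (k : ℕ) (j : Fin k) :
    ContinuousOn (fun z : Fin k → ℂ => xi ν (z j)) (specDomain ν k) := by
  simp only [xi]
  exact ContinuousOn.div (by fun_prop) (by fun_prop) fun z hz => sub_ne_zero.2 (hz j).2.symm

theorem continuousOn_laurentEval (ν : ℝ) {k : ℕ} (P : (Fin k → ℤ) →₀ ℂ) :
    ContinuousOn (laurentEval ν P) (specDomain ν k) := by
  refine continuousOn_finsetSum _ fun m _ => continuousOn_const.mul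
    (continuousOn_finsetProd _ fun j _ => ?_)
  exact (continuousOn_xi ν k j).zpow₀ _ fun z hz => Or.inl (xi_ne_zero (hz j).1 (hz j).2)

theorem extendDiag_eq {ν : ℝ} {k : ℕ} {F : (Fin k → ℂ) → ℂ} {P : (Fin k → ℤ) →₀ ℂ}
    (h : ∀ z ∈ specDomain ν k, Function.Injective z → F z = laurentEval ν P z) {z : Fin k → ℂ}
    (hz : z ∈ specDomain ν k) : extendDiag ν F z = laurentEval ν P z := by
  rw [extendDiag, indicator_of_mem hz]
  refine extendFrom_eq (mem_closure_injective z) ?_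
  have hc := ((continuousOn_laurentEval ν P).continuousAt
    ((isOpen_specDomain ν k).mem_nhds hz)).tendsto
  refine (hc.mono_left nhdsWithin_le_nhds).congr' ?_
  filter_upwards [self_mem_nhdsWithin, nhdsWithin_le_nhds ((isOpen_specDomain ν k).mem_nhds hz)]
    with w hw hw' using (h w hw' hw).symm

theorem extendDiag_bethe_mem_Cz {ν : ℝ} (hν : ν < 1) (q c : ℂ) {k : ℕ} (n : Fin k → ℤ) :
    extendDiag ν (fun z => c * bethe q ν n z) ∈ Cz ν k := by
  obtain ⟨P, hP⟩ := exists_laurent_bethe hν q n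
  have hcP := laurentEval_smul ν c P
  have hP' : ∀ z ∈ specDomain ν k, Function.Injective z →
      c * bethe q ν n z = laurentEval ν (c • P) z := fun z hz hi => by rw [hP z hz hi, hcP]
  refine ⟨fun σ z => ?_, ⟨c • P, fun z hz => extendDiag_eq hP' hz⟩,
    fun z hz => indicator_of_notMem hz _⟩
  by_cases hz : z ∈ specDomain ν k
  · rw [extendDiag_eq hP' ((specDomain_comp_perm σ).2 hz), extendDiag_eq hP' hz]
    refine eq_of_eq_on_injective (isOpen_specDomain ν k) (f := fun z => laurentEval ν (c • P) (z ∘ σ))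
      ((continuousOn_laurentEval ν _).comp (by fun_prop) fun z hz => (specDomain_comp_perm σ).2 hz)
      (continuousOn_laurentEval ν _) (fun w hw hi => ?_) z hz
    rw [← hP' w hw hi, ← hP' _ ((specDomain_comp_perm σ).2 hw) (hi.comp σ.injective),
      bethe_comp_perm]
  · rw [extendDiag, indicator_of_notMem hz, indicator_of_notMem
      (mt (specDomain_comp_perm σ).1 hz)]

theorem extendDiag_bethe_of_injective {ν : ℝ} (hν : ν < 1) (q c : ℂ) {k : ℕ} (n : Fin k → ℤ)
    {z : Fin k → ℂ} (hz : z ∈ specDomain ν k) (hi : Function.Injective z) :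
    extendDiag ν (fun z => c * bethe q ν n z) z = c * bethe q ν n z := by
  obtain ⟨P, hP⟩ := exists_laurent_bethe hν q n
  have hcP := laurentEval_smul ν c P
  rw [extendDiag_eq (P := c • P) (fun z hz hi => by rw [hP z hz hi, hcP]) hz, hcP, hP z hz hi]

theorem eigenR_eq {q : ℂ} (hq : q ≠ 0) (ν : ℝ) {k : ℕ} (n : WeylChamber k) :
    eigenR q ν n = extendDiag ν fun z =>
      (-1) ^ k * (1 - q) ^ k * stat q ν n * bethe q ν (fun j => n.1 j.rev) z := by
  rw [eigenR]
  congr 1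
  funext z
  exact eigenRFormula_eq_bethe hq ν n z

theorem eigenL_eq (q : ℂ) (ν : ℝ) {k : ℕ} (n : WeylChamber k) :
    eigenL q ν n = extendDiag ν fun z => 1 * bethe q ν (fun j => -n.1 j) z := by
  simp only [one_mul]
  rfl

theorem eigenR_mem_Cz {q : ℂ} (hq : q ≠ 0) {ν : ℝ} (hν : ν < 1) {k : ℕ} (n : WeylChamber k) :
    eigenR q ν n ∈ Cz ν k := eigenR_eq hq ν n ▸ extendDiag_bethe_mem_Cz hν q _ _

theorem direct_eq_sum (q : ℂ) (ν : ℝ) {k : ℕ} (f : Wc k) {s : Finset (WeylChamber k)}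
    (hs : ∀ n, f.1 n ≠ 0 → n ∈ s) :
    direct q ν k f = ∑ n ∈ s, f.1 n • eigenR q ν n := by
  funext z
  rw [Finset.sum_apply]
  refine finsum_eq_sum_of_support_subset _ fun n hn => hs n fun h => hn (by simp [h])

theorem direct_mem_Cz {q : ℂ} (hq : q ≠ 0) {ν : ℝ} (hν : ν < 1) {k : ℕ} (f : Wc k) :
    direct q ν k f ∈ Cz ν k := by
  rw [direct_eq_sum q ν f (s := Set.Finite.toFinset f.2) fun n hn =>
    (Set.Finite.mem_toFinset _).2 hn]
  exact Submodule.sum_mem _ fun n _ => Submodule.smul_mem _ _ (eigenR_mem_Cz hq hν n)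

/-! ### The swapping operator -/

theorem qPoch_ne_zero {a q : ℂ} (ha : ‖a‖ < 1) (hq : ‖q‖ < 1) (n : ℕ) : qPoch a q n ≠ 0 := by
  refine Finset.prod_ne_zero_iff.2 fun j _ => sub_ne_zero.2 fun h => ?_
  have h1 : ‖a * q ^ j‖ = 1 := by rw [← h, norm_one]
  rw [norm_mul, norm_pow] at h1
  have h2 : ‖q‖ ^ j ≤ 1 := pow_le_one₀ (norm_nonneg _) hq.le
  nlinarith [norm_nonneg a]

theorem stat_ne_zero {q : ℂ} (hq : ‖q‖ < 1) {ν : ℝ} (hν0 : 0 ≤ ν) (hν1 : ν < 1) {k : ℕ}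
    (n : WeylChamber k) : stat q ν n ≠ 0 := by
  refine Finset.prod_ne_zero_iff.2 fun v _ => div_ne_zero (qPoch_ne_zero ?_ hq _)
    (qPoch_ne_zero hq hq _)
  rwa [Complex.norm_real, Real.norm_of_nonneg hν0]

theorem stat_reflPt (q : ℂ) (ν : ℝ) {k : ℕ} (n : WeylChamber k) :
    stat q ν (reflPt n) = stat q ν n := by
  have himg : Finset.univ.image (reflPt n).1 = (Finset.univ.image n.1).image fun v => -v := by
    ext v
    simp only [reflPt, Finset.mem_image, Finset.mem_univ, true_and, exists_exists_eq_and]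
    exact ⟨fun ⟨j, hj⟩ => ⟨j.rev, hj⟩, fun ⟨j, hj⟩ => ⟨j.rev, by simpa using hj⟩⟩
  have hcard : ∀ v, (Finset.univ.filter fun j => (reflPt n).1 j = -v).card =
      (Finset.univ.filter fun j => n.1 j = v).card := fun v =>
    Finset.card_equiv Fin.revPerm fun j => by simp [reflPt]
  rw [stat, himg, Finset.prod_image fun _ _ _ _ h => neg_injective h]
  simp only [hcard]
  rfl

/-- The reflection of n undoes the reversal of exponents in `eigenR_eq`, and `stat` is invariant
under it, so the prefactors cancel. -/
theorem swap_eigenR {q : ℂ} (hq0 : q ≠ 0) (hq1 : ‖q‖ < 1) {ν : ℝ} (hν0 : 0 ≤ ν) (hν1 : ν < 1)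
    {k : ℕ} (z : Fin k → ℂ) :
    swap q ν k (fun n => eigenR q ν n z) = fun n => eigenL q ν n z := by
  funext n
  have hq : (1 - q) ^ k ≠ 0 := by
    refine pow_ne_zero _ (sub_ne_zero.2 ?_)
    rintro rfl
    simp at hq1
  have hs := stat_ne_zero hq1 hν0 hν1 n
  have hneg : ((-1 : ℂ) ^ k) * (-1) ^ k = 1 := by rw [← mul_pow]; simp
  change (-1) ^ k * ((1 - q) ^ k)⁻¹ * (stat q ν n)⁻¹ * eigenR q ν (reflPt n) z = _
  by_cases hz : z ∈ specDomain ν k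
  · obtain ⟨P, hP⟩ := exists_laurent_bethe hν1 q (fun j => -n.1 j)
    have hcP := fun c => laurentEval_smul ν c P
    rw [eigenR_eq hq0, eigenL_eq]
    simp only [reflPt, Fin.rev_rev]
    rw [extendDiag_eq (P := ((-1) ^ k * (1 - q) ^ k * stat q ν (reflPt n)) • P)
      (fun z hz hi => by rw [hcP, ← hP z hz hi]; rfl) hz,
      extendDiag_eq (P := P) (fun z hz hi => by rw [one_mul, hP z hz hi]) hz, hcP, stat_reflPt]
    field_simp
    linear_combination laurentEval ν P z * hneg
  · simp [eigenR, eigenL, extendDiag, indicator_of_notMem hz]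

/-! ### Symmetrization over clusters -/

/-- The leading coefficient 1 of ∏ (X - q v_a) is computed by Lagrange interpolation at the nodes 0
and v_p. The node 0 contributes q^|s|; at v_p the factor v_p - q v_p over v_p - 0 leaves 1 - q.
`Option` adjoins the node 0. -/
theorem sum_prod_ratio_of_ne_zero {ι : Type*} [DecidableEq ι] {q : ℂ} (s : Finset ι) {v : ι → ℂ}
    (hv : Set.InjOn v s) (h0 : ∀ i ∈ s, v i ≠ 0) :
    (1 - q) * ∑ p ∈ s, ∏ a ∈ s.erase p, (v p - q * v a) / (v p - v a) = 1 - q ^ s.card := by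
  set Q : Polynomial ℂ := ∏ a ∈ s, (Polynomial.X - Polynomial.C (q * v a)) with hQ
  have hmonic : Q.Monic := Polynomial.monic_prod_of_monic _ _ fun a _ => Polynomial.monic_X_sub_C _
  have hdeg : Q.degree = s.card := by
    rw [hQ, Polynomial.degree_prod]
    simp [-map_mul, Polynomial.degree_X_sub_C]
  set w : Option ι → ℂ := fun o => o.elim 0 v with hw
  have hinj : Set.InjOn w (Finset.insertNone s : Finset (Option ι)) := by
    rintro (_ | i) hi (_ | j) hj h
    · rfl
    · simp only [hw, Option.elim_none, Option.elim_some] at h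
      exact absurd h.symm (h0 j (by simpa using hj))
    · simp only [hw, Option.elim_none, Option.elim_some] at h
      exact absurd h (h0 i (by simpa using hi))
    · simp only [hw, Option.elim_some] at h
      rw [hv (by simpa using hi) (by simpa using hj) h]
  have h := Lagrange.leadingCoeff_eq_sum hinj (P := Q) (by
    rw [hdeg, Finset.card_insertNone]; norm_cast)
  rw [hmonic.leadingCoeff] at h
  have hev : ∀ x, Q.eval x = ∏ a ∈ s, (x - q * v a) := fun x => by
    rw [hQ, Polynomial.eval_prod]; simp
  have hnone : (Finset.insertNone s).erase none = s.map Function.Embedding.some := by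
    ext (_ | i) <;> simp
  have hsome : ∀ p ∈ s, (Finset.insertNone s).erase (some p) = Finset.insertNone (s.erase p) := by
    intro p _
    ext (_ | i) <;> simp
  have hsum : ∀ F : Option ι → ℂ, ∑ i ∈ Finset.insertNone s, F i = F none + ∑ p ∈ s, F (some p) :=
    fun F => by
      rw [← Finset.add_sum_erase _ F (a := none) (by simp), hnone, Finset.sum_map]
      rfl
  rw [hsum, hnone, Finset.prod_map, hev] at h
  have e0 : (∏ a ∈ s, (w none - q * v a)) / ∏ x ∈ s, (w none - w (Function.Embedding.some x)) =
      q ^ s.card := by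
    rw [← Finset.prod_div_distrib, Finset.prod_congr rfl (g := fun _ => q), Finset.prod_const]
    intro a ha
    have := h0 a ha
    simp only [hw, Option.elim_none, Function.Embedding.some_apply, Option.elim_some, zero_sub]
    field_simp
  have e1 : ∀ p ∈ s, Q.eval (w (some p)) / ∏ j ∈ (Finset.insertNone s).erase (some p),
      (w (some p) - w j) = (1 - q) * ∏ a ∈ s.erase p, (v p - q * v a) / (v p - v a) := by
    intro p hp
    have hne : ∏ a ∈ s.erase p, (v p - v a) ≠ 0 := Finset.prod_ne_zero_iff.2 fun a ha =>
      sub_ne_zero.2 fun e => (Finset.ne_of_mem_erase ha)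
        (hv hp (Finset.mem_of_mem_erase ha) e).symm
    have := h0 p hp
    rw [hsome p hp, hev, Finset.prod_insertNone, Finset.prod_div_distrib,
      ← Finset.mul_prod_erase s _ hp]
    simp only [hw, Option.elim_none, Option.elim_some, sub_zero]
    field_simp
  rw [e0, Finset.sum_congr rfl e1, ← Finset.mul_sum] at h
  linear_combination -h

/-- If v_i = 0, the i-th term is q^(|s| - 1) and i contributes the factor 1 to every other term,
which reduces the sum to the nonzero values. -/
theorem sum_prod_ratio {ι : Type*} [DecidableEq ι] {q : ℂ} (s : Finset ι) {v : ι → ℂ}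
    (hv : Set.InjOn v s) :
    (1 - q) * ∑ p ∈ s, ∏ a ∈ s.erase p, (v p - q * v a) / (v p - v a) = 1 - q ^ s.card := by
  by_cases h0 : ∀ i ∈ s, v i ≠ 0
  · exact sum_prod_ratio_of_ne_zero s hv h0
  push Not at h0
  obtain ⟨i, hi, hvi⟩ := h0
  have hne : ∀ a ∈ s.erase i, v a ≠ 0 := fun a ha h =>
    Finset.ne_of_mem_erase ha (hv (Finset.mem_of_mem_erase ha) hi (h.trans hvi.symm))
  have h := sum_prod_ratio_of_ne_zero (q := q) (s.erase i)
    (hv.mono (Finset.coe_subset.2 (Finset.erase_subset _ _))) hne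
  have e0 : ∏ a ∈ s.erase i, (v i - q * v a) / (v i - v a) = q ^ (s.erase i).card := by
    rw [Finset.prod_congr rfl (g := fun _ => q), Finset.prod_const]
    intro a ha
    have := hne a ha
    rw [hvi]
    field_simp
    ring
  have e1 : ∀ p ∈ s.erase i, ∏ a ∈ s.erase p, (v p - q * v a) / (v p - v a) =
      ∏ a ∈ (s.erase i).erase p, (v p - q * v a) / (v p - v a) := by
    intro p hp
    have hip : i ∈ s.erase p := Finset.mem_erase.2 ⟨(Finset.ne_of_mem_erase hp).symm, hi⟩
    rw [← Finset.mul_prod_erase _ _ hip, hvi, Finset.erase_right_comm]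
    have := hne p hp
    simp [this]
  rw [← Finset.add_sum_erase s _ hi, e0, Finset.sum_congr rfl e1, mul_add, h,
    ← Finset.card_erase_add_one hi, pow_succ]
  ring

theorem prod_Iio_succ {k : ℕ} {M : Type*} [CommMonoid M] (h : Fin (k + 1) → Fin (k + 1) → M) :
    ∏ A, ∏ B ∈ Finset.Iio A, h A B =
      (∏ A : Fin k, h A.succ 0) * ∏ A : Fin k, ∏ B ∈ Finset.Iio A, h A.succ B.succ := by
  have e : ∀ {m : ℕ} (A : Fin m) (f : Fin m → M),
      ∏ B ∈ Finset.Iio A, f B = ∏ B, if B < A then f B else 1 := by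
    intro m A f
    rw [← Finset.prod_filter]
    refine Finset.prod_congr ?_ fun _ _ => rfl
    ext; simp
  simp only [e]
  rw [Fin.prod_univ_succ]
  simp only [Fin.not_lt_zero, if_false, Finset.prod_const_one, one_mul]
  rw [← Finset.prod_mul_distrib]
  refine Finset.prod_congr rfl fun A _ => ?_
  rw [Fin.prod_univ_succ]
  simp

theorem prod_Iio_castSucc {k : ℕ} {M : Type*} [CommMonoid M] (h : Fin (k + 1) → Fin (k + 1) → M) :
    ∏ A, ∏ B ∈ Finset.Iio A, h A B =
      (∏ A : Fin k, ∏ B ∈ Finset.Iio A, h A.castSucc B.castSucc) *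
        ∏ B : Fin k, h (Fin.last k) B.castSucc := by
  have e : ∀ {m : ℕ} (A : Fin m) (f : Fin m → M),
      ∏ B ∈ Finset.Iio A, f B = ∏ B, if B < A then f B else 1 := by
    intro m A f
    rw [← Finset.prod_filter]
    refine Finset.prod_congr ?_ fun _ _ => rfl
    ext; simp
  simp only [e]
  rw [Fin.prod_univ_castSucc]
  congr 1
  · refine Finset.prod_congr rfl fun A _ => ?_
    rw [Fin.prod_univ_castSucc]
    simp [(Fin.castSucc_lt_last A).not_gt]
  · rw [Fin.prod_univ_castSucc]
    simp

/-- The number of later indices in the cluster of `i`. -/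
def laterCount {k : ℕ} (x : Fin k → ℤ) (i : Fin k) : ℕ :=
  (Finset.univ.filter fun j => i < j ∧ x j = x i).card

theorem laterCount_succ {k : ℕ} (x : Fin (k + 1) → ℤ) (i : Fin k) :
    laterCount x i.succ = laterCount (fun j => x j.succ) i := by
  simp only [laterCount]
  rw [Fin.card_filter_univ_succ]
  simp

theorem laterCount_zero {k : ℕ} (x : Fin (k + 1) → ℤ) :
    (Finset.univ.filter fun j => x j = x 0).card = laterCount x 0 + 1 := by
  simp only [laterCount]
  rw [Fin.card_filter_univ_succ, Fin.card_filter_univ_succ]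
  simp

theorem laterCount_castSucc {k : ℕ} (x : Fin (k + 1) → ℤ) (i : Fin k) :
    laterCount x i.castSucc = laterCount (fun j => x j.castSucc) i +
      if x (Fin.last k) = x i.castSucc then 1 else 0 := by
  simp only [laterCount, Finset.card_filter]
  rw [Fin.sum_univ_castSucc]
  simp [Fin.castSucc_lt_last]

theorem laterCount_last {k : ℕ} (x : Fin (k + 1) → ℤ) : laterCount x (Fin.last k) = 0 := by
  simp only [laterCount, Finset.card_eq_zero, Finset.filter_eq_empty_iff]
  intro j _ h
  exact absurd (Fin.le_last j) (not_le.2 h.1)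

/-- The counts of later elements run once through 0, …, |s| - 1. This turns q-Pochhammer products
over clusters into products over single indices. -/
theorem prod_card_later {k : ℕ} {M : Type*} [CommMonoid M] (g : ℕ → M) (s : Finset (Fin k)) :
    ∏ i ∈ s, g (s.filter fun j => i < j).card = ∏ j ∈ Finset.range s.card, g j := by
  induction s using Finset.induction_on_min with
  | empty => simp
  | insert a s ha ih =>
    have has : a ∉ s := fun h => lt_irrefl _ (ha a h)
    rw [Finset.prod_insert has, Finset.card_insert_of_notMem has, Finset.prod_range_succ, ← ih,
      mul_comm]
    congr 1
    · refine Finset.prod_congr rfl fun i hi => ?_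
      rw [Finset.filter_insert, if_neg (ha i hi).not_gt]
    · rw [Finset.filter_insert, if_neg (lt_irrefl a), Finset.filter_true_of_mem ha]

theorem stat_eq_prod (q : ℂ) (ν : ℝ) {k : ℕ} (n : WeylChamber k) :
    stat q ν n = ∏ i, (1 - ν * q ^ laterCount n.1 i) / (1 - q ^ (laterCount n.1 i + 1)) := by
  rw [stat, ← Finset.prod_fiberwise_of_maps_to (s := Finset.univ)
    (t := Finset.univ.image n.1) (g := n.1) fun i _ => Finset.mem_image_of_mem _ (Finset.mem_univ i)]
  refine Finset.prod_congr rfl fun v _ => ?_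
  have h := prod_card_later (fun c => (1 - ν * q ^ c) / (1 - q ^ (c + 1)))
    (Finset.univ.filter fun j => n.1 j = v)
  rw [qPoch, qPoch, ← Finset.prod_div_distrib]
  simp only [← pow_succ']
  rw [← h]
  refine Finset.prod_congr rfl fun i hi => ?_
  rw [Finset.filter_filter]
  simp only [laterCount, (Finset.mem_filter.1 hi).2, and_comm]

/-- Symmetrization over the permutations preserving the clusters. -/
theorem sum_cluster_perm {q : ℂ} (hq : q ≠ 1) : ∀ {k : ℕ} (x : Fin k → ℤ) {z : Fin k → ℂ},
    Function.Injective z →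
    ∑ σ : Equiv.Perm (Fin k), (if x ∘ σ = x then ∏ A, ∏ B ∈ Finset.Iio A,
      (if x B = x A then (z (σ B) - q * z (σ A)) / (z (σ B) - z (σ A)) else 1) else 0) =
    ∏ i, (1 - q ^ (laterCount x i + 1)) / (1 - q) := by
  intro k
  induction k with
  | zero => intro x z _; simp [Subsingleton.elim (x ∘ _) x]
  | succ k ih =>
    intro x z hz
    have hq' : 1 - q ≠ 0 := sub_ne_zero.2 hq.symm
    rw [Fin.prod_univ_succ]
    simp only [laterCount_succ]
    -- A permutation is split into p = σ 0 and a permutation of the remaining indices. For p in the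
    -- cluster of 0 the inner sum is the induction hypothesis for the permuted points, times the
    -- factors of pairs containing position 0.
    rw [← Equiv.sum_comp Equiv.Perm.decomposeFin.symm, Fintype.sum_prod_type]
    set K := ∏ i, (1 - q ^ (laterCount (fun j => x (Fin.succ j)) i + 1)) / (1 - q) with hK
    have hp : ∀ p : Fin (k + 1), ∑ σ' : Equiv.Perm (Fin k),
        (if x ∘ (Equiv.Perm.decomposeFin.symm (p, σ')) = x then ∏ A, ∏ B ∈ Finset.Iio A,
          (if x B = x A then (z (Equiv.Perm.decomposeFin.symm (p, σ') B) -
            q * z (Equiv.Perm.decomposeFin.symm (p, σ') A)) /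
            (z (Equiv.Perm.decomposeFin.symm (p, σ') B) -
              z (Equiv.Perm.decomposeFin.symm (p, σ') A)) else 1) else 0) =
        if x p = x 0 then (∏ a, if a ≠ p ∧ x a = x 0 then (z p - q * z a) / (z p - z a) else 1) * K
        else 0 := by
      intro p
      by_cases hxp : x p = x 0
      · rw [if_pos hxp]
        have hsw : ∀ a, x (Equiv.swap 0 p a) = x a := by
          intro a
          by_cases h0 : a = 0
          · subst h0; simpa using hxp
          by_cases hap : a = p
          · subst hap; simpa using hxp.symm
          rw [Equiv.swap_apply_of_ne_of_ne h0 hap]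
        have hz' : Function.Injective fun j : Fin k => z (Equiv.swap 0 p j.succ) := fun i j h =>
          Fin.succ_injective _ ((Equiv.swap 0 p).injective (hz h))
        rw [hK, ← ih (fun j => x j.succ) hz', Finset.mul_sum]
        refine Finset.sum_congr rfl fun σ' _ => ?_
        set σ := Equiv.Perm.decomposeFin.symm (p, σ') with hσ
        have hσ0 : σ 0 = p := Equiv.Perm.decomposeFin_symm_apply_zero p σ'
        have hσs : ∀ j : Fin k, σ j.succ = Equiv.swap 0 p (σ' j).succ :=
          fun j => Equiv.Perm.decomposeFin_symm_apply_succ σ' p j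
        have hiff : x ∘ σ = x ↔ (fun j => x (Fin.succ j)) ∘ σ' = fun j => x (Fin.succ j) := by
          constructor
          · intro h
            funext j
            have := congrFun h j.succ
            simpa [hσs, hsw] using this
          · intro h
            funext j
            refine Fin.cases ?_ (fun j => ?_) j
            · simp [hσ0, hxp]
            · have := congrFun h j
              simpa [hσs, hsw] using this
        by_cases hx : x ∘ σ = x
        · rw [if_pos hx, if_pos (hiff.1 hx), prod_Iio_succ]
          have hx' : ∀ a, x (σ a) = x a := congrFun hx
          simp only [hσs, hσ0]
          congr 1
          have e : ∏ a, (if a ≠ p ∧ x a = x 0 then (z p - q * z a) / (z p - z a) else 1) =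
              ∏ A, (if σ A ≠ p ∧ x (σ A) = x 0 then (z p - q * z (σ A)) / (z p - z (σ A)) else 1) :=
            (Equiv.prod_comp σ _).symm
          rw [e, Fin.prod_univ_succ]
          simp only [hσ0, ne_eq, not_true, false_and, if_false, one_mul]
          refine Finset.prod_congr rfl fun A _ => ?_
          have hne : σ A.succ ≠ p := fun h => (Fin.succ_ne_zero A) (σ.injective (h.trans hσ0.symm))
          simp only [hne, not_false_eq_true, true_and, hx', eq_comm (a := x 0)]
          rw [hσs]
        · rw [if_neg hx, if_neg (mt hiff.2 hx), mul_zero]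
      · rw [if_neg hxp]
        refine Finset.sum_eq_zero fun σ' _ => if_neg fun h => hxp ?_
        have := congrFun h 0
        simpa [Equiv.Perm.decomposeFin_symm_apply_zero] using this
    rw [Finset.sum_congr rfl fun p _ => hp p, ← Finset.sum_filter, ← Finset.sum_mul]
    congr 1
    -- The remaining sum over p runs over the cluster of 0 and gives the factor of index 0.
    have h := sum_prod_ratio (q := q) (Finset.univ.filter fun j => x j = x 0) (v := z) hz.injOn
    rw [laterCount_zero] at h
    rw [eq_div_iff hq', mul_comm, ← h]
    congr 1
    refine Finset.sum_congr rfl fun p _ => ?_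
    rw [← Finset.prod_filter]
    refine Finset.prod_congr ?_ fun _ _ => rfl
    ext a
    simp

/-! ### Linearity and vanishing of multiple integrals -/

theorem multiIntegral_sum {m : ℕ} {γ : Fin m → Contour} {ι : Type*} (s : Finset ι)
    {f : ι → (Fin m → ℂ) → ℂ} (hf : ∀ i ∈ s, ContinuousOn (f i) (ranges γ)) :
    multiIntegral γ (fun z => ∑ i ∈ s, f i z) = ∑ i ∈ s, multiIntegral γ (f i) := by
  simp only [multiIntegral, Finset.sum_mul]
  rw [integral_finsetSum s fun i hi => integrableOn_multi γ (hf i hi), Finset.mul_sum]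

theorem Contour.range_nonempty (γ : Contour) : γ.range.Nonempty :=
  ⟨_, γ.mem_range ⟨le_rfl, zero_le_one⟩⟩

theorem multiIntegral_eq_zero_of_update {k : ℕ} {γ : Fin k → Contour} {f : (Fin k → ℂ) → ℂ}
    (hf : ContinuousOn f (ranges γ)) (j : Fin k)
    (h : ∀ z ∈ ranges γ, cint (γ j) (fun u => f (Function.update z j u)) = 0) :
    multiIntegral γ f = 0 := by
  cases k with
  | zero => exact j.elim0
  | succ k =>
    rw [multiIntegral_insertNth' γ j hf]
    -- The hypothesis overwrites coordinate j, so any point of `γ j` may complete `w`.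
    obtain ⟨z0, hz0⟩ := (γ j).range_nonempty
    have e : ∀ w ∈ ranges fun i => γ (j.succAbove i),
        cint (γ j) (fun z => f (j.insertNth z w)) = 0 := by
      intro w hw
      have hz : (j.insertNth z0 w : Fin (k + 1) → ℂ) ∈ ranges γ := by
        intro i
        refine Fin.succAboveCases j ?_ (fun i => ?_) i
        · simpa using hz0
        · simpa using hw i
      have := h _ hz
      simpa only [Fin.update_insertNth] using this
    rw [multiIntegral_congr e]
    simpa using multiIntegral_const_mul (fun i => γ (j.succAbove i)) 0 fun _ => 0

/-- The functions that agree on `T` with a member of `A`. -/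
def eqOnSubalgebra (A : Subalgebra ℂ (ℂ → ℂ)) (T : Set ℂ) : Subalgebra ℂ (ℂ → ℂ) where
  carrier := {f | ∃ g ∈ A, ∀ z ∈ T, f z = g z}
  mul_mem' := by
    rintro f f' ⟨g, hg, h⟩ ⟨g', hg', h'⟩
    exact ⟨g * g', mul_mem hg hg', fun z hz => by simp [h z hz, h' z hz]⟩
  add_mem' := by
    rintro f f' ⟨g, hg, h⟩ ⟨g', hg', h'⟩
    exact ⟨g + g', add_mem hg hg', fun z hz => by simp [h z hz, h' z hz]⟩
  algebraMap_mem' c := ⟨_, A.algebraMap_mem c, fun _ _ => rfl⟩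

theorem mem_eqOnSubalgebra {A : Subalgebra ℂ (ℂ → ℂ)} {T : Set ℂ} {f g : ℂ → ℂ} (hg : g ∈ A)
    (h : ∀ z ∈ T, f z = g z) : f ∈ eqOnSubalgebra A T := ⟨g, hg, h⟩

theorem cint_eq_zero_of_avoids {γ : Contour} {S : Set ℂ} (hS : ∀ p ∈ S, γ.Avoids p) {f : ℂ → ℂ}
    (hf : f ∈ eqOnSubalgebra (Rat S) γ.range) : cint γ f = 0 := by
  obtain ⟨g, hg, h⟩ := hf
  rw [cint_congr h]
  refine (isContourFunctional_cint γ).eq_zero_of_mem_Rat (fun p hp => ⟨(hS p hp).1, ?_⟩) hg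
  rw [← winding_eq_cint]
  exact (hS p hp).2

theorem cint_eq_zero_of_contains {γ : Contour} {S : Set ℂ} (hS : ∀ p ∈ S, γ.Contains p) {a : ℂ}
    (ha : a ∈ S) {f : ℂ → ℂ} (hf : f ∈ eqOnSubalgebra (BRat S) γ.range) :
    cint γ (fun u => (u - a)⁻¹ * (u - a)⁻¹ * f u) = 0 := by
  obtain ⟨g, hg, h⟩ := hf
  rw [cint_congr fun z hz => by rw [h z hz]]
  refine (isContourFunctional_cint γ).eq_zero_of_mem_BRat (c := 1)
    (fun p hp => ⟨(hS p hp).1, ?_⟩) ha ha hg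
  rw [← winding_eq_cint]
  exact (hS p hp).2

/-! ### Nested contours -/

section Nested

variable {q : ℂ} {ν : ℝ} {k : ℕ} {γ : Fin k → Contour}

theorem Nested.avoids_nu (h : Nested q ν γ) (j : Fin k) {p : ℂ} (hp : (ν : ℂ) * p = 1) :
    (γ j).Avoids p := by
  have hν : (ν : ℂ) ≠ 0 := left_ne_zero_of_mul_eq_one hp
  rw [eq_inv_of_mul_eq_one_right hp]
  exact h.avoids_inv (by exact_mod_cast hν) j

theorem Nested.ranges_subset (h : Nested q ν γ) : ranges γ ⊆ specDomain ν k := fun _ hz j =>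
  ⟨fun e => (h.contains_one j).1 (e ▸ hz j), fun e => (h.avoids_nu j e).1 (hz j)⟩

theorem Nested.ne_mul (h : Nested q ν γ) {z : Fin k → ℂ} (hz : z ∈ ranges γ) {a b : Fin k}
    (hab : a < b) : z a ≠ q * z b := fun e => (h.nested a b hab _ (hz b)).1 (e ▸ hz a)

theorem Nested.avoids_div (h : Nested q ν γ) (hq : q ≠ 0) {a b : Fin k} (hab : a < b) {p : ℂ}
    (hp : p ∈ (γ a).range) : (γ b).Avoids (p / q) :=
  avoids_div_of_nested hq (h.nested a b hab) hp

/-- Each step outwards multiplies by q: the contour a contains q times whatever is contained in the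
contour a + 1. The bound on i says that enough inner contours are available. -/
theorem Nested.contains_pow (h : Nested q ν γ) (hq : q ≠ 0) :
    ∀ (i : ℕ) (a : Fin k), i + a < k → (γ a).Contains (q ^ i) := by
  intro i
  induction i with
  | zero => intro a _; simpa using h.contains_one a
  | succ i ih =>
    intro a ha
    have hb : (a : ℕ) + 1 < k := by omega
    rw [pow_succ']
    exact contains_mul_of_nested hq (h.nested a ⟨a + 1, hb⟩ (Fin.lt_def.2 (Nat.lt_succ_self _)))
      (ih ⟨a + 1, hb⟩ (by simp only; omega))

end Nested

/-! ### Vanishing of the off-diagonal terms -/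

/-- The factor `1 / ((1 - z) (1 - ν z))` of the spectral measure. -/
def phi (ν : ℝ) (z : ℂ) : ℂ := 1 / ((1 - z) * (1 - ν * z))

/-- The product of the scattering factors over the inversions of `τ`. -/
def scatter (q : ℂ) {k : ℕ} (τ : Fin k → Fin k) (z : Fin k → ℂ) : ℂ :=
  ∏ a, ∏ b ∈ Finset.Iio a, if τ b < τ a then 1 else (q * z b - z a) / (z b - q * z a)

/-- One term of the composition of the direct and the inverse transform. -/
def scatterTerm (q : ℂ) (ν : ℝ) {k : ℕ} (τ : Fin k → Fin k) (e : Fin k → ℤ) (z : Fin k → ℂ) : ℂ :=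
  scatter q τ z * ∏ j, (phi ν (z j) * xi ν (z j) ^ e j)

theorem continuousOn_phi (ν : ℝ) (k : ℕ) (j : Fin k) :
    ContinuousOn (fun z : Fin k → ℂ => phi ν (z j)) (specDomain ν k) := by
  simp only [phi]
  exact ContinuousOn.div (by fun_prop) (by fun_prop) fun z hz =>
    mul_ne_zero (sub_ne_zero.2 (hz j).1.symm) (sub_ne_zero.2 (hz j).2.symm)

theorem continuousOn_monomial (ν : ℝ) {k : ℕ} (e : Fin k → ℤ) :
    ContinuousOn (fun z : Fin k → ℂ => ∏ j, (phi ν (z j) * xi ν (z j) ^ e j)) (specDomain ν k) :=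
  continuousOn_finsetProd _ fun j _ => (continuousOn_phi ν k j).mul
    ((continuousOn_xi ν k j).zpow₀ _ fun _ hz => Or.inl (xi_ne_zero (hz j).1 (hz j).2))

/-- The points where the nested kernel is regular. -/
def kernelDomain (q : ℂ) (ν : ℝ) (k : ℕ) : Set (Fin k → ℂ) :=
  specDomain ν k ∩ {z | ∀ a, ∀ b < a, z b ≠ q * z a}

theorem isOpen_kernelDomain (q : ℂ) (ν : ℝ) (k : ℕ) : IsOpen (kernelDomain q ν k) := by
  refine (isOpen_specDomain ν k).inter ?_
  simp only [ofPred_forall]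
  exact isOpen_iInter_of_finite fun a => isOpen_iInter_of_finite fun b =>
    isOpen_iInter_of_finite fun _ => isOpen_ne_fun (by fun_prop) (by fun_prop)

theorem continuousOn_scatter (q : ℂ) (ν : ℝ) {k : ℕ} (τ : Fin k → Fin k) :
    ContinuousOn (scatter q τ) (kernelDomain q ν k) := by
  refine continuousOn_finsetProd _ fun a _ => continuousOn_finsetProd _ fun b hb => ?_
  split_ifs
  · exact continuousOn_const
  · exact ContinuousOn.div (by fun_prop) (by fun_prop) fun z hz =>
      sub_ne_zero.2 (hz.2 a b (Finset.mem_Iio.1 hb))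

theorem continuousOn_scatterTerm (q : ℂ) (ν : ℝ) {k : ℕ} (τ : Fin k → Fin k) (e : Fin k → ℤ) :
    ContinuousOn (scatterTerm q ν τ e) (kernelDomain q ν k) :=
  (continuousOn_scatter q ν τ).mul ((continuousOn_monomial ν e).mono inter_subset_left)

theorem scatter_update_mem {A : Subalgebra ℂ (ℂ → ℂ)} (q : ℂ) {k : ℕ} (τ : Fin k → Fin k)
    (z : Fin k → ℂ) (j : Fin k)
    (h1 : ∀ b < j, ¬ τ b < τ j → (fun u => (q * z b - u) / (z b - q * u)) ∈ A)
    (h2 : ∀ a, j < a → ¬ τ j < τ a → (fun u => (q * u - z a) / (u - q * z a)) ∈ A) :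
    (fun u => scatter q τ (Function.update z j u)) ∈ A := by
  have e : (fun u => scatter q τ (Function.update z j u)) = ∏ a, ∏ b ∈ Finset.Iio a, fun u =>
      if τ b < τ a then 1 else (q * Function.update z j u b - Function.update z j u a) /
        (Function.update z j u b - q * Function.update z j u a) := by
    funext u
    simp only [scatter, Finset.prod_apply]
  rw [e]
  refine Subalgebra.prod_mem _ fun a _ => Subalgebra.prod_mem _ fun b hb => ?_
  have hba := Finset.mem_Iio.1 hb
  by_cases hτ : τ b < τ a
  · simp only [hτ, if_true]
    exact one_mem _
  simp only [hτ, if_false]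
  by_cases ha : a = j
  · subst ha
    simp only [Function.update_self, Function.update_of_ne hba.ne]
    exact h1 b hba hτ
  by_cases hb' : b = j
  · subst hb'
    simp only [Function.update_self, Function.update_of_ne ha]
    exact h2 a hba hτ
  simp only [Function.update_of_ne ha, Function.update_of_ne hb']
  exact const_mem_subalgebra _ _

theorem scatterTerm_update (q : ℂ) (ν : ℝ) {k : ℕ} (τ : Fin k → Fin k) (e : Fin k → ℤ)
    (z : Fin k → ℂ) (j : Fin k) (u : ℂ) : scatterTerm q ν τ e (Function.update z j u) =
      (∏ i ∈ Finset.univ.erase j, (phi ν (z i) * xi ν (z i) ^ e i)) *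
        (phi ν u * xi ν u ^ e j * scatter q τ (Function.update z j u)) := by
  rw [scatterTerm, ← Finset.mul_prod_erase Finset.univ _ (Finset.mem_univ j)]
  simp only [Function.update_self]
  rw [Finset.prod_congr rfl fun i hi => by rw [Function.update_of_ne (Finset.ne_of_mem_erase hi)]]
  ring

theorem inv_one_sub_mem_Rat {ν : ℝ} {S : Set ℂ} (hS : ∀ p : ℂ, (ν : ℂ) * p = 1 → p ∈ S) :
    (fun u : ℂ => (1 - (ν : ℂ) * u)⁻¹) ∈ Rat S := by
  by_cases h0 : (ν : ℂ) = 0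
  · simp only [h0, zero_mul, sub_zero, inv_one]
    exact one_mem _
  · have e : (fun u : ℂ => (1 - (ν : ℂ) * u)⁻¹) = fun u => (-ν : ℂ)⁻¹ * (u - (ν : ℂ)⁻¹)⁻¹ := by
      funext u
      rw [← mul_inv]
      congr 1
      field_simp
      ring
    rw [e]
    exact mul_mem (const_mem_subalgebra _ _) (inv_mem_Rat (hS _ (mul_inv_cancel₀ h0)))

variable {q : ℂ} {ν : ℝ} {k : ℕ} {γ : Fin k → Contour}

theorem Nested.ranges_subset_kernelDomain (h : Nested q ν γ) : ranges γ ⊆ kernelDomain q ν k :=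
  fun _ hz => ⟨h.ranges_subset hz, fun _ _ hab => h.ne_mul hz hab⟩

/-- The positive exponent removes the pole at 1, and the record condition removes all scattering
factors with later variables. Only ν⁻¹ and z_b/q with b < j can be poles in z_j, and the j-th
contour avoids them. -/
theorem multiIntegral_scatterTerm_of_pos (h : Nested q ν γ) (hq : q ≠ 0) (τ : Fin k → Fin k)
    (e : Fin k → ℤ) (j : Fin k) (hτ : ∀ a, j < a → τ j < τ a) (he : 0 < e j) :
    multiIntegral γ (scatterTerm q ν τ e) = 0 := by
  refine multiIntegral_eq_zero_of_update
    ((continuousOn_scatterTerm q ν τ e).mono h.ranges_subset_kernelDomain) j fun z hz => ?_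
  simp only [scatterTerm_update]
  rw [cint_const_mul]
  refine mul_eq_zero_of_right _ ?_
  set S : Set ℂ := {p | (ν : ℂ) * p = 1 ∨ ∃ b < j, p = z b / q} with hS
  refine cint_eq_zero_of_avoids (S := S) ?_ (mul_mem ?_ ?_)
  · rintro p (hp | ⟨b, hb, rfl⟩)
    · exact h.avoids_nu j hp
    · exact h.avoids_div hq hb (hz b)
  · obtain ⟨d, hd⟩ : ∃ d : ℕ, e j = d + 1 := ⟨(e j - 1).toNat, by omega⟩
    refine mem_eqOnSubalgebra (g := fun u => (1 - u) ^ d * ((1 - (ν : ℂ) * u)⁻¹) ^ (d + 2)) ?_ ?_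
    · exact mul_mem (pow_mem (sub_mem (one_mem _) (id_mem_Rat S)) d)
        (pow_mem (inv_one_sub_mem_Rat fun p hp => Or.inl hp) _)
    · intro u hu
      have h1 : 1 - u ≠ 0 := sub_ne_zero.2 fun e' => (h.contains_one j).1 (e' ▸ hu)
      have h2 : 1 - (ν : ℂ) * u ≠ 0 := sub_ne_zero.2 fun e' => (h.avoids_nu j e'.symm).1 hu
      have h2' : 1 - u * (ν : ℂ) ≠ 0 := by rwa [mul_comm]
      rw [hd, phi, xi, zpow_add_one₀ (div_ne_zero h1 h2), zpow_natCast, div_pow, inv_pow,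
        pow_add _ d 2]
      field_simp
  · refine scatter_update_mem q τ z j (fun b hb _ => ?_) fun a ha hn => absurd (hτ a ha) hn
    refine mem_eqOnSubalgebra (g := fun u => (q * z b - u) * ((-q)⁻¹ * (u - z b / q)⁻¹)) ?_ ?_
    · exact mul_mem (sub_mem (const_mem_subalgebra _ _) (id_mem_Rat S))
        (mul_mem (const_mem_subalgebra _ _) (inv_mem_Rat (Or.inr ⟨b, hb, rfl⟩)))
    · intro u _
      rw [div_eq_mul_inv, ← mul_inv]
      congr 2
      field_simp
      ring

/-- The negative exponent removes the pole at ν⁻¹, and the record condition removes the factors with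
earlier variables. The remaining poles 1 and q z_a with a > j are all enclosed, ξ⁻¹ and the
scattering factors are bounded at infinity, and (u - 1)⁻² is split off for decay. -/
theorem multiIntegral_scatterTerm_of_neg (h : Nested q ν γ) (τ : Fin k → Fin k)
    (e : Fin k → ℤ) (j : Fin k) (hτ : ∀ b < j, τ b < τ j) (he : e j < 0) :
    multiIntegral γ (scatterTerm q ν τ e) = 0 := by
  refine multiIntegral_eq_zero_of_update
    ((continuousOn_scatterTerm q ν τ e).mono h.ranges_subset_kernelDomain) j fun z hz => ?_
  simp only [scatterTerm_update]
  rw [cint_const_mul]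
  refine mul_eq_zero_of_right _ ?_
  set S : Set ℂ := {p | p = 1 ∨ ∃ a, j < a ∧ p = q * z a} with hS
  obtain ⟨d, hd⟩ : ∃ d : ℕ, e j = -(d + 1 : ℤ) := ⟨(-e j - 1).toNat, by omega⟩
  have e1 : ∀ u ∈ (γ j).range, phi ν u * xi ν u ^ e j * scatter q τ (Function.update z j u) =
      (u - 1)⁻¹ * (u - 1)⁻¹ *
        ((ν + (ν - 1) * (u - 1)⁻¹) ^ d * scatter q τ (Function.update z j u)) := by
    intro u hu
    have h1 : u - 1 ≠ 0 := sub_ne_zero.2 fun e' => (h.contains_one j).1 (e' ▸ hu)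
    have h2 : 1 - (ν : ℂ) * u ≠ 0 := sub_ne_zero.2 fun e' => (h.avoids_nu j e'.symm).1 hu
    have h3 : (ν : ℂ) + (ν - 1) * (u - 1)⁻¹ = -((1 - ν * u) / (u - 1)) := by
      field_simp
      ring
    have h4 : xi ν u = (-((1 - ν * u) / (u - 1)))⁻¹ := by
      rw [xi, ← neg_sub u 1, inv_neg, inv_div]
      ring
    have h2' : 1 - u * (ν : ℂ) ≠ 0 := by rwa [mul_comm]
    have h5 : -((1 - (ν : ℂ) * u) / (u - 1)) ≠ 0 := neg_ne_zero.2 (div_ne_zero h2 h1)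
    rw [h3, h4, hd, phi, zpow_neg, inv_zpow, inv_inv, zpow_add_one₀ h5, zpow_natCast,
      ← neg_sub u 1]
    field_simp
  rw [cint_congr e1]
  refine cint_eq_zero_of_contains (S := S) ?_ (Or.inl rfl) (mul_mem (pow_mem ?_ d) ?_)
  · rintro p (rfl | ⟨a, ha, rfl⟩)
    · exact h.contains_one j
    · exact h.nested j a ha _ (hz a)
  · exact mem_eqOnSubalgebra (add_mem (const_mem_subalgebra _ _)
      (mul_mem (const_mem_subalgebra _ _) (inv_mem_BRat (S := S) (Or.inl rfl)))) fun _ _ => rfl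
  · refine scatter_update_mem q τ z j (fun b hb hn => absurd (hτ b hb) hn) fun a ha _ => ?_
    refine mem_eqOnSubalgebra (g := fun u => q + (q * q - 1) * z a * (u - q * z a)⁻¹) ?_ ?_
    · exact add_mem (const_mem_subalgebra _ _) (mul_mem (const_mem_subalgebra _ _)
        (inv_mem_BRat (Or.inr ⟨a, ha, rfl⟩)))
    · intro u hu
      have h1 : u - q * z a ≠ 0 := sub_ne_zero.2 fun e' =>
        (h.nested j a ha _ (hz a)).1 (e' ▸ hu)
      field_simp
      ring

/-- The combinatorics of the vanishing of the off-diagonal terms. -/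
theorem eq_and_comp_eq_of_records {x y : Fin k → ℤ} (hx : Antitone x) (hy : Antitone y)
    (τ : Equiv.Perm (Fin k)) (hmin : ∀ j, (∀ a, j < a → τ j < τ a) → x (τ j) ≤ y j)
    (hmax : ∀ j, (∀ b < j, τ b < τ j) → y j ≤ x (τ j)) : x = y ∧ x ∘ τ = x := by
  have key1 : ∀ i, x i ≤ y i ∧ x (τ i) ≤ y i := by
    intro i
    -- The minimum of τ over the indices from i on is attained at a right-to-left minimum j, and τ j
    -- ≤ i: otherwise τ would inject k - i indices into the k - i - 1 indices beyond i.
    obtain ⟨j, hj, hjmin⟩ := Finset.exists_min_image (Finset.Ici i) τ ⟨i, by simp⟩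
    rw [Finset.mem_Ici] at hj
    have hrec : ∀ a, j < a → τ j < τ a := fun a ha =>
      lt_of_le_of_ne (hjmin a (Finset.mem_Ici.2 (hj.trans ha.le)))
        fun e => ha.ne (τ.injective e)
    have hle : τ j ≤ i := by
      by_contra hlt
      have hsub : (Finset.Ici i).image τ ⊆ Finset.Ioi i := by
        intro b hb
        obtain ⟨a, ha, rfl⟩ := Finset.mem_image.1 hb
        exact Finset.mem_Ioi.2 ((not_le.1 hlt).trans_le (hjmin a ha))
      have hc := Finset.card_le_card hsub
      rw [Finset.card_image_of_injective _ τ.injective, Fin.card_Ici, Fin.card_Ioi] at hc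
      have := i.2
      omega
    exact ⟨(hx hle).trans ((hmin j hrec).trans (hy hj)),
      (hx (hjmin i (by simp))).trans ((hmin j hrec).trans (hy hj))⟩
  have key2 : ∀ i, y i ≤ x i := by
    intro i
    obtain ⟨j, hj, hjmax⟩ := Finset.exists_max_image (Finset.Iic i) τ ⟨i, by simp⟩
    rw [Finset.mem_Iic] at hj
    have hrec : ∀ b < j, τ b < τ j := fun b hb =>
      lt_of_le_of_ne (hjmax b (Finset.mem_Iic.2 (hb.le.trans hj)))
        fun e => hb.ne (τ.injective e)
    have hle : i ≤ τ j := by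
      by_contra hlt
      have hsub : (Finset.Iic i).image τ ⊆ Finset.Iio i := by
        intro b hb
        obtain ⟨a, ha, rfl⟩ := Finset.mem_image.1 hb
        exact Finset.mem_Iio.2 ((hjmax a ha).trans_lt (not_le.1 hlt))
      have hc := Finset.card_le_card hsub
      rw [Finset.card_image_of_injective _ τ.injective, Fin.card_Iic, Fin.card_Iio] at hc
      omega
    exact (hy hj).trans ((hmax j hrec).trans (hx hle))
  have hxy : x = y := funext fun i => le_antisymm (key1 i).1 (key2 i)
  refine ⟨hxy, ?_⟩
  have hle : ∀ i ∈ Finset.univ, x (τ i) ≤ x i := fun i _ => by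
    have := (key1 i).2
    rwa [← hxy] at this
  -- x ∘ τ ≤ x pointwise while the two sums agree, which forces equality.
  have hsum := (Finset.sum_eq_sum_iff_of_le hle).1 (Equiv.sum_comp τ x)
  exact funext fun i => hsum i (Finset.mem_univ i)

theorem multiIntegral_scatterTerm_eq_zero (h : Nested q ν γ) (hq : q ≠ 0) (x y : WeylChamber k)
    (τ : Equiv.Perm (Fin k)) (hne : ¬ (x = y ∧ x.1 ∘ τ = x.1)) :
    multiIntegral γ (scatterTerm q ν τ fun j => x.1 (τ j) - y.1 j) = 0 := by
  by_contra h0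
  have := eq_and_comp_eq_of_records x.2 y.2 τ ?_ ?_
  · exact hne ⟨Subtype.ext this.1, this.2⟩
  · intro j hj
    by_contra hlt
    exact h0 (multiIntegral_scatterTerm_of_pos h hq τ _ j hj (sub_pos.2 (not_le.1 hlt)))
  · intro j hj
    by_contra hlt
    exact h0 (multiIntegral_scatterTerm_of_neg h τ _ j hj (sub_neg.2 (not_le.1 hlt)))

/-! ### Nested integrals of cluster kernels -/

/-- The nested integration kernel restricted to pairs in the same cluster. -/
def clusterKernel (q : ℂ) {k : ℕ} (x : Fin k → ℤ) (z : Fin k → ℂ) : ℂ :=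
  ∏ a, ∏ b ∈ Finset.Iio a, if x b = x a then (z b - z a) / (z b - q * z a) else 1

theorem div_sub_mul_mem_Rat {q w : ℂ} (hq : q ≠ 0) {S : Set ℂ} (hw : w / q ∈ S) :
    (fun u => (w - u) / (w - q * u)) ∈ Rat S := by
  have e : (fun u => (w - u) / (w - q * u)) = fun u => (w - u) * ((-q)⁻¹ * (u - w / q)⁻¹) := by
    funext u
    rw [div_eq_mul_inv, ← mul_inv]
    congr 2
    field_simp
    ring
  rw [e]
  exact mul_mem (sub_mem (const_mem_subalgebra _ _) (id_mem_Rat S))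
    (mul_mem (const_mem_subalgebra _ _) (inv_mem_Rat hw))

/-- The innermost variable encloses only its pole D = q^d. Taking the residue there multiplies each
variable of the same cluster by (w - D)/(w - qD), which moves its pole from q^d to q^(d+1). Hence
the exponents `d` are left arbitrary per cluster in the induction, and the bound in the last
hypothesis is preserved when `d` rises as `m` drops. -/
theorem multiIntegral_clusterKernel {q : ℂ} (hq : q ≠ 0) {ν : ℝ} : ∀ {m : ℕ} {γ : Fin m → Contour}
    (x : Fin m → ℤ) (d : ℤ → ℕ), (∀ j p, (ν : ℂ) * p = 1 → (γ j).Avoids p) →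
    (∀ a b, b < a → ∀ w ∈ (γ a).range, (γ b).Contains (q * w)) →
    (∀ (a : Fin m) (i : ℕ), i + a + 1 ≤ d (x a) + m → (γ a).Contains (q ^ i)) →
    multiIntegral γ (fun z => clusterKernel q x z *
      ∏ a, ((1 - ν * z a)⁻¹ * (z a - q ^ d (x a))⁻¹)) =
      ∏ a, (1 - ν * q ^ (d (x a) + laterCount x a))⁻¹ := by
  intro m
  induction m with
  | zero => intro γ x d _ _ _; rw [multiIntegral_zero_dim]; simp [clusterKernel]
  | succ m ih =>
    intro γ x d hnu hnest hpow
    set l := Fin.last m with hl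
    have hlt : ∀ b : Fin m, b.castSucc < l := Fin.castSucc_lt_last
    have hdl : (γ l).Contains (q ^ d (x l)) := hpow l _ (by simp [hl])
    have hcont : ContinuousOn (fun z => clusterKernel q x z *
        ∏ a, ((1 - ν * z a)⁻¹ * (z a - q ^ d (x a))⁻¹)) (ranges γ) := by
      refine ContinuousOn.mul ?_ ?_
      · refine continuousOn_finsetProd _ fun a _ => continuousOn_finsetProd _ fun b hb => ?_
        split_ifs
        · exact ContinuousOn.div (by fun_prop) (by fun_prop) fun z hz => sub_ne_zero.2 fun e =>
            (hnest a b (Finset.mem_Iio.1 hb) _ (hz a)).1 (e ▸ hz b)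
        · exact continuousOn_const
      · refine continuousOn_finsetProd _ fun a _ => ContinuousOn.mul
          (ContinuousOn.inv₀ (by fun_prop) fun z hz => sub_ne_zero.2 fun e =>
            (hnu a _ e.symm).1 (hz a)) (ContinuousOn.inv₀ (by fun_prop) fun z hz =>
            sub_ne_zero.2 fun e => (hpow a (d (x a)) (by have := a.2; omega)).1 (e ▸ hz a))
    rw [multiIntegral_insertNth' γ l hcont]
    set γ' : Fin m → Contour := fun j => γ j.castSucc with hγ'
    set x' : Fin m → ℤ := fun j => x j.castSucc with hx'
    have hγe : (fun j => γ (l.succAbove j)) = γ' := by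
      funext j; simp [hl, hγ', Fin.succAbove_last]
    rw [hγe]
    have hins : ∀ (u : ℂ) (w : Fin m → ℂ) (b : Fin m),
        (l.insertNth u w : Fin (m + 1) → ℂ) b.castSucc = w b := by
      intro u w b
      rw [hl, Fin.insertNth_last', Fin.snoc_castSucc]
    have hins' : ∀ (u : ℂ) (w : Fin m → ℂ), (l.insertNth u w : Fin (m + 1) → ℂ) l = u :=
      fun u w => Fin.insertNth_apply_same _ _ _
    set D := q ^ d (x l) with hD
    have hinner : ∀ w ∈ ranges γ', cint (γ l) (fun u => clusterKernel q x (l.insertNth u w) *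
        ∏ a, ((1 - ν * (l.insertNth u w : Fin (m + 1) → ℂ) a)⁻¹ *
          ((l.insertNth u w : Fin (m + 1) → ℂ) a - q ^ d (x a))⁻¹)) =
        (1 - ν * D)⁻¹ * (clusterKernel q x' w * ∏ a, ((1 - ν * w a)⁻¹ *
          (w a - q ^ (Function.update d (x l) (d (x l) + 1) (x' a)))⁻¹)) := by
      intro w hw
      set H : ℂ → ℂ := fun u => (1 - ν * u)⁻¹ *
        ∏ b : Fin m, if x' b = x l then (w b - u) / (w b - q * u) else 1 with hH
      have e1 : ∀ u, clusterKernel q x (l.insertNth u w) *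
          ∏ a, ((1 - ν * (l.insertNth u w : Fin (m + 1) → ℂ) a)⁻¹ *
            ((l.insertNth u w : Fin (m + 1) → ℂ) a - q ^ d (x a))⁻¹) =
          (clusterKernel q x' w * ∏ a, ((1 - ν * w a)⁻¹ * (w a - q ^ d (x' a))⁻¹)) *
            (H u * (u - D)⁻¹) := by
        intro u
        rw [clusterKernel, prod_Iio_castSucc, Fin.prod_univ_castSucc]
        simp only [← hl, hins, hins', hH, clusterKernel, hx', hD]
        ring
      simp only [e1]
      rw [cint_const_mul]
      set S : Set ℂ := {p | (ν : ℂ) * p = 1 ∨ ∃ b, p = w b / q} with hS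
      have hSa : ∀ p ∈ S, (γ l).Avoids p := by
        rintro p (hp | ⟨b, rfl⟩)
        · exact hnu _ _ hp
        · exact avoids_div_of_nested hq (hnest _ _ (hlt b)) (hw b)
      have hHm : H ∈ Rat S := by
        refine mul_mem (inv_one_sub_mem_Rat fun p hp => Or.inl hp) ?_
        have e : (fun u => ∏ b : Fin m, if x' b = x l then (w b - u) / (w b - q * u) else 1) =
            ∏ b : Fin m, fun u => if x' b = x l then (w b - u) / (w b - q * u) else 1 := by
          funext u; simp
        rw [e]
        refine Subalgebra.prod_mem _ fun b _ => ?_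
        by_cases hb : x' b = x l
        · simp only [hb, if_true]
          exact div_sub_mul_mem_Rat hq (Or.inr ⟨b, rfl⟩)
        · simp only [hb, if_false]
          exact one_mem _
      have hDS : D ∉ S := fun h => by
        have h1 := (hSa D h).2
        rw [hdl.2] at h1
        exact one_ne_zero h1
      rw [(isContourFunctional_cint (γ l)).eq_value_of_simple_pole (S := S) (fun p hp =>
        ⟨(hSa p hp).1, by rw [← winding_eq_cint]; exact (hSa p hp).2⟩) hHm hdl.1 hDS,
        ← winding_eq_cint, hdl.2, mul_one, hH]
      simp only
      have e2 : (∏ a, ((1 - ν * w a)⁻¹ * (w a - q ^ d (x' a))⁻¹)) *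
          (∏ b : Fin m, if x' b = x l then (w b - D) / (w b - q * D) else 1) =
          ∏ a, ((1 - ν * w a)⁻¹ *
            (w a - q ^ (Function.update d (x l) (d (x l) + 1) (x' a)))⁻¹) := by
        rw [← Finset.prod_mul_distrib]
        refine Finset.prod_congr rfl fun b _ => ?_
        by_cases hb : x' b = x l
        · rw [if_pos hb, hb, Function.update_self, pow_succ', ← hD]
          have hne : w b - D ≠ 0 := sub_ne_zero.2 fun e => by
            have h1 := hpow b.castSucc (d (x l)) (by
              have h2 : x b.castSucc = x l := hb
              rw [h2, Fin.val_castSucc]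
              have := b.2
              omega)
            exact h1.1 (by rw [← hD, ← e]; exact hw b)
          rw [div_eq_mul_inv, mul_assoc, ← mul_assoc (w b - D)⁻¹, inv_mul_cancel₀ hne, one_mul]
        · rw [if_neg hb, mul_one, Function.update_of_ne hb]
      rw [← e2]
      ring
    rw [multiIntegral_congr hinner, multiIntegral_const_mul, ih x' _ (fun j => hnu _)
      (fun a b hab => hnest _ _ (Fin.castSucc_lt_castSucc_iff.2 hab)) ?_, Fin.prod_univ_castSucc,
      mul_comm]
    · rw [← hl, laterCount_last, add_zero]
      congr 1
      refine Finset.prod_congr rfl fun a _ => ?_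
      rw [laterCount_castSucc]
      by_cases ha : x' a = x l
      · have ha' : x a.castSucc = x l := ha
        rw [ha, Function.update_self, if_pos ha'.symm, ha', add_right_comm, add_assoc]
      · have ha' : ¬ x l = x a.castSucc := fun e => ha e.symm
        rw [Function.update_of_ne ha, if_neg ha', add_zero]
    · intro a i hi
      refine hpow a.castSucc i ?_
      rw [Fin.val_castSucc]
      by_cases ha : x' a = x l
      · rw [ha, Function.update_self] at hi
        have ha' : x a.castSucc = x l := ha
        rw [ha']
        omega
      · rw [Function.update_of_ne ha] at hi
        have : d (x a.castSucc) = d (x' a) := rfl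
        omega

/-! ### The composition of the transforms -/

/-- The kernel of the nested integral. -/
def pairKernel (q : ℂ) {k : ℕ} (z : Fin k → ℂ) : ℂ :=
  ∏ a, ∏ b ∈ Finset.Iio a, (z b - z a) / (z b - q * z a)

theorem prod_Ioi_eq_pairKernel (q : ℂ) {k : ℕ} (z : Fin k → ℂ) :
    ∏ A, ∏ B ∈ Finset.Ioi A, (z A - z B) / (z A - q * z B) = pairKernel q z :=
  Finset.prod_comm' (by simp)

theorem bethe_rev (q : ℂ) (ν : ℝ) {k : ℕ} (n : Fin k → ℤ) (z : Fin k → ℂ) :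
    bethe q ν (fun j => n j.rev) z = ∑ σ : Equiv.Perm (Fin k),
      (∏ A, ∏ B ∈ Finset.Iio A, (z (σ B) - q * z (σ A)) / (z (σ B) - z (σ A))) *
        ∏ j, xi ν (z (σ j)) ^ n j := by
  rw [bethe, ← Equiv.sum_comp (Equiv.mulRight (Fin.revPerm : Equiv.Perm (Fin k)))]
  refine Finset.sum_congr rfl fun σ _ => ?_
  congr 1
  · have := prod_Iio_comp_perm (fun a b => (z (σ a) - q * z (σ b)) / (z (σ a) - z (σ b)))
      Fin.revPerm
    simp only [Equiv.coe_mulRight, Equiv.Perm.mul_apply]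
    rw [this]
    refine Finset.prod_congr rfl fun A _ => Finset.prod_congr rfl fun B hB => ?_
    rw [if_neg]
    simpa using (Finset.mem_Iio.1 hB).le
  · rw [← Equiv.prod_comp Fin.revPerm]
    simp

/-- With τ = σ⁻¹, a pair b < a in the order kept by τ has its scattering factor cancelled by the
kernel; for an inverted pair a ratio with denominator z_b - q z_a remains. The poles at z_a = z_b
are gone in either case. -/
theorem pairKernel_mul_bethe {q : ℂ} {ν : ℝ} {k : ℕ} (n : Fin k → ℤ) {z : Fin k → ℂ}
    (hz : z ∈ kernelDomain q ν k) (hi : Function.Injective z) :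
    pairKernel q z * bethe q ν (fun j => n j.rev) z =
      ∑ τ : Equiv.Perm (Fin k), scatter q τ z * ∏ j, xi ν (z j) ^ n (τ j) := by
  rw [bethe_rev, Finset.mul_sum, ← Equiv.sum_comp (Equiv.inv (Equiv.Perm (Fin k)))]
  refine Finset.sum_congr rfl fun τ _ => ?_
  rw [← mul_assoc]
  congr 1
  · rw [prod_Iio_comp_perm fun a b => (z b - q * z a) / (z b - z a), pairKernel, scatter,
      ← Finset.prod_mul_distrib]
    refine Finset.prod_congr rfl fun a _ => ?_
    rw [← Finset.prod_mul_distrib]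
    refine Finset.prod_congr rfl fun b hb => ?_
    have h1 : z b - q * z a ≠ 0 := sub_ne_zero.2 (hz.2 a b (Finset.mem_Iio.1 hb))
    have h2 : z b - z a ≠ 0 := sub_ne_zero.2 fun e => (Finset.mem_Iio.1 hb).ne (hi e)
    have h3 : z a - z b ≠ 0 := sub_ne_zero.2 fun e => (Finset.mem_Iio.1 hb).ne' (hi e)
    have hs : (Equiv.inv (Equiv.Perm (Fin k)) τ).symm = τ := by
      change τ⁻¹⁻¹ = τ
      rw [inv_inv]
    rw [hs]
    split_ifs
    · rw [div_mul_div_cancel₀ h1, div_self h2]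
    · rw [div_mul_div_comm, div_eq_div_iff (mul_ne_zero h1 h3) h1]
      ring
  · rw [← Equiv.prod_comp τ]
    refine Finset.prod_congr rfl fun j _ => ?_
    have : (Equiv.inv (Equiv.Perm (Fin k)) τ) (τ j) = j := by
      change τ⁻¹ (τ j) = j
      simp
    rw [this]

theorem continuousOn_of_mem_Cz {ν : ℝ} {k : ℕ} {G : (Fin k → ℂ) → ℂ} (hG : G ∈ Cz ν k) :
    ContinuousOn G (specDomain ν k) := by
  obtain ⟨-, ⟨P, hP⟩, -⟩ := hG
  exact (continuousOn_laurentEval ν P).congr hP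

theorem continuousOn_pairKernel (q : ℂ) (ν : ℝ) (k : ℕ) :
    ContinuousOn (pairKernel q (k := k)) (kernelDomain q ν k) :=
  continuousOn_finsetProd _ fun a _ => continuousOn_finsetProd _ fun b hb =>
    ContinuousOn.div (by fun_prop) (by fun_prop) fun z hz =>
      sub_ne_zero.2 (hz.2 a b (Finset.mem_Iio.1 hb))

theorem pairKernel_mul_eigenR {q : ℂ} (hq : q ≠ 0) {ν : ℝ} (hν : ν < 1) {k : ℕ} (x : WeylChamber k)
    {z : Fin k → ℂ} (hz : z ∈ kernelDomain q ν k) :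
    pairKernel q z * eigenR q ν x z = (-1) ^ k * (1 - q) ^ k * stat q ν x *
      ∑ τ : Equiv.Perm (Fin k), scatter q τ z * ∏ j, xi ν (z j) ^ x.1 (τ j) := by
  refine eq_of_eq_on_injective (isOpen_kernelDomain q ν k)
    (f := fun z => pairKernel q z * eigenR q ν x z)
    (g := fun z => (-1) ^ k * (1 - q) ^ k * stat q ν x *
      ∑ τ : Equiv.Perm (Fin k), scatter q τ z * ∏ j, xi ν (z j) ^ x.1 (τ j))
    ((continuousOn_pairKernel q ν k).fun_mul
    ((continuousOn_of_mem_Cz (eigenR_mem_Cz hq hν x)).mono inter_subset_left))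
    (continuousOn_const.fun_mul (continuousOn_finsetSum _ fun τ _ =>
      (continuousOn_scatter q ν τ).fun_mul (continuousOn_finsetProd _ fun j _ =>
        ((continuousOn_xi ν k j).mono inter_subset_left).zpow₀ _ fun z hz => Or.inl
          (xi_ne_zero (hz.1 j).1 (hz.1 j).2)))) (fun z hz hi => ?_) z hz
  rw [eigenR_eq hq, extendDiag_bethe_of_injective hν _ _ _ hz.1 hi, ← pairKernel_mul_bethe _ hz hi]
  ring

/-- A permutation fixing the weakly decreasing x cannot invert indices of different clusters, so
such pairs contribute 1. Pairs within a cluster give the cluster kernel times the ratio summed in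
`sum_cluster_perm`. -/
theorem sum_scatter_cluster {q : ℂ} (hq : q ≠ 1) {ν : ℝ} {k : ℕ} (x : WeylChamber k)
    {z : Fin k → ℂ} (hz : z ∈ kernelDomain q ν k) :
    ∑ τ : Equiv.Perm (Fin k), (if x.1 ∘ τ = x.1 then scatter q τ z else 0) =
      (∏ i, (1 - q ^ (laterCount x.1 i + 1)) / (1 - q)) * clusterKernel q x.1 z := by
  refine eq_of_eq_on_injective (isOpen_kernelDomain q ν k)
    (f := fun z => ∑ τ : Equiv.Perm (Fin k), (if x.1 ∘ τ = x.1 then scatter q τ z else 0))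
    (g := fun z => (∏ i, (1 - q ^ (laterCount x.1 i + 1)) / (1 - q)) * clusterKernel q x.1 z)
    (continuousOn_finsetSum _ fun τ _ => ?_)
    (continuousOn_const.fun_mul (continuousOn_finsetProd _ fun a _ => continuousOn_finsetProd _
      fun b hb => ?_)) (fun z hz hi => ?_) z hz
  · split_ifs
    · exact continuousOn_scatter q ν τ
    · exact continuousOn_const
  · split_ifs
    · exact ContinuousOn.div (by fun_prop) (by fun_prop) fun z hz =>
        sub_ne_zero.2 (hz.2 a b (Finset.mem_Iio.1 hb))
    · exact continuousOn_const
  · rw [← sum_cluster_perm hq x.1 hi, ← Equiv.sum_comp (Equiv.inv (Equiv.Perm (Fin k))),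
      Finset.sum_mul]
    refine Finset.sum_congr rfl fun σ _ => ?_
    have hinv : (Equiv.inv (Equiv.Perm (Fin k)) σ) = σ.symm := rfl
    rw [hinv]
    have hiff : x.1 ∘ σ.symm = x.1 ↔ x.1 ∘ σ = x.1 :=
      ⟨fun h => by conv_lhs => rw [← h, Function.comp_assoc, Equiv.symm_comp_self, Function.comp_id],
        fun h => by conv_lhs => rw [← h, Function.comp_assoc, Equiv.self_comp_symm, Function.comp_id]⟩
    by_cases hx : x.1 ∘ σ = x.1
    · rw [if_pos hx, if_pos (hiff.2 hx)]
      have hσ : ∀ a, x.1 (σ a) = x.1 a := congrFun hx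
      have hσ' : ∀ a, x.1 (σ.symm a) = x.1 a := congrFun (hiff.2 hx)
      have e : ∏ A, ∏ B ∈ Finset.Iio A, (if x.1 B = x.1 A then
          (z (σ B) - q * z (σ A)) / (z (σ B) - z (σ A)) else 1) =
          ∏ A, ∏ B ∈ Finset.Iio A, (fun a b => if x.1 b = x.1 a then
            (z b - q * z a) / (z b - z a) else 1) (σ A) (σ B) := by
        simp only [hσ]
      rw [e, prod_Iio_comp_perm (fun a b => if x.1 b = x.1 a then
            (z b - q * z a) / (z b - z a) else 1) σ, scatter, clusterKernel, ← Finset.prod_mul_distrib]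
      refine Finset.prod_congr rfl fun a _ => ?_
      rw [← Finset.prod_mul_distrib]
      refine Finset.prod_congr rfl fun b hb => ?_
      have hb := Finset.mem_Iio.1 hb
      have h1 : z b - q * z a ≠ 0 := sub_ne_zero.2 (hz.2 a b hb)
      have h2 : z b - z a ≠ 0 := sub_ne_zero.2 fun e => hb.ne (hi e)
      have h3 : z a - z b ≠ 0 := sub_ne_zero.2 fun e => hb.ne' (hi e)
      by_cases hab : x.1 b = x.1 a
      · simp only [hab, if_true]
        split_ifs
        · rw [div_mul_div_cancel₀ h2, div_self h1]
        · rw [div_mul_div_comm, div_eq_div_iff h1 (mul_ne_zero h3 h1)]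
          ring
      · have hab' : ¬ x.1 a = x.1 b := fun e => hab e.symm
        have hlt : σ.symm b < σ.symm a := by
          by_contra hle
          have h4 := x.2 (not_lt.1 hle)
          rw [hσ', hσ'] at h4
          exact hab (le_antisymm h4 (x.2 hb.le))
        simp [hab, hlt]
    · rw [if_neg hx, if_neg (mt hiff.1 hx), zero_mul]

section Inversion

variable {q : ℂ} {ν : ℝ} {k : ℕ} {γ : Fin k → Contour}

theorem inverse_eigenR_eq_sum (hq : q ≠ 0) (hν : ν < 1) (h : Nested q ν γ) (x y : WeylChamber k) :
    inverse q ν γ (eigenR q ν x) y = (-1) ^ k * (1 - q) ^ k * stat q ν x *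
      ∑ τ : Equiv.Perm (Fin k), multiIntegral γ (scatterTerm q ν τ fun j => x.1 (τ j) - y.1 j) := by
  have hsub := h.ranges_subset_kernelDomain
  rw [inverse, ← multiIntegral_sum (f := fun τ : Equiv.Perm (Fin k) =>
      scatterTerm q ν τ fun j => x.1 (τ j) - y.1 j) _
      fun τ _ => (continuousOn_scatterTerm q ν τ _).mono hsub,
    ← multiIntegral_const_mul]
  refine multiIntegral_congr fun z hz => ?_
  rw [prod_Ioi_eq_pairKernel, mul_right_comm, pairKernel_mul_eigenR hq hν x (hsub hz), mul_assoc,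
    Finset.sum_mul]
  congr 1
  refine Finset.sum_congr rfl fun τ _ => ?_
  rw [scatterTerm, mul_assoc, ← Finset.prod_mul_distrib]
  congr 1
  refine Finset.prod_congr rfl fun j _ => ?_
  have hj := (hsub hz).1 j
  rw [phi, sub_eq_add_neg (x.1 _), zpow_add₀ (xi_ne_zero hj.1 hj.2)]
  ring

theorem inverse_eigenR_of_ne (hq : q ≠ 0) (hν : ν < 1) (h : Nested q ν γ) {x y : WeylChamber k}
    (hxy : x ≠ y) : inverse q ν γ (eigenR q ν x) y = 0 := by
  rw [inverse_eigenR_eq_sum hq hν h, Finset.sum_eq_zero fun τ _ =>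
    multiIntegral_scatterTerm_eq_zero h hq x y τ fun e => hxy e.1, mul_zero]

/-- Three products over indices cancel: `stat` written with `laterCount`, the symmetrization
constant, and the value of the cluster integral with all poles starting at q^0 = 1. The two signs
(-1)^k come from the eigenfunction and from 1 - z = -(z - 1). -/
theorem inverse_eigenR_self (hq : q ≠ 0) (hq1 : ‖q‖ < 1) (hν0 : 0 ≤ ν) (hν : ν < 1)
    (h : Nested q ν γ) (x : WeylChamber k) : inverse q ν γ (eigenR q ν x) x = 1 := by
  have hsub := h.ranges_subset_kernelDomain
  have hqn : q ≠ 1 := by rintro rfl; simp at hq1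
  have hterm : ∀ τ : Equiv.Perm (Fin k),
      multiIntegral γ (scatterTerm q ν τ fun j => x.1 (τ j) - x.1 j) =
      multiIntegral γ (fun z => (if x.1 ∘ τ = x.1 then scatter q τ z else 0) *
        ∏ j, phi ν (z j)) := by
    intro τ
    by_cases hx : x.1 ∘ τ = x.1
    · refine multiIntegral_congr fun z _ => ?_
      have : ∀ j, x.1 (τ j) = x.1 j := congrFun hx
      simp [scatterTerm, hx, this]
    · rw [multiIntegral_scatterTerm_eq_zero h hq x x τ fun e => hx e.2]
      simp only [if_neg hx]
      rw [multiIntegral_const_mul, zero_mul]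
  have hphi : ContinuousOn (fun z : Fin k → ℂ => ∏ j, phi ν (z j)) (ranges γ) :=
    continuousOn_finsetProd _ fun j _ => (continuousOn_phi ν k j).mono h.ranges_subset
  rw [inverse_eigenR_eq_sum hq hν h, Finset.sum_congr rfl fun τ _ => hterm τ,
    ← multiIntegral_sum (f := fun (τ : Equiv.Perm (Fin k)) z =>
      (if x.1 ∘ τ = x.1 then scatter q τ z else 0) * ∏ j, phi ν (z j)) _
      fun τ _ => ContinuousOn.fun_mul ?_ hphi]
  · have e : ∀ z ∈ ranges γ, ∑ τ : Equiv.Perm (Fin k),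
        (if x.1 ∘ τ = x.1 then scatter q τ z else 0) * ∏ j, phi ν (z j) =
        (∏ i, (1 - q ^ (laterCount x.1 i + 1)) / (1 - q)) * (-1) ^ k *
          (clusterKernel q x.1 z * ∏ a, ((1 - ν * z a)⁻¹ * (z a - q ^ 0)⁻¹)) := by
      intro z hz
      have e1 : ∏ j, phi ν (z j) = (-1) ^ k * ∏ a, ((1 - ν * z a)⁻¹ * (z a - q ^ 0)⁻¹) := by
        have : ((-1 : ℂ)) ^ k = ∏ _ : Fin k, (-1 : ℂ) := by simp
        rw [this, ← Finset.prod_mul_distrib]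
        refine Finset.prod_congr rfl fun j _ => ?_
        rw [phi, pow_zero, ← neg_sub (1 : ℂ) (z j), one_div, mul_inv, inv_neg]
        ring
      rw [← Finset.sum_mul, sum_scatter_cluster hqn x (hsub hz), e1]
      ring
    rw [multiIntegral_congr e, multiIntegral_const_mul,
      multiIntegral_clusterKernel hq x.1 (fun _ => 0) (fun j p hp => h.avoids_nu j hp)
        (fun a b hab w hw => h.nested b a hab w hw)
        (fun a i hi => h.contains_pow hq i a (by omega)), stat_eq_prod]
    have hc : (-1 : ℂ) ^ k * (1 - q) ^ k *
        (∏ i, (1 - ν * q ^ laterCount x.1 i) / (1 - q ^ (laterCount x.1 i + 1))) *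
        ((∏ i, (1 - q ^ (laterCount x.1 i + 1)) / (1 - q)) * (-1) ^ k *
          ∏ a, (1 - ν * q ^ (0 + laterCount x.1 a))⁻¹) =
        ((-1) ^ k * (-1) ^ k) * ∏ i : Fin k, ((1 - q) *
          ((1 - ν * q ^ laterCount x.1 i) / (1 - q ^ (laterCount x.1 i + 1)) *
          ((1 - q ^ (laterCount x.1 i + 1)) / (1 - q) * (1 - ν * q ^ laterCount x.1 i)⁻¹))) := by
      simp only [Finset.prod_mul_distrib, zero_add, Finset.prod_const, Finset.card_univ,
        Fintype.card_fin]
      ring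
    rw [hc, ← mul_pow, neg_one_mul, neg_neg, one_pow, one_mul]
    refine Finset.prod_eq_one fun i _ => ?_
    have h1 : 1 - q ≠ 0 := sub_ne_zero.2 hqn.symm
    have h2 : 1 - q ^ (laterCount x.1 i + 1) ≠ 0 := by
      refine sub_ne_zero.2 fun e => ?_
      have h3 : ‖q ^ (laterCount x.1 i + 1)‖ < 1 := by
        rw [norm_pow]
        exact pow_lt_one₀ (norm_nonneg _) hq1 (Nat.succ_ne_zero _)
      rw [← e, norm_one] at h3
      exact lt_irrefl _ h3
    have h3 : 1 - (ν : ℂ) * q ^ laterCount x.1 i ≠ 0 := by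
      refine sub_ne_zero.2 fun e => ?_
      have h4 : ‖(ν : ℂ) * q ^ laterCount x.1 i‖ < 1 := by
        rw [norm_mul, norm_pow, Complex.norm_real, Real.norm_of_nonneg hν0]
        exact mul_lt_one_of_nonneg_of_lt_one_left hν0 hν (pow_le_one₀ (norm_nonneg _) hq1.le)
      rw [← e, norm_one] at h4
      exact lt_irrefl _ h4
    generalize (1 - (ν : ℂ) * q ^ laterCount x.1 i) = A at h3 ⊢
    generalize 1 - q ^ (laterCount x.1 i + 1) = B at h2 ⊢
    generalize 1 - q = C at h1 ⊢
    field_simp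
  · split_ifs
    · exact (continuousOn_scatter q ν τ).mono hsub
    · exact continuousOn_const

theorem inverse_sum (h : Nested q ν γ) {ι : Type*} (s : Finset ι) (c : ι → ℂ)
    {G : ι → (Fin k → ℂ) → ℂ} (hG : ∀ i ∈ s, G i ∈ Cz ν k) (y : WeylChamber k) :
    inverse q ν γ (∑ i ∈ s, c i • G i) y = ∑ i ∈ s, c i * inverse q ν γ (G i) y := by
  simp only [inverse, ← multiIntegral_const_mul]
  rw [← multiIntegral_sum]
  · refine multiIntegral_congr fun z _ => ?_
    rw [Finset.sum_apply, Finset.mul_sum]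
    refine Finset.sum_congr rfl fun i _ => ?_
    rw [Pi.smul_apply, smul_eq_mul]
    ring
  · intro i hi
    have hm : ContinuousOn (fun z : Fin k → ℂ =>
        ∏ j, 1 / ((1 - z j) * (1 - ν * z j)) * xi ν (z j) ^ (-y.1 j)) (ranges γ) :=
      (continuousOn_monomial ν fun j => -y.1 j).mono h.ranges_subset
    refine continuousOn_const.mul (ContinuousOn.mul (ContinuousOn.mul ?_ hm)
      ((continuousOn_of_mem_Cz (hG i hi)).mono h.ranges_subset))
    simp only [prod_Ioi_eq_pairKernel]
    exact (continuousOn_pairKernel q ν k).mono h.ranges_subset_kernelDomain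

theorem inverse_direct (hq : q ≠ 0) (hq1 : ‖q‖ < 1) (hν0 : 0 ≤ ν) (hν : ν < 1)
    (h : Nested q ν γ) (f : Wc k) (y : WeylChamber k) :
    inverse q ν γ (direct q ν k f) y = f.1 y := by
  rw [direct_eq_sum q ν f (s := insert y (Set.Finite.toFinset f.2)) fun n hn =>
    Finset.mem_insert_of_mem ((Set.Finite.mem_toFinset _).2 hn),
    inverse_sum h _ _ fun n _ => eigenR_mem_Cz hq hν n,
    Finset.sum_eq_single y (fun n _ hn => by rw [inverse_eigenR_of_ne hq hν h hn, mul_zero])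
      fun hn => absurd (Finset.mem_insert_self _ _) hn,
    inverse_eigenR_self hq hq1 hν0 hν h, mul_one]

end Inversion

/-! ### Recursive form of the Bethe sums -/

/-- The Bethe sum over the orderings of a finite set of points, by recursion on the first point. -/
def betheSet (q : ℂ) (ν : ℝ) : {m : ℕ} → (Fin m → ℤ) → Finset ℂ → ℂ
  | 0, _, _ => 1
  | _ + 1, n, Z => ∑ z ∈ Z, (∏ y ∈ Z.erase z, (y - q * z) / (y - z)) *
      (xi ν z ^ n 0 * betheSet q ν (fun j => n j.succ) (Z.erase z))

/-- The Bethe sum is symmetric, so nothing is lost by forgetting the labels of distinct points. The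
point in position 0 becomes the first point of the recursion. -/
theorem betheSet_image (q : ℂ) (ν : ℝ) : ∀ {m : ℕ} (n : Fin m → ℤ) {z : Fin m → ℂ},
    Function.Injective z → betheSet q ν n (Finset.univ.image z) = bethe q ν n z := by
  intro m
  induction m with
  | zero => intro n z _; simp [betheSet, bethe]
  | succ m ih =>
    intro n z hz
    rw [betheSet, Finset.sum_image fun _ _ _ _ h => hz h, bethe,
      ← Equiv.sum_comp Equiv.Perm.decomposeFin.symm, Fintype.sum_prod_type]
    refine Finset.sum_congr rfl fun p _ => ?_
    have hz' : Function.Injective fun j : Fin m => z (Equiv.swap 0 p j.succ) := fun i j h =>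
      Fin.succ_injective _ ((Equiv.swap 0 p).injective (hz h))
    have himg : (Finset.univ.image z).erase (z p) =
        Finset.univ.image fun j : Fin m => z (Equiv.swap 0 p j.succ) := by
      ext y
      simp only [Finset.mem_erase, Finset.mem_image, Finset.mem_univ, true_and]
      constructor
      · rintro ⟨hy, a, rfl⟩
        have ha : Equiv.swap 0 p a ≠ 0 := fun h => hy (by
          rw [← Equiv.swap_apply_left (0 : Fin (m + 1)) p] at h
          have h2 := congrArg (Equiv.swap 0 p) h
          simp at h2
          rw [h2])
        obtain ⟨j, hj⟩ := Fin.exists_succ_eq.2 ha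
        exact ⟨j, by rw [hj, Equiv.swap_apply_self]⟩
      · rintro ⟨j, rfl⟩
        refine ⟨fun h => ?_, _, rfl⟩
        have h1 := hz h
        rw [Equiv.swap_apply_eq_iff, Equiv.swap_apply_right] at h1
        exact Fin.succ_ne_zero j h1
    rw [himg, ih _ hz', bethe, Finset.mul_sum, Finset.mul_sum]
    refine Finset.sum_congr rfl fun σ' _ => ?_
    set σ := Equiv.Perm.decomposeFin.symm (p, σ') with hσ
    have hσ0 : σ 0 = p := Equiv.Perm.decomposeFin_symm_apply_zero p σ'
    have hσs : ∀ j : Fin m, σ j.succ = Equiv.swap 0 p (σ' j).succ :=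
      fun j => Equiv.Perm.decomposeFin_symm_apply_succ σ' p j
    rw [prod_Iio_succ, Fin.prod_univ_succ, Finset.prod_image fun _ _ _ _ h => hz' h]
    simp only [hσ0, hσs]
    rw [Equiv.prod_comp σ' fun j => (z (Equiv.swap 0 p j.succ) - q * z p) /
      (z (Equiv.swap 0 p j.succ) - z p)]
    ring

/-! ### Strings -/

/-- The union of the strings `w_b, q w_b, …, q^{l_b - 1} w_b`. -/
def stringSet (q : ℂ) {p : ℕ} (l : Fin p → ℕ) (w : Fin p → ℂ) : Finset ℂ :=
  Finset.univ.biUnion fun b => (Finset.range (l b)).image fun i => q ^ i * w b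

/-- Points whose `q`-strings of length at most `m` do not meet. -/
def Generic (q : ℂ) (m : ℕ) {p : ℕ} (w : Fin p → ℂ) : Prop :=
  Function.Injective w ∧ ∀ a b, ∀ c, 1 ≤ c → c ≤ m → q ^ c * w a ≠ w b

section Strings

variable {q : ℂ} {m p : ℕ} {w : Fin p → ℂ} {l : Fin p → ℕ}

theorem Generic.ne_zero (h : Generic q m w) (hm : 1 ≤ m) (a : Fin p) : w a ≠ 0 := fun h0 =>
  h.2 a a 1 le_rfl hm (by simp [h0])

theorem Generic.eq_of_eq (hq : q ≠ 0) (h : Generic q m w) {a b : Fin p} {i j : ℕ} (hi : i ≤ m)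
    (hj : j ≤ m) (e : q ^ i * w a = q ^ j * w b) : a = b ∧ i = j := by
  have aux : ∀ {a b : Fin p} {i j : ℕ}, j ≤ m → i ≤ j → q ^ i * w a = q ^ j * w b →
      a = b ∧ i = j := by
    intro a b i j hj hij e
    obtain ⟨c, rfl⟩ := Nat.exists_eq_add_of_le hij
    rw [pow_add, mul_assoc] at e
    have e' := mul_left_cancel₀ (pow_ne_zero i hq) e
    rcases Nat.eq_zero_or_pos c with rfl | hc
    · simp only [pow_zero, one_mul] at e'
      exact ⟨h.1 e', rfl⟩
    · exact absurd e'.symm (h.2 b a c hc (by omega))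
  rcases le_total i j with hij | hij
  · exact aux hj hij e
  · have := aux hi hij e.symm
    exact ⟨this.1.symm, this.2.symm⟩

theorem mem_stringSet {z : ℂ} :
    z ∈ stringSet q l w ↔ ∃ b, ∃ i < l b, q ^ i * w b = z := by
  simp [stringSet]

theorem prod_stringSet {M : Type*} [CommMonoid M] (hq : q ≠ 0) (h : Generic q m w)
    (hl : ∀ b, l b ≤ m) (g : ℂ → M) :
    ∏ z ∈ stringSet q l w, g z = ∏ b, ∏ i ∈ Finset.range (l b), g (q ^ i * w b) := by
  rw [stringSet, Finset.prod_biUnion]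
  · refine Finset.prod_congr rfl fun b _ => Finset.prod_image fun i hi j hj e => ?_
    exact (h.eq_of_eq hq ((Finset.mem_range.1 hi).le.trans (hl b))
      ((Finset.mem_range.1 hj).le.trans (hl b)) e).2
  · intro a _ b _ hab
    rw [Function.onFun, Finset.disjoint_left]
    intro z hz hz'
    obtain ⟨i, hi, rfl⟩ := Finset.mem_image.1 hz
    obtain ⟨j, hj, e⟩ := Finset.mem_image.1 hz'
    exact hab (h.eq_of_eq hq ((Finset.mem_range.1 hj).le.trans (hl b))
      ((Finset.mem_range.1 hi).le.trans (hl a)) e).1.symm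

theorem sum_stringSet {M : Type*} [AddCommMonoid M] (hq : q ≠ 0) (h : Generic q m w)
    (hl : ∀ b, l b ≤ m) (g : ℂ → M) :
    ∑ z ∈ stringSet q l w, g z = ∑ b, ∑ i ∈ Finset.range (l b), g (q ^ i * w b) :=
  prod_stringSet (M := Multiplicative M) hq h hl g

/-- The recursion for the Bethe sum over strings: only the ends of the strings can come first. -/
theorem betheSet_stringSet (hq : q ≠ 0) (ν : ℝ) (h : Generic q m w) (hl : ∀ b, l b ≤ m)
    (hl1 : ∀ b, 1 ≤ l b) {s : ℕ} (n : Fin (s + 1) → ℤ) :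
    betheSet q ν n (stringSet q l w) = ∑ b,
      (∏ y ∈ (stringSet q l w).erase (q ^ (l b - 1) * w b),
        (y - q * (q ^ (l b - 1) * w b)) / (y - q ^ (l b - 1) * w b)) *
      (xi ν (q ^ (l b - 1) * w b) ^ n 0 *
        betheSet q ν (fun j => n j.succ) ((stringSet q l w).erase (q ^ (l b - 1) * w b))) := by
  rw [betheSet, sum_stringSet hq h hl]
  refine Finset.sum_congr rfl fun b _ => ?_
  refine Finset.sum_eq_single (l b - 1) (fun i hi hne => ?_) fun hn => ?_
  · rw [Finset.mem_range] at hi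
    -- For a point that is not the end of its string, the next point y = qz is still in the set and
    -- the numerator y - qz vanishes.
    rw [Finset.prod_eq_zero (i := q * (q ^ i * w b)), zero_mul]
    · rw [Finset.mem_erase, mem_stringSet]
      refine ⟨fun e => ?_, b, i + 1, by omega, by rw [pow_succ']; ring⟩
      rw [← mul_assoc, ← pow_succ'] at e
      have := (h.eq_of_eq hq (by have := hl b; omega) (by have := hl b; omega) e).2
      omega
    · simp
  · exact absurd (Finset.mem_range.2 (by have := hl1 b; omega)) hn

theorem erase_stringSet_update (hq : q ≠ 0) (h : Generic q m w) (b : Fin p)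
    (hl : ∀ a, l a ≤ m) :
    (stringSet q (Function.update l b (l b + 1)) w).erase (q ^ l b * w b) = stringSet q l w := by
  ext z
  rw [Finset.mem_erase, mem_stringSet, mem_stringSet]
  constructor
  · rintro ⟨hz, a, i, hi, rfl⟩
    by_cases hab : a = b
    · subst hab
      rw [Function.update_self] at hi
      have : i ≠ l a := fun e => hz (by rw [e])
      exact ⟨a, i, by omega, rfl⟩
    · rw [Function.update_of_ne hab] at hi
      exact ⟨a, i, hi, rfl⟩
  · rintro ⟨a, i, hi, rfl⟩
    refine ⟨fun e => ?_, a, i, ?_, rfl⟩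
    · obtain ⟨rfl, rfl⟩ := h.eq_of_eq hq (hi.le.trans (hl a)) (hl b) e
      exact lt_irrefl _ hi
    · by_cases hab : a = b
      · subst hab
        rw [Function.update_self]
        omega
      · rwa [Function.update_of_ne hab]

theorem erase_stringSet_insertNth (hq : q ≠ 0) {l : Fin p → ℕ} {w : Fin p → ℂ} {z : ℂ}
    (b : Fin (p + 1)) (h : Generic q m (b.insertNth z w : Fin (p + 1) → ℂ)) (hl : ∀ a, l a ≤ m) :
    (stringSet q (b.insertNth 1 l : Fin (p + 1) → ℕ) (b.insertNth z w)).erase z =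
      stringSet q l w := by
  ext y
  rw [Finset.mem_erase, mem_stringSet, mem_stringSet]
  constructor
  · rintro ⟨hy, a, i, hi, rfl⟩
    revert hi hy
    refine Fin.succAboveCases b ?_ (fun a => ?_) a
    · intro hi hy
      simp only [Fin.insertNth_apply_same, Nat.lt_one_iff] at hi hy
      simp [hi] at hy
    · intro hi hy
      simp only [Fin.insertNth_apply_succAbove] at hi ⊢
      exact ⟨a, i, hi, rfl⟩
  · rintro ⟨a, i, hi, rfl⟩
    refine ⟨fun e => ?_, b.succAbove a, i, by simpa using hi, by simp⟩
    have e' : q ^ i * (b.insertNth z w : Fin (p + 1) → ℂ) (b.succAbove a) =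
        q ^ 0 * (b.insertNth z w : Fin (p + 1) → ℂ) b := by simpa using e
    exact Fin.succAbove_ne b a (h.eq_of_eq hq (hi.le.trans (hl a)) (Nat.zero_le _) e').1

end Strings

/-! ### Products over a string -/

/-- The product telescopes: the denominator at one point of the string is the numerator at the next.
-/
theorem prod_string_kernel {q z w : ℂ} {l : ℕ} (hl : 1 ≤ l)
    (h : ∀ i, 1 ≤ i → i < l → z ≠ q ^ i * w) :
    ∏ i ∈ Finset.range l, (z - q ^ i * w) / (z - q * (q ^ i * w)) = (z - w) / (z - q ^ l * w) := by
  induction l, hl using Nat.le_induction with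
  | base => simp
  | succ l hl ih =>
    rw [Finset.prod_range_succ, ih fun i h1 h2 => h i h1 (h2.trans (Nat.lt_succ_self l)),
      div_mul_div_cancel₀ (sub_ne_zero.2 (h l hl (Nat.lt_succ_self l))), ← mul_assoc, ← pow_succ']

/-- Telescoping again, each cancellation leaving a factor q. The last factor is written so that no
exponent l - 1 appears. -/
theorem prod_string_scatter {q u w : ℂ} (hq : q ≠ 0) {l : ℕ} (hl : 1 ≤ l)
    (h : ∀ i, i < l → q ^ i * w ≠ u) :
    ∏ i ∈ Finset.range l, (q ^ i * w - q * u) / (q ^ i * w - u) =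
      q ^ l * ((w - q * u) / (q ^ l * w - q * u)) := by
  induction l, hl using Nat.le_induction with
  | base =>
    simp only [Finset.prod_range_one, pow_zero, one_mul, pow_one]
    rw [← mul_sub]
    field_simp
  | succ l hl ih =>
    have h1 : q ^ l * w - q * u ≠ 0 := by
      obtain ⟨j, rfl⟩ := Nat.exists_eq_add_of_le' hl
      rw [pow_succ', mul_assoc, ← mul_sub]
      exact mul_ne_zero hq (sub_ne_zero.2 (h j (by omega)))
    have h2 : q ^ l * w - u ≠ 0 := sub_ne_zero.2 (h l (Nat.lt_succ_self l))
    rw [Finset.prod_range_succ, ih fun i hi => h i (hi.trans (Nat.lt_succ_self l)), pow_succ' q l,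
      mul_assoc q _ w, ← mul_sub]
    field_simp

/-! ### The density in product form -/

/-- The interaction of two strings. -/
def pairFac (q : ℂ) (l : ℕ) (w : ℂ) (l' : ℕ) (w' : ℂ) : ℂ :=
  (q ^ (l * l'))⁻¹ * ((q ^ l * w - q ^ l' * w') * (w' - w) / ((q ^ l * w - w') * (q ^ l' * w' - w)))

/-- The weight of a single string. -/
def stringFac (q : ℂ) (l : ℕ) (w : ℂ) : ℂ := (1 - q) ^ l * (-1) ^ l * (w ^ (l - 1) / (q ^ l - 1))

/-- The Plancherel density, without its symmetry factor, in product form. -/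
def density (q : ℂ) {p : ℕ} (l : Fin p → ℕ) (w : Fin p → ℂ) : ℂ :=
  (∏ a, stringFac q (l a) (w a)) * ∏ a, ∏ b ∈ Finset.Iio a, pairFac q (l a) (w a) (l b) (w b)

theorem pairFac_comm (q : ℂ) (l : ℕ) (w : ℂ) (l' : ℕ) (w' : ℂ) :
    pairFac q l w l' w' = pairFac q l' w' l w := by
  rw [pairFac, pairFac, mul_comm l l', mul_comm (q ^ l * w - w'), ← neg_sub (q ^ l' * w'),
    ← neg_sub w w', neg_mul_neg]

/-- The cycle `i.cycleRange.symm` brings the index i to the front, and symmetry of P makes the order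
within pairs irrelevant. -/
theorem prod_Iio_succAbove {p : ℕ} {M : Type*} [CommMonoid M] (P : Fin (p + 1) → Fin (p + 1) → M)
    (hP : ∀ a b, P a b = P b a) (i : Fin (p + 1)) :
    ∏ a, ∏ b ∈ Finset.Iio a, P a b =
      (∏ j, P i (i.succAbove j)) * ∏ a, ∏ b ∈ Finset.Iio a, P (i.succAbove a) (i.succAbove b) := by
  have h := prod_Iio_comp_perm P i.cycleRange.symm
  rw [prod_Iio_succ] at h
  simp only [Fin.cycleRange_symm_zero, Fin.cycleRange_symm_succ] at h
  have e : ∏ a, ∏ b ∈ Finset.Iio a, P a b = ∏ a, ∏ b ∈ Finset.Iio a,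
      if i.cycleRange.symm.symm b < i.cycleRange.symm.symm a then P a b else P b a := by
    refine Finset.prod_congr rfl fun a _ => Finset.prod_congr rfl fun b _ => ?_
    split_ifs
    · rfl
    · exact hP a b
  rw [e, ← h]
  congr 1
  exact Finset.prod_congr rfl fun j _ => hP _ _

theorem prod_Iio_comp_perm_of_symm {p : ℕ} {M : Type*} [CommMonoid M] (P : Fin p → Fin p → M)
    (hP : ∀ a b, P a b = P b a) (σ : Equiv.Perm (Fin p)) :
    ∏ a, ∏ b ∈ Finset.Iio a, P (σ a) (σ b) = ∏ a, ∏ b ∈ Finset.Iio a, P a b := by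
  rw [prod_Iio_comp_perm]
  refine Finset.prod_congr rfl fun a _ => Finset.prod_congr rfl fun b _ => ?_
  split_ifs
  · rfl
  · exact hP b a

theorem density_comp_perm (q : ℂ) {p : ℕ} (l : Fin p → ℕ) (w : Fin p → ℂ)
    (σ : Equiv.Perm (Fin p)) : density q (l ∘ σ) (w ∘ σ) = density q l w := by
  rw [density, density]
  congr 1
  · exact Equiv.prod_comp σ fun a => stringFac q (l a) (w a)
  · exact prod_Iio_comp_perm_of_symm (fun a b => pairFac q (l a) (w a) (l b) (w b))
      (fun a b => pairFac_comm _ _ _ _ _) σ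

theorem density_succAbove (q : ℂ) {p : ℕ} (l : Fin (p + 1) → ℕ) (w : Fin (p + 1) → ℂ)
    (b : Fin (p + 1)) : density q l w = stringFac q (l b) (w b) *
      (∏ j, pairFac q (l b) (w b) (l (b.succAbove j)) (w (b.succAbove j))) *
      density q (fun j => l (b.succAbove j)) (fun j => w (b.succAbove j)) := by
  rw [density, density, prod_Iio_succAbove (fun a b => pairFac q (l a) (w a) (l b) (w b))
    (fun a b => pairFac_comm _ _ _ _ _) b, Fin.prod_univ_succAbove _ b]
  ring

theorem prod_erase_succAbove {p : ℕ} {M : Type*} [CommMonoid M] (f : Fin (p + 1) → M)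
    (b : Fin (p + 1)) : ∏ a ∈ Finset.univ.erase b, f a = ∏ j, f (b.succAbove j) := by
  rw [← Finset.prod_image (s := Finset.univ) (g := b.succAbove) (f := f)
    fun _ _ _ _ h => Fin.succAbove_right_injective h]
  refine Finset.prod_congr ?_ fun _ _ => rfl
  ext a
  simp only [Finset.mem_erase, Finset.mem_univ, and_true, Finset.mem_image, true_and]
  exact Fin.exists_succAbove_eq_iff.symm

/-- A string of length one has weight 1. Its interaction with another string, times the scattering
factor of z with that string, is the factor (z - w)/(z - q^l w) left by integrating the inner
variables. -/
theorem density_insertNth_mul {q : ℂ} (hq0 : q ≠ 0) (hq1 : q ≠ 1) {p : ℕ} (b : Fin (p + 1))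
    (l : Fin p → ℕ) (w : Fin p → ℂ) {z : ℂ} (h1 : ∀ a, q * z ≠ w a)
    (h2 : ∀ a, q ^ l a * w a ≠ q * z) (h3 : ∀ a, z ≠ q ^ l a * w a) :
    density q (b.insertNth 1 l : Fin (p + 1) → ℕ) (b.insertNth z w) *
      ∏ a, (q ^ l a * ((w a - q * z) / (q ^ l a * w a - q * z))) =
    density q l w * ∏ a, (z - w a) / (z - q ^ l a * w a) := by
  rw [density_succAbove q _ _ b]
  simp only [Fin.insertNth_apply_same, Fin.insertNth_apply_succAbove]
  have hs : stringFac q 1 z = 1 := by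
    have : q - 1 ≠ 0 := sub_ne_zero.2 hq1
    rw [stringFac]
    simp only [pow_one, Nat.sub_self, pow_zero]
    field_simp
    ring
  rw [hs, one_mul, mul_right_comm, mul_comm (density q l w), ← Finset.prod_mul_distrib]
  congr 1
  refine Finset.prod_congr rfl fun a _ => ?_
  have e1 := sub_ne_zero.2 (h1 a)
  have e2 := sub_ne_zero.2 (h2 a)
  have e3 := sub_ne_zero.2 (h3 a)
  have e4 : q ^ l a * w a - z ≠ 0 := sub_ne_zero.2 (h3 a).symm
  have e5 := pow_ne_zero (l a) hq0
  rw [pairFac, one_mul, pow_one, mul_mul_mul_comm, inv_mul_cancel₀ e5, one_mul, div_mul_div_comm,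
    div_eq_div_iff (mul_ne_zero (mul_ne_zero e1 e4) e2) e3]
  ring

/-- Besides the old density, the right side is the residue of ∏ (z - w_a)/(z - q^(l_a) w_a) at z =
q^(l_b) w_b: taking this residue prolongs the string b. The string b itself (`e0`) and its
interactions with the others (`e1`) are compared separately. -/
theorem density_update_mul {q : ℂ} (hq0 : q ≠ 0) {p : ℕ} (b : Fin (p + 1))
    (l : Fin (p + 1) → ℕ) (w : Fin (p + 1) → ℂ) (hl : 1 ≤ l b) (hw : w b ≠ 0)
    (hb : q ^ l b ≠ 1) (hb' : q ^ (l b + 1) ≠ 1) (hq1 : q ≠ 1)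
    (h1 : ∀ j, q ^ (l b + 1) * w b ≠ w (b.succAbove j))
    (h2 : ∀ j, q ^ l (b.succAbove j) * w (b.succAbove j) ≠ q ^ (l b + 1) * w b)
    (h3 : ∀ j, q ^ l b * w b ≠ q ^ l (b.succAbove j) * w (b.succAbove j))
    (h4 : ∀ j, q ^ l b * w b ≠ w (b.succAbove j))
    (h5 : ∀ j, q ^ l (b.succAbove j) * w (b.succAbove j) ≠ w b) :
    density q (Function.update l b (l b + 1)) w *
      ∏ a, (q ^ l a * ((w a - q * (q ^ l b * w b)) / (q ^ l a * w a - q * (q ^ l b * w b)))) =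
    density q l w * ((∏ a, (q ^ l b * w b - w a)) *
      ∏ a ∈ Finset.univ.erase b, (q ^ l b * w b - q ^ l a * w a)⁻¹) := by
  rw [density_succAbove q _ _ b, density_succAbove q l w b, prod_erase_succAbove,
    Fin.prod_univ_succAbove _ b, Fin.prod_univ_succAbove (fun a => q ^ l b * w b - w a) b]
  simp only [Function.update_self, Function.update_of_ne (Fin.succAbove_ne b _)]
  set D := density q (fun j => l (b.succAbove j)) fun j => w (b.succAbove j)
  have e0 : stringFac q (l b + 1) (w b) *
      (q ^ l b * ((w b - q * (q ^ l b * w b)) / (q ^ l b * w b - q * (q ^ l b * w b)))) =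
      stringFac q (l b) (w b) * (q ^ l b * w b - w b) := by
    obtain ⟨d, hd⟩ := Nat.exists_eq_add_of_le' hl
    have e1 : q ^ l b - 1 ≠ 0 := sub_ne_zero.2 hb
    have e2 : q ^ (l b + 1) - 1 ≠ 0 := sub_ne_zero.2 hb'
    have e3 : 1 - q ≠ 0 := sub_ne_zero.2 hq1.symm
    have e4 : q ^ l b * w b - q * (q ^ l b * w b) = q ^ l b * w b * (1 - q) := by ring
    have e5 : w b - q * (q ^ l b * w b) = -(w b * (q ^ (l b + 1) - 1)) := by ring
    have e6 := pow_ne_zero (l b) hq0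
    rw [stringFac, stringFac, e4, e5, Nat.add_sub_cancel, pow_succ (1 - q), pow_succ (-1 : ℂ)]
    have e7 : w b ^ l b = w b ^ (l b - 1) * w b := by
      rw [hd, Nat.add_sub_cancel, pow_succ]
    rw [e7]
    generalize q ^ (l b + 1) - 1 = A at e2 ⊢
    have e8 : q ^ l b * w b - w b = (q ^ l b - 1) * w b := by ring
    rw [e8]
    generalize hB : q ^ l b - 1 = B at e1 ⊢
    generalize q ^ l b = Q at e6 ⊢
    field_simp
  have e1 : (∏ j, pairFac q (l b + 1) (w b) (l (b.succAbove j)) (w (b.succAbove j))) *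
      ∏ j, (q ^ l (b.succAbove j) * ((w (b.succAbove j) - q * (q ^ l b * w b)) /
        (q ^ l (b.succAbove j) * w (b.succAbove j) - q * (q ^ l b * w b)))) =
      (∏ j, pairFac q (l b) (w b) (l (b.succAbove j)) (w (b.succAbove j))) *
        ((∏ j, (q ^ l b * w b - w (b.succAbove j))) *
          ∏ j, (q ^ l b * w b - q ^ l (b.succAbove j) * w (b.succAbove j))⁻¹) := by
    rw [← Finset.prod_mul_distrib, ← Finset.prod_mul_distrib, ← Finset.prod_mul_distrib]
    refine Finset.prod_congr rfl fun j _ => ?_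
    have e1 := sub_ne_zero.2 (h1 j)
    have e2 := sub_ne_zero.2 (h2 j)
    have e3 := sub_ne_zero.2 (h3 j)
    have e4 := sub_ne_zero.2 (h4 j)
    have e5 := sub_ne_zero.2 (h5 j)
    have e6 := pow_ne_zero (l (b.succAbove j)) hq0
    have e7 := pow_ne_zero (l b * l (b.succAbove j)) hq0
    rw [pairFac, pairFac, add_mul, one_mul, pow_add]
    have e8 : q * (q ^ l b * w b) = q ^ (l b + 1) * w b := by ring
    rw [e8]
    generalize q ^ (l b + 1) * w b = X at *
    generalize q ^ l b * w b = Y at *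
    generalize q ^ (l b * l (b.succAbove j)) = Q at *
    generalize w (b.succAbove j) = W at *
    generalize q ^ l (b.succAbove j) = R at *
    field_simp
    ring
  linear_combination (D * (∏ j, pairFac q (l b + 1) (w b) (l (b.succAbove j)) (w (b.succAbove j))) *
      ∏ j, (q ^ l (b.succAbove j) * ((w (b.succAbove j) - q * (q ^ l b * w b)) /
        (q ^ l (b.succAbove j) * w (b.succAbove j) - q * (q ^ l b * w b))))) * e0 +
    (D * (stringFac q (l b) (w b) * (q ^ l b * w b - w b))) * e1

/-! ### Integrals over powers of a circle -/

theorem Contour.IsCircle.injOn {C : Contour} {r : ℝ} (h : C.IsCircle r) :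
    InjOn C.toFun (Ioo 0 1) := by
  intro s hs t ht e
  rw [h.2 s (Ioo_subset_Icc_self hs), h.2 t (Ioo_subset_Icc_self ht),
    circleMap_eq_circleMap_iff 1 h.1.ne'] at e
  obtain ⟨n, hn⟩ := e
  have h1 : (s : ℂ) = t + n := by
    have h2 : (2 * Real.pi * Complex.I : ℂ) ≠ 0 := Complex.two_pi_I_ne_zero
    refine mul_left_cancel₀ h2 ?_
    push_cast at hn
    linear_combination hn
  have h2 : s = t + n := by exact_mod_cast h1
  have h3 : (n : ℝ) < 1 := by linarith [hs.2, ht.1]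
  have h4 : (-1 : ℝ) < n := by linarith [hs.1, ht.2]
  have h5 : n = 0 := by
    have h6 : n < 1 := by exact_mod_cast h3
    have h7 : -1 < n := by exact_mod_cast h4
    omega
  rw [h2, h5, Int.cast_zero, add_zero]

/-- Off the end parameters the circle is injective, and coincidences of parameters fill only the
hyperplanes t_i = t_j, which are null sets. -/
theorem ae_injective_of_isCircle {C : Contour} {r : ℝ} (h : C.IsCircle r) (p : ℕ) :
    ∀ᵐ t : Fin p → ℝ, t ∈ Icc (0 : Fin p → ℝ) 1 → Function.Injective fun j => C.toFun (t j) := by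
  have h0 : ∀ᵐ t : Fin p → ℝ, ∀ i, t i ≠ 0 :=
    ae_all_iff.2 fun i => by rw [volume_pi]; exact Measure.ae_eval_ne (μ := fun _ : Fin p => (volume : Measure ℝ)) i 0
  have h1 : ∀ᵐ t : Fin p → ℝ, ∀ i, t i ≠ 1 :=
    ae_all_iff.2 fun i => by rw [volume_pi]; exact Measure.ae_eval_ne (μ := fun _ : Fin p => (volume : Measure ℝ)) i 1
  have h2 : ∀ᵐ t : Fin p → ℝ, ∀ i j, i ≠ j → t i ≠ t j := by
    refine ae_all_iff.2 fun i => ae_all_iff.2 fun j => ?_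
    by_cases hij : i = j
    · simp [hij]
    set s : Submodule ℝ (Fin p → ℝ) :=
      LinearMap.ker ((LinearMap.proj i : (Fin p → ℝ) →ₗ[ℝ] ℝ) - LinearMap.proj j) with hs
    have hne : s ≠ ⊤ := fun e => by
      have h3 : Pi.single i (1 : ℝ) ∈ s := e ▸ Submodule.mem_top
      change (Pi.single i (1 : ℝ) : Fin p → ℝ) i - (Pi.single i (1 : ℝ) : Fin p → ℝ) j = 0 at h3
      simp [Ne.symm hij] at h3
    have := Measure.addHaar_submodule (volume : Measure (Fin p → ℝ)) s hne
    rw [ae_iff]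
    refine measure_mono_null (fun t ht => ?_) this
    have ht' : t i = t j := by
      by_contra hne'
      exact ht fun _ => hne'
    change t i - t j = 0
    rw [ht', sub_self]
  filter_upwards [h0, h1, h2] with t h0 h1 h2 ht i j e
  by_contra hij
  have hI : ∀ i, t i ∈ Ioo (0 : ℝ) 1 := fun i =>
    ⟨lt_of_le_of_ne (ht.1 i) (h0 i).symm, lt_of_le_of_ne (ht.2 i) (h1 i)⟩
  exact h2 i j hij (h.injOn (hI i) (hI j) e)

/-- Integrands agreeing at points with distinct coordinates have the same integral. -/
theorem multiIntegral_congr_injective {C : Contour} {r : ℝ} (h : C.IsCircle r) {p : ℕ}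
    {f g : (Fin p → ℂ) → ℂ} (hfg : ∀ w ∈ ranges fun _ : Fin p => C, Function.Injective w →
      f w = g w) : multiIntegral (fun _ => C) f = multiIntegral (fun _ => C) g := by
  rw [multiIntegral, multiIntegral]
  congr 1
  refine setIntegral_congr_ae measurableSet_Icc ?_
  filter_upwards [ae_injective_of_isCircle h p] with t ht ht'
  rw [hfg _ (fun j => C.mem_range ⟨ht'.1 j, ht'.2 j⟩) (ht ht')]

/-- A function on the power of a contour is regular if it agrees with a continuous function at
points with distinct coordinates. -/
def Regular (C : Contour) {p : ℕ} (f : (Fin p → ℂ) → ℂ) : Prop :=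
  ∃ F, ContinuousOn F (ranges fun _ : Fin p => C) ∧
    ∀ w ∈ ranges fun _ : Fin p => C, Function.Injective w → f w = F w

theorem Regular.congr {C : Contour} {p : ℕ} {f g : (Fin p → ℂ) → ℂ} (hg : Regular C g)
    (h : ∀ w ∈ ranges fun _ : Fin p => C, Function.Injective w → f w = g w) : Regular C f := by
  obtain ⟨F, hF, hgF⟩ := hg
  exact ⟨F, hF, fun w hw hi => (h w hw hi).trans (hgF w hw hi)⟩

theorem Regular.mul {C : Contour} {p : ℕ} {f g : (Fin p → ℂ) → ℂ} (hf : Regular C f)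
    (hg : Regular C g) : Regular C fun w => f w * g w := by
  obtain ⟨F, hF, hfF⟩ := hf
  obtain ⟨G, hG, hgG⟩ := hg
  exact ⟨fun w => F w * G w, hF.mul hG, fun w hw hi => by simp only [hfF w hw hi, hgG w hw hi]⟩

theorem regular_of_continuousOn {C : Contour} {p : ℕ} {f : (Fin p → ℂ) → ℂ}
    (hf : ContinuousOn f (ranges fun _ : Fin p => C)) : Regular C f := ⟨f, hf, fun _ _ _ => rfl⟩

theorem Regular.const_mul {C : Contour} {p : ℕ} {f : (Fin p → ℂ) → ℂ} (hf : Regular C f) (c : ℂ) :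
    Regular C fun w => c * f w := (regular_of_continuousOn continuousOn_const).mul hf

theorem multiIntegral_sum_of_regular {C : Contour} {r : ℝ} (h : C.IsCircle r) {p : ℕ} {ι : Type*}
    (s : Finset ι) {f : ι → (Fin p → ℂ) → ℂ} (hf : ∀ i ∈ s, Regular C (f i)) :
    multiIntegral (fun _ => C) (fun w => ∑ i ∈ s, f i w) =
      ∑ i ∈ s, multiIntegral (fun _ => C) (f i) := by
  classical
  choose! F hF hfF using hf
  rw [multiIntegral_congr_injective h (g := fun w => ∑ i ∈ s, F i w) fun w hw hi =>
    Finset.sum_congr rfl fun i his => hfF i his w hw hi, multiIntegral_sum s hF]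
  exact Finset.sum_congr rfl fun i his =>
    (multiIntegral_congr_injective h fun w hw hi => hfF i his w hw hi).symm

theorem multiIntegral_comp_perm (C : Contour) {p : ℕ} (f : (Fin p → ℂ) → ℂ)
    (σ : Equiv.Perm (Fin p)) :
    multiIntegral (fun _ => C) (fun w => f (w ∘ σ)) = multiIntegral (fun _ => C) f := by
  rw [multiIntegral, multiIntegral]
  congr 1
  have hm := volume_measurePreserving_piCongrLeft (fun _ : Fin p => ℝ) σ.symm
  have happ : ∀ t : Fin p → ℝ, MeasurableEquiv.piCongrLeft (fun _ : Fin p => ℝ) σ.symm t =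
      t ∘ σ := by
    intro t
    funext i
    have h := Equiv.piCongrLeft_apply_apply (fun _ : Fin p => ℝ) σ.symm t (σ i)
    rwa [Equiv.symm_apply_apply] at h
  have h := hm.setIntegral_preimage_emb (MeasurableEquiv.measurableEmbedding _)
    (fun t => f (fun j => C.toFun (t j)) * ∏ j, deriv C.toFun (t j)) (Icc 0 1)
  rw [← h]
  have hpre : MeasurableEquiv.piCongrLeft (fun _ : Fin p => ℝ) σ.symm ⁻¹' Icc 0 1 =
      Icc (0 : Fin p → ℝ) 1 := by
    ext t
    rw [mem_preimage, happ]
    constructor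
    · intro ht
      exact ⟨fun i => by simpa using ht.1 (σ.symm i), fun i => by simpa using ht.2 (σ.symm i)⟩
    · exact fun ht => ⟨fun i => ht.1 (σ i), fun i => ht.2 (σ i)⟩
  rw [hpre]
  refine setIntegral_congr_fun measurableSet_Icc fun t _ => ?_
  simp only [happ]
  congr 1
  exact (Equiv.prod_comp σ fun j => deriv C.toFun (t j)).symm

/-! ### Continuity of parametric contour integrals -/

theorem isCompact_ranges {m : ℕ} (γ : Fin m → Contour) : IsCompact (ranges γ) := by
  have : ranges γ = Set.pi univ fun j => (γ j).range := by
    ext z; simp [ranges]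
  rw [this]
  exact isCompact_univ_pi fun j => (γ j).isCompact_range

theorem continuousOn_multiIntegral {X : Type*} [TopologicalSpace X] [FirstCountableTopology X]
    {K : Set X} (hK : IsCompact K) {m : ℕ} (γ : Fin m → Contour) {f : X → (Fin m → ℂ) → ℂ}
    (hf : ContinuousOn (fun p : X × (Fin m → ℂ) => f p.1 p.2) (K ×ˢ ranges γ)) :
    ContinuousOn (fun x => multiIntegral γ (f x)) K := by
  obtain ⟨M, hM⟩ := (hK.prod (isCompact_ranges γ)).exists_bound_of_continuousOn hf
  choose C hC0 hC using fun j => (γ j).exists_deriv_bound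
  have hmem : ∀ t ∈ Icc (0 : Fin m → ℝ) 1, (fun j => (γ j).toFun (t j)) ∈ ranges γ :=
    fun t ht j => (γ j).mem_range ⟨ht.1 j, ht.2 j⟩
  have hb : ∀ᵐ t : Fin m → ℝ, ∀ j, t j ∈ Icc (0 : ℝ) 1 → ‖deriv (γ j).toFun (t j)‖ ≤ C j := by
    refine ae_all_iff.2 fun j => ?_
    rw [volume_pi]
    exact (Measure.tendsto_eval_ae_ae (μ := fun _ : Fin m => (volume : Measure ℝ)) (i := j)).eventually
      (hC j)
  unfold multiIntegral
  refine continuousOn_const.mul (continuousOn_of_dominated (bound := fun _ => M * ∏ j, C j)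
    (fun x hx => ?_) (fun x hx => ?_) ?_ ?_)
  · refine (integrableOn_multi γ ?_).aestronglyMeasurable
    exact hf.comp (f := fun z => (x, z)) (by fun_prop) fun z hz => ⟨hx, hz⟩
  · filter_upwards [ae_restrict_of_ae hb, ae_restrict_mem measurableSet_Icc] with t ht ht'
    rw [norm_mul, norm_prod]
    have h0 := hM (x, _) ⟨hx, hmem t ht'⟩
    refine mul_le_mul h0 (Finset.prod_le_prod (fun _ _ => norm_nonneg _) fun j _ =>
      ht j ⟨ht'.1 j, ht'.2 j⟩) (Finset.prod_nonneg fun _ _ => norm_nonneg _)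
      ((norm_nonneg _).trans h0)
  · exact integrableOn_const (by simp [Real.volume_Icc_pi])
  · filter_upwards [ae_restrict_mem measurableSet_Icc] with t ht
    refine ContinuousOn.mul ?_ continuousOn_const
    exact hf.comp (f := fun x => (x, _)) (by fun_prop) fun x hx => ⟨hx, hmem t ht⟩

theorem continuousOn_cint {X : Type*} [TopologicalSpace X] [FirstCountableTopology X]
    {K : Set X} (hK : IsCompact K) (C : Contour) {f : X → ℂ → ℂ}
    (hf : ContinuousOn (fun p : X × ℂ => f p.1 p.2) (K ×ˢ C.range)) :
    ContinuousOn (fun x => cint C (f x)) K := by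
  simp only [← multiIntegral_fin_one C]
  refine continuousOn_multiIntegral hK _ ?_
  exact hf.comp (f := fun p : X × (Fin 1 → ℂ) => (p.1, p.2 0)) (by fun_prop)
    fun p hp => ⟨hp.1, hp.2 0⟩

/-! ### String lengths -/

/-- The lengths of `p` nonempty strings with `m` points in total. -/
def lengths (m p : ℕ) : Finset (Fin p → ℕ) :=
  (Finset.piAntidiag Finset.univ m).filter fun l => ∀ b, 1 ≤ l b

theorem mem_lengths {m p : ℕ} {l : Fin p → ℕ} :
    l ∈ lengths m p ↔ ∑ b, l b = m ∧ ∀ b, 1 ≤ l b := by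
  simp [lengths, Finset.mem_piAntidiag]

theorem le_of_mem_lengths {m p : ℕ} {l : Fin p → ℕ} (h : l ∈ lengths m p) (b : Fin p) :
    l b ≤ m := by
  rw [← (mem_lengths.1 h).1]
  exact Finset.single_le_sum (f := l) (fun _ _ => Nat.zero_le _) (Finset.mem_univ b)

theorem lengths_eq_empty {m p : ℕ} (h : m < p) : lengths m p = ∅ := by
  refine Finset.eq_empty_of_forall_notMem fun l hl => ?_
  rw [mem_lengths] at hl
  have := Finset.sum_le_sum fun b (_ : b ∈ Finset.univ) => hl.2 b
  rw [hl.1] at this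
  simp at this
  omega

theorem insertNth_mem_lengths {m p : ℕ} (b : Fin (p + 1)) {l : Fin p → ℕ} :
    (b.insertNth 1 l : Fin (p + 1) → ℕ) ∈ lengths (m + 1) (p + 1) ↔ l ∈ lengths m p := by
  rw [mem_lengths, mem_lengths, Fin.sum_univ_succAbove _ b, Fin.forall_iff_succAbove b]
  simp only [Fin.insertNth_apply_same, Fin.insertNth_apply_succAbove, le_refl, true_and]
  constructor <;> rintro ⟨h1, h2⟩ <;> exact ⟨by omega, h2⟩

theorem update_mem_lengths {m p : ℕ} (b : Fin p) {l : Fin p → ℕ} (h : l ∈ lengths m p) :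
    Function.update l b (l b + 1) ∈ lengths (m + 1) p := by
  rw [mem_lengths] at h ⊢
  refine ⟨?_, fun a => ?_⟩
  · rw [Finset.sum_update_of_mem (Finset.mem_univ b), ← h.1,
      ← Finset.add_sum_erase Finset.univ l (Finset.mem_univ b), Finset.sdiff_singleton_eq_erase]
    omega
  · by_cases hab : a = b
    · subst hab; simp
    · rw [Function.update_of_ne hab]; exact h.2 a

theorem update_pred_mem_lengths {m p : ℕ} (b : Fin p) {l : Fin p → ℕ} (h : l ∈ lengths (m + 1) p)
    (hb : l b ≠ 1) : Function.update l b (l b - 1) ∈ lengths m p := by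
  rw [mem_lengths] at h ⊢
  have hb1 := h.2 b
  refine ⟨?_, fun a => ?_⟩
  · rw [Finset.sum_update_of_mem (Finset.mem_univ b), Finset.sdiff_singleton_eq_erase]
    have := h.1
    rw [← Finset.add_sum_erase Finset.univ l (Finset.mem_univ b)] at this
    omega
  · by_cases hab : a = b
    · subst hab; simp; omega
    · rw [Function.update_of_ne hab]; exact h.2 a

/-- The numbers and lengths of the strings with `m` points in total. -/
def stringData (m : ℕ) : Finset (Σ p, Fin p → ℕ) := (Finset.range (m + 1)).sigma fun p => lengths m p

/-- Extending strings by one point: either a new string is created or a string is prolonged. -/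
theorem sum_stringData_succ (m : ℕ) (T : ∀ p, (Fin p → ℕ) → Fin p → ℂ) (N : ∀ p, (Fin p → ℕ) → ℂ)
    (hN : ∀ p, ∀ l ∈ lengths m p, ∀ b : Fin (p + 1), T (p + 1) (b.insertNth 1 l) b = N p l) :
    ∑ x ∈ stringData (m + 1), ((x.1.factorial : ℂ))⁻¹ * ∑ b, T x.1 x.2 b =
      ∑ x ∈ stringData m, ((x.1.factorial : ℂ))⁻¹ *
        (N x.1 x.2 + ∑ b, T x.1 (Function.update x.2 b (x.2 b + 1)) b) := by
  rw [stringData, stringData, Finset.sum_sigma, Finset.sum_sigma]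
  simp only [← Finset.mul_sum]
  -- The marked string b either has length 1, and is new, or arises from exactly one tuple of total
  -- m by prolonging b.
  have hsplit : ∀ p, ∑ l ∈ lengths (m + 1) p, ∑ b, T p l b =
      (∑ b, ∑ l ∈ (lengths (m + 1) p).filter fun l => l b = 1, T p l b) +
      ∑ l ∈ lengths m p, ∑ b, T p (Function.update l b (l b + 1)) b := by
    intro p
    rw [Finset.sum_comm, Finset.sum_comm (s := lengths m p), ← Finset.sum_add_distrib]
    refine Finset.sum_congr rfl fun b _ => ?_
    rw [← Finset.sum_filter_add_sum_filter_not (lengths (m + 1) p) fun l => l b = 1]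
    congr 1
    refine Finset.sum_nbij' (fun l => Function.update l b (l b - 1))
      (fun l => Function.update l b (l b + 1)) (fun l hl => ?_) (fun l hl => ?_) (fun l hl => ?_)
      (fun l hl => ?_) fun l hl => ?_
    · rw [Finset.mem_filter] at hl
      exact update_pred_mem_lengths b hl.1 hl.2
    · rw [Finset.mem_filter]
      have := (mem_lengths.1 hl).2 b
      exact ⟨update_mem_lengths b hl, by rw [Function.update_self]; omega⟩
    · rw [Finset.mem_filter] at hl
      have := (mem_lengths.1 hl.1).2 b
      simp [Nat.sub_add_cancel this]
    · simp
    · rw [Finset.mem_filter] at hl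
      have := (mem_lengths.1 hl.1).2 b
      simp [Nat.sub_add_cancel this]
  -- A new string may take any of p + 1 positions with equal contributions by `hN`; the factor p + 1
  -- turns 1/(p + 1)! into 1/p!.
  have hnew : ∀ p, ∑ b, ∑ l ∈ (lengths (m + 1) (p + 1)).filter (fun l => l b = 1), T (p + 1) l b =
      (p + 1) * ∑ l ∈ lengths m p, N p l := by
    intro p
    have : ∀ b : Fin (p + 1), ∑ l ∈ (lengths (m + 1) (p + 1)).filter (fun l => l b = 1),
        T (p + 1) l b = ∑ l ∈ lengths m p, N p l := by
      intro b
      have hins : ∀ l : Fin (p + 1) → ℕ, l b = 1 → b.insertNth 1 (b.removeNth l) = l := fun l hl => by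
        have := Fin.insertNth_self_removeNth b l
        rwa [hl] at this
      refine Finset.sum_nbij' (fun l => b.removeNth l) (fun l => b.insertNth 1 l) (fun l hl => ?_)
        (fun l hl => ?_) (fun l hl => ?_) (fun l hl => ?_) fun l hl => ?_
      · rw [Finset.mem_filter] at hl
        rw [← insertNth_mem_lengths b, hins l hl.2]
        exact hl.1
      · rw [Finset.mem_filter]
        exact ⟨(insertNth_mem_lengths b).2 hl, by simp⟩
      · exact hins l (Finset.mem_filter.1 hl).2
      · simp
      · rw [Finset.mem_filter] at hl
        rw [← hN p _ ((insertNth_mem_lengths b).1 ((hins l hl.2).symm ▸ hl.1)) b, hins l hl.2]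
    simp [this]
  have hz : (lengths (m + 1) 0) = ∅ := by
    refine Finset.eq_empty_of_forall_notMem fun l hl => ?_
    have := (mem_lengths.1 hl).1
    simp at this
  simp only [hsplit, mul_add, Finset.sum_add_distrib]
  congr 1
  · rw [Finset.sum_range_succ']
    simp only [hnew]
    simp only [Finset.univ_eq_empty, Finset.sum_empty, mul_zero, add_zero]
    refine Finset.sum_congr rfl fun p _ => ?_
    rw [Nat.factorial_succ, ← mul_assoc]
    congr 1
    have h1 : (p : ℂ) + 1 ≠ 0 := Nat.cast_add_one_ne_zero p
    have h2 : (p.factorial : ℂ) ≠ 0 := Nat.cast_ne_zero.2 p.factorial_ne_zero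
    push_cast
    field_simp
  · rw [Finset.sum_range_succ, lengths_eq_empty (Nat.lt_succ_self m)]
    simp

/-! ### Residue expansion of nested contour integrals -/

/-- The configurations of contours and poles for which nested integrals are expanded into integrals
over the last contour `C`. -/
structure Expandable (q : ℂ) (ν : ℝ) {m : ℕ} (γ : Fin m → Contour) (C : Contour) (S : Set ℂ) :
    Prop where
  one_mem : (1 : ℂ) ∈ S
  nu_mem : ∀ p : ℂ, (ν : ℂ) * p = 1 → p ∈ S
  poles : ∀ p ∈ S, ∀ j, p ∉ (γ j).range ∧ p ∉ C.range ∧ (γ j).winding p = C.winding p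
  strings : ∀ c < m, ∀ w ∈ C.range, q ^ c * w ∉ S
  contains : ∀ (a : Fin m) (c : ℕ), 1 ≤ c → c + a + 1 ≤ m → ∀ w ∈ C.range,
    (γ a).Contains (q ^ c * w)
  avoids : ∀ c, 1 ≤ c → c ≤ m → ∀ w ∈ C.range, C.Avoids (q ^ c * w)
  nested : ∀ a b, a < b → ∀ z ∈ (γ a).range, (γ b).Avoids (z / q)
  circle : ∀ a : Fin m, (a : ℕ) + 1 < m → ∀ z ∈ (γ a).range, C.Avoids (z / q)

/-- Freezing z on the outermost contour adds the pole z/q, from the factor z - q y, to the remaining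
variables. It is enclosed neither by the inner contours nor by C, so it joins S. It lies on no
string, since z = q^(c+1) w would be both on the outermost contour and enclosed by it. -/
theorem Expandable.tail {q : ℂ} (hq : q ≠ 0) {ν : ℝ} {m : ℕ} {γ : Fin (m + 1) → Contour}
    {C : Contour} {S : Set ℂ} (E : Expandable q ν γ C S) {z : ℂ} (hz : z ∈ (γ 0).range) :
    Expandable q ν (fun j : Fin m => γ j.succ) C (insert (z / q) S) where
  one_mem := Or.inr E.one_mem
  nu_mem p hp := Or.inr (E.nu_mem p hp)
  poles p hp j := by
    rcases hp with rfl | hp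
    · have h1 := E.nested 0 j.succ (Fin.succ_pos j) z hz
      have h2 := E.circle 0 (by have := j.2; simp only [Fin.val_zero]; omega) z hz
      exact ⟨h1.1, h2.1, h1.2.trans h2.2.symm⟩
    · exact E.poles p hp j.succ
  strings c hc w hw := by
    rintro (h | h)
    · have h1 := (E.contains 0 (c + 1) (by omega) (by simp only [Fin.val_zero]; omega) w hw).1
      rw [pow_succ', mul_assoc, h, mul_div_cancel₀ _ hq] at h1
      exact h1 hz
    · exact E.strings c (by omega) w hw h
  contains a c h1 h2 := E.contains a.succ c h1 (by simp only [Fin.val_succ]; omega)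
  avoids c h1 h2 := E.avoids c h1 (by omega)
  nested a b hab := E.nested a.succ b.succ (Fin.succ_lt_succ_iff.2 hab)
  circle a ha := E.circle a.succ (by simp only [Fin.val_succ]; omega)

theorem xi_zpow_mem_Rat {ν : ℝ} {S : Set ℂ} (h1 : (1 : ℂ) ∈ S)
    (hν : ∀ p : ℂ, (ν : ℂ) * p = 1 → p ∈ S) (n : ℤ) : (fun z => xi ν z ^ n) ∈ Rat S := by
  have hA : (fun z : ℂ => 1 - z) ∈ Rat S := sub_mem (one_mem _) (id_mem_Rat S)
  have hB : (fun z : ℂ => 1 - (ν : ℂ) * z) ∈ Rat S :=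
    sub_mem (one_mem _) (mul_mem (const_mem_subalgebra _ _) (id_mem_Rat S))
  have hA' : (fun z : ℂ => (1 - z)⁻¹) ∈ Rat S := by
    have e : (fun z : ℂ => (1 - z)⁻¹) = fun z => -1 * (z - 1)⁻¹ := by
      funext z
      rw [← neg_sub z 1, inv_neg]
      ring
    rw [e]
    exact mul_mem (const_mem_subalgebra _ _) (inv_mem_Rat h1)
  have hB' := inv_one_sub_mem_Rat hν
  have e1 : xi ν = fun z => (1 - z) * (1 - (ν : ℂ) * z)⁻¹ := rfl
  have hX : xi ν ∈ Rat S := e1 ▸ mul_mem hA hB'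
  have e2 : (fun z => (xi ν z)⁻¹) = fun z => (1 - (ν : ℂ) * z) * (1 - z)⁻¹ := by
    funext z
    rw [xi, inv_div]
    rfl
  rcases n with n | n
  · simp only [Int.ofNat_eq_natCast, zpow_natCast]
    exact pow_mem hX n
  · simp only [zpow_negSucc, ← inv_pow]
    exact pow_mem (e2 ▸ mul_mem hB hA') (n + 1)

theorem phi_mem_Rat {ν : ℝ} {S : Set ℂ} (h1 : (1 : ℂ) ∈ S)
    (hν : ∀ p : ℂ, (ν : ℂ) * p = 1 → p ∈ S) : phi ν ∈ Rat S := by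
  have e : phi ν = fun z => -1 * (z - 1)⁻¹ * (1 - (ν : ℂ) * z)⁻¹ := by
    funext z
    rw [phi, ← neg_sub z 1, one_div, mul_inv, inv_neg]
    ring
  rw [e]
  exact mul_mem (mul_mem (const_mem_subalgebra _ _) (inv_mem_Rat h1)) (inv_one_sub_mem_Rat hν)

/-- The product of a function over the points of the strings. -/
def stringProd (q : ℂ) (h : ℂ → ℂ) {p : ℕ} (l : Fin p → ℕ) (w : Fin p → ℂ) : ℂ :=
  ∏ b, ∏ i ∈ Finset.range (l b), h (q ^ i * w b)

/-- The contribution to the expansion of the orderings starting at the end of the string `b`. -/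
def endTerm (q : ℂ) (ν : ℝ) (h : ℂ → ℂ) {m p : ℕ} (n : Fin (m + 1) → ℤ) (l : Fin p → ℕ)
    (b : Fin p) (w : Fin p → ℂ) : ℂ :=
  density q l w * stringProd q h l w *
    ((∏ y ∈ (stringSet q l w).erase (q ^ (l b - 1) * w b),
        (y - q * (q ^ (l b - 1) * w b)) / (y - q ^ (l b - 1) * w b)) *
      (xi ν (q ^ (l b - 1) * w b) ^ n 0 *
        betheSet q ν (fun j => n j.succ) ((stringSet q l w).erase (q ^ (l b - 1) * w b))))

theorem prod_scatter_stringSet {q u : ℂ} (hq : q ≠ 0) {m p : ℕ} {l : Fin p → ℕ} {w : Fin p → ℂ}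
    (hw : Generic q m w) (hl : ∀ b, l b ≤ m) (hl1 : ∀ b, 1 ≤ l b)
    (hu : ∀ a, ∀ i < l a, q ^ i * w a ≠ u) :
    ∏ y ∈ stringSet q l w, (y - q * u) / (y - u) =
      ∏ a, (q ^ l a * ((w a - q * u) / (q ^ l a * w a - q * u))) := by
  rw [prod_stringSet hq hw hl]
  exact Finset.prod_congr rfl fun a _ => prod_string_scatter hq (hl1 a) (hu a)

section Terms

variable {q : ℂ} {ν : ℝ} {h : ℂ → ℂ} {m p : ℕ}

/-- Removing the end of the prolonged string b gives back the strings `l`. By `density_update_mul`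
the term is the residue at q^(l_b) w_b of the integrand in the outermost variable. -/
theorem endTerm_update (hq0 : q ≠ 0) (hq1 : q ≠ 1) (n : Fin (m + 1) → ℤ) {l : Fin p → ℕ}
    (hl : l ∈ lengths m p) (b : Fin p) {w : Fin p → ℂ} (hw : Generic q (m + 1) w) :
    endTerm q ν h n (Function.update l b (l b + 1)) b w =
      (density q l w * stringProd q h l w * betheSet q ν (fun j => n j.succ) (stringSet q l w)) *
        (xi ν (q ^ l b * w b) ^ n 0 * h (q ^ l b * w b) * (∏ a, (q ^ l b * w b - w a)) *
          ∏ a ∈ Finset.univ.erase b, (q ^ l b * w b - q ^ l a * w a)⁻¹) := by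
  have hle := le_of_mem_lengths hl
  have hle' : ∀ a, l a ≤ m + 1 := fun a => (hle a).trans (Nat.le_succ m)
  have h1 := (mem_lengths.1 hl).2
  cases p with
  | zero => exact b.elim0
  | succ p =>
    have hwb := hw.ne_zero (by omega) b
    have hd := density_update_mul hq0 b l w (h1 b) hwb
      (fun e => hw.2 b b _ (h1 b) (hle' b) (by rw [e, one_mul]))
      (fun e => hw.2 b b (l b + 1) (by omega) (by have := hle b; omega) (by rw [e, one_mul])) hq1
      (fun j => hw.2 _ _ _ (by omega) (by have := hle b; omega))
      (fun j e => Fin.succAbove_ne b j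
        (hw.eq_of_eq hq0 (hle' _) (by have := hle b; omega) e).1)
      (fun j e => Fin.succAbove_ne b j (hw.eq_of_eq hq0 (hle' _) (hle' _) e).1.symm)
      (fun j => hw.2 _ _ _ (h1 _) (hle' _)) (fun j => hw.2 _ _ _ (h1 _) (hle' _))
    have hs : stringProd q h (Function.update l b (l b + 1)) w =
        stringProd q h l w * h (q ^ l b * w b) := by
      rw [stringProd, stringProd, ← Finset.mul_prod_erase _ _ (Finset.mem_univ b),
        ← Finset.mul_prod_erase Finset.univ (fun b => ∏ i ∈ Finset.range (l b), h (q ^ i * w b))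
          (Finset.mem_univ b), Function.update_self, Finset.prod_range_succ, mul_right_comm]
      congr 2
      exact Finset.prod_congr rfl fun a ha => by
        rw [Function.update_of_ne (Finset.ne_of_mem_erase ha)]
    rw [endTerm, Function.update_self, Nat.add_sub_cancel, erase_stringSet_update hq0 hw b hle',
      prod_scatter_stringSet hq0 hw hle' h1, hs]
    · linear_combination (stringProd q h l w * h (q ^ l b * w b) * (xi ν (q ^ l b * w b) ^ n 0 *
        betheSet q ν (fun j => n j.succ) (stringSet q l w))) * hd
    · intro a i hi e
      obtain ⟨rfl, rfl⟩ := hw.eq_of_eq hq0 (hi.le.trans (hle' a)) (hle' b) e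
      exact lt_irrefl _ hi

/-- When the marked string is the single point z, removing it leaves the strings `l`, and the term
is the integrand of the outermost variable evaluated at z. -/
theorem endTerm_insertNth (hq0 : q ≠ 0) (hq1 : q ≠ 1) (n : Fin (m + 1) → ℤ) {l : Fin p → ℕ}
    (hl : l ∈ lengths m p) (b : Fin (p + 1)) {w : Fin p → ℂ} {z : ℂ}
    (hw : Generic q (m + 1) (b.insertNth z w : Fin (p + 1) → ℂ)) :
    endTerm q ν h n (b.insertNth 1 l : Fin (p + 1) → ℕ) b (b.insertNth z w) =
      (density q l w * stringProd q h l w * betheSet q ν (fun j => n j.succ) (stringSet q l w)) *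
        (xi ν z ^ n 0 * h z * ∏ a, (z - w a) / (z - q ^ l a * w a)) := by
  have hle := le_of_mem_lengths hl
  have hle' : ∀ a, l a ≤ m + 1 := fun a => (hle a).trans (Nat.le_succ m)
  have h1 := (mem_lengths.1 hl).2
  have hb : (b.insertNth z w : Fin (p + 1) → ℂ) b = z := Fin.insertNth_apply_same _ _ _
  have ha : ∀ a, (b.insertNth z w : Fin (p + 1) → ℂ) (b.succAbove a) = w a :=
    fun a => Fin.insertNth_apply_succAbove _ _ _ _
  have hw' : Generic q (m + 1) w := by
    refine ⟨fun i j e => ?_, fun i j c h1 h2 => ?_⟩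
    · rw [← ha, ← ha] at e
      exact Fin.succAbove_right_injective (hw.1 e)
    · rw [← ha, ← ha]
      exact hw.2 _ _ c h1 h2
  have hne : ∀ a i, i ≤ m + 1 → q ^ i * w a ≠ z := by
    intro a i hi e
    have e' : q ^ i * (b.insertNth z w : Fin (p + 1) → ℂ) (b.succAbove a) =
        q ^ 0 * (b.insertNth z w : Fin (p + 1) → ℂ) b := by rw [ha, hb, e, pow_zero, one_mul]
    exact Fin.succAbove_ne b a (hw.eq_of_eq hq0 hi (Nat.zero_le _) e').1
  have hd := density_insertNth_mul hq0 hq1 b l w (z := z)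
    (fun a => by
      have := hw.2 b (b.succAbove a) 1 le_rfl (by omega)
      rwa [hb, ha, pow_one] at this)
    (fun a e => by
      have e' : q ^ l a * (b.insertNth z w : Fin (p + 1) → ℂ) (b.succAbove a) =
        q ^ 1 * (b.insertNth z w : Fin (p + 1) → ℂ) b := by rw [ha, hb, e, pow_one]
      exact Fin.succAbove_ne b a (hw.eq_of_eq hq0 (hle' a) (by omega) e').1)
    (fun a => (hne a _ (hle' a)).symm)
  have hs : stringProd q h (b.insertNth 1 l : Fin (p + 1) → ℕ) (b.insertNth z w) =
      h z * stringProd q h l w := by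
    rw [stringProd, stringProd, Fin.prod_univ_succAbove _ b]
    simp
  have hlb : (b.insertNth 1 l : Fin (p + 1) → ℕ) b = 1 := Fin.insertNth_apply_same _ _ _
  rw [endTerm, hlb, hb, Nat.sub_self, pow_zero, one_mul, erase_stringSet_insertNth hq0 b hw hle',
    prod_scatter_stringSet hq0 hw' hle' h1 fun a i hi => hne a i (hi.le.trans (hle' a)), hs]
  linear_combination (h z * stringProd q h l w * (xi ν z ^ n 0 *
    betheSet q ν (fun j => n j.succ) (stringSet q l w))) * hd

end Terms

/-! ### Regularity of the integrands -/

section Regularity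

variable {q : ℂ} {ν : ℝ} {M : ℕ} {γ : Fin M → Contour} {C : Contour} {S : Set ℂ}

theorem Expandable.pow_mul_ne (E : Expandable q ν γ C S) {c : ℕ} (h1 : 1 ≤ c) (h2 : c ≤ M)
    {w w' : ℂ} (hw : w ∈ C.range) (hw' : w' ∈ C.range) : q ^ c * w ≠ w' := fun e =>
  (E.avoids c h1 h2 w hw).1 (e ▸ hw')

theorem Expandable.generic (E : Expandable q ν γ C S) {p : ℕ} {w : Fin p → ℂ}
    (hw : w ∈ ranges fun _ : Fin p => C) (hi : Function.Injective w) : Generic q M w :=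
  ⟨hi, fun a b _ h1 h2 => E.pow_mul_ne h1 h2 (hw a) (hw b)⟩

theorem continuousOn_stringFac (q : ℂ) {p : ℕ} (l : ℕ) (b : Fin p) (T : Set (Fin p → ℂ)) :
    ContinuousOn (fun w : Fin p → ℂ => stringFac q l (w b)) T := by
  unfold stringFac
  exact continuousOn_const.mul (ContinuousOn.div_const (by fun_prop) _)

theorem Expandable.continuousOn_density (E : Expandable q ν γ C S) {p : ℕ} {l : Fin p → ℕ}
    (hl1 : ∀ b, 1 ≤ l b) (hl : ∀ b, l b ≤ M) :
    ContinuousOn (density q l) (ranges fun _ : Fin p => C) := by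
  refine (continuousOn_finsetProd _ fun b _ => continuousOn_stringFac q _ b _).mul
    (continuousOn_finsetProd _ fun a _ => continuousOn_finsetProd _ fun b _ => ?_)
  unfold pairFac
  refine continuousOn_const.mul (ContinuousOn.div (by fun_prop) (by fun_prop) fun w hw => ?_)
  exact mul_ne_zero (sub_ne_zero.2 (E.pow_mul_ne (hl1 a) (hl a) (hw a) (hw b)))
    (sub_ne_zero.2 (E.pow_mul_ne (hl1 b) (hl b) (hw b) (hw a)))

theorem Expandable.continuousOn_stringProd (E : Expandable q ν γ C S) {p : ℕ} {l : Fin p → ℕ}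
    (hl : ∀ b, l b ≤ M) {h : ℂ → ℂ} (hh : h ∈ Rat S) :
    ContinuousOn (stringProd q h l) (ranges fun _ : Fin p => C) := by
  refine continuousOn_finsetProd _ fun b _ => continuousOn_finsetProd _ fun i hi => ?_
  have hiM := (Finset.mem_range.1 hi).trans_le (hl b)
  have hc : ContinuousOn h ((fun w => q ^ i * w) '' C.range) := by
    refine continuousOn_of_mem_Rat (fun p hp hp' => ?_) hh
    obtain ⟨w, hw, rfl⟩ := hp'
    exact E.strings i hiM w hw hp
  exact hc.comp (by fun_prop) fun w hw => ⟨w b, hw b, rfl⟩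

theorem exists_equiv_sigma {m p : ℕ} {l : Fin p → ℕ} (hl : l ∈ lengths m p) :
    Nonempty (Fin m ≃ Σ b, Fin (l b)) := by
  refine Fintype.card_eq.1 ?_
  simp [(mem_lengths.1 hl).1]

theorem image_eq_stringSet (q : ℂ) {m p : ℕ} {l : Fin p → ℕ} (e : Fin m ≃ Σ b, Fin (l b))
    (w : Fin p → ℂ) :
    Finset.univ.image (fun j => q ^ ((e j).2 : ℕ) * w (e j).1) = stringSet q l w := by
  ext z
  rw [mem_stringSet, Finset.mem_image]
  constructor
  · rintro ⟨j, -, rfl⟩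
    exact ⟨(e j).1, (e j).2, (e j).2.2, rfl⟩
  · rintro ⟨b, i, hi, rfl⟩
    exact ⟨e.symm ⟨b, i, hi⟩, Finset.mem_univ _, by rw [Equiv.apply_symm_apply]⟩

theorem Generic.injective_strings (hq : q ≠ 0) {m p : ℕ} {l : Fin p → ℕ} {w : Fin p → ℂ}
    (hw : Generic q M w) (hl : ∀ b, l b ≤ M) (e : Fin m ≃ Σ b, Fin (l b)) :
    Function.Injective fun j => q ^ ((e j).2 : ℕ) * w (e j).1 := by
  intro i j hij
  refine e.injective ?_
  have h := hw.eq_of_eq hq ((e i).2.2.le.trans (hl _)) ((e j).2.2.le.trans (hl _)) hij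
  generalize e i = x at h ⊢
  generalize e j = y at h ⊢
  obtain ⟨a, i⟩ := x
  obtain ⟨b, j⟩ := y
  obtain ⟨rfl, h⟩ := h
  exact congrArg _ (Fin.ext h)

theorem Expandable.strings_mem_specDomain (E : Expandable q ν γ C S) {m p : ℕ} {l : Fin p → ℕ}
    (hl : ∀ b, l b ≤ M) (e : Fin m ≃ Σ b, Fin (l b)) {w : Fin p → ℂ}
    (hw : w ∈ ranges fun _ : Fin p => C) :
    (fun j => q ^ ((e j).2 : ℕ) * w (e j).1) ∈ specDomain ν m := by
  intro j
  have h := E.strings (e j).2 ((e j).2.2.trans_le (hl _)) (w (e j).1) (hw _)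
  exact ⟨fun h1 => h (mem_of_eq_of_mem h1 E.one_mem), fun h1 => h (E.nu_mem _ h1)⟩

/-- When points of strings collide, the finite set loses elements and `betheSet` jumps. The Laurent
polynomial of `exists_laurent_bethe`, evaluated at the enumerated points, is the continuous
representative. -/
theorem Expandable.regular_betheSet (E : Expandable q ν γ C S) (hq : q ≠ 0) (hν : ν < 1) {m p : ℕ}
    {l : Fin p → ℕ} (hl : l ∈ lengths m p) (hm : m ≤ M) (n : Fin m → ℤ) :
    Regular C fun w => betheSet q ν n (stringSet q l w) := by
  obtain ⟨e⟩ := exists_equiv_sigma hl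
  obtain ⟨P, hP⟩ := exists_laurent_bethe hν q n
  have hlM : ∀ b, l b ≤ M := fun b => (le_of_mem_lengths hl b).trans hm
  refine ⟨fun w => laurentEval ν P fun j => q ^ ((e j).2 : ℕ) * w (e j).1, ?_, fun w hw hi => ?_⟩
  · exact (continuousOn_laurentEval ν P).comp (by fun_prop) fun w hw =>
      E.strings_mem_specDomain hlM e hw
  · have hinj := (E.generic hw hi).injective_strings hq hlM e
    simp only
    rw [← image_eq_stringSet q e, betheSet_image q ν n hinj,
      hP _ (E.strings_mem_specDomain hlM e hw) hinj]

theorem Regular.comp_succAbove {p : ℕ} {f : (Fin p → ℂ) → ℂ} (hf : Regular C f) (b : Fin (p + 1)) :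
    Regular C fun w : Fin (p + 1) → ℂ => f fun j => w (b.succAbove j) := by
  obtain ⟨F, hF, hfF⟩ := hf
  exact ⟨fun w => F fun j => w (b.succAbove j), hF.comp (by fun_prop) fun w hw j => hw _,
    fun w hw hi => hfF _ (fun j => hw _) (hi.comp Fin.succAbove_right_injective)⟩

/-- The inverse factors are singular where w_a = w_b for strings of equal length; each is cancelled
by the factor q^(l_b) w_b - q^(l_a) w_a in the numerator of `pairFac`. -/
theorem Expandable.regular_density_mul_prod_inv (E : Expandable q ν γ C S) (hq : q ≠ 0) {p : ℕ}
    {l : Fin p → ℕ} (hl1 : ∀ b, 1 ≤ l b) (hl : ∀ b, l b ≤ M) (b : Fin p) :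
    Regular C fun w => density q l w *
      ∏ a ∈ Finset.univ.erase b, (q ^ l b * w b - q ^ l a * w a)⁻¹ := by
  cases p with
  | zero => exact b.elim0
  | succ p =>
    refine ⟨fun w => stringFac q (l b) (w b) * (∏ j, ((q ^ (l b * l (b.succAbove j)))⁻¹ *
      ((w (b.succAbove j) - w b) / ((q ^ l b * w b - w (b.succAbove j)) *
        (q ^ l (b.succAbove j) * w (b.succAbove j) - w b))))) *
      density q (fun j => l (b.succAbove j)) (fun j => w (b.succAbove j)), ?_, fun w hw hi => ?_⟩
    · refine ((continuousOn_stringFac q _ b _).mul (continuousOn_finsetProd _ fun j _ =>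
        continuousOn_const.mul (ContinuousOn.div (by fun_prop) (by fun_prop) fun w hw => ?_))).mul
        ((E.continuousOn_density (fun j => hl1 _) fun j => hl _).comp (by fun_prop)
          fun w hw j => hw _)
      exact mul_ne_zero (sub_ne_zero.2 (E.pow_mul_ne (hl1 _) (hl _) (hw _) (hw _)))
        (sub_ne_zero.2 (E.pow_mul_ne (hl1 _) (hl _) (hw _) (hw _)))
    · simp only
      rw [density_succAbove q l w b, prod_erase_succAbove, mul_right_comm _ (density _ _ _),
        mul_assoc (stringFac _ _ _), ← Finset.prod_mul_distrib]
      congr 2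
      refine Finset.prod_congr rfl fun j _ => ?_
      have h1 : q ^ l b * w b - q ^ l (b.succAbove j) * w (b.succAbove j) ≠ 0 :=
        sub_ne_zero.2 fun e => Fin.succAbove_ne b j
          ((E.generic hw hi).eq_of_eq hq (hl _) (hl _) e).1.symm
      rw [pairFac, mul_assoc]
      congr 1
      rw [div_mul_eq_mul_div, mul_right_comm, mul_inv_cancel₀ h1, one_mul]

end Regularity

section Succ

variable {q : ℂ} {ν : ℝ} {m : ℕ} {γ : Fin (m + 1) → Contour} {C : Contour} {S : Set ℂ} {h : ℂ → ℂ}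

theorem Expandable.regular_term (E : Expandable q ν γ C S) (hq : q ≠ 0) (hν : ν < 1)
    (hh : h ∈ Rat S) {s : ℕ} (hs : s ≤ m + 1) (n : Fin s → ℤ) {p : ℕ} {l : Fin p → ℕ}
    (hl : l ∈ lengths s p) :
    Regular C fun w => density q l w * stringProd q h l w * betheSet q ν n (stringSet q l w) :=
  have hlM : ∀ b, l b ≤ m + 1 := fun b => (le_of_mem_lengths hl b).trans hs
  ((regular_of_continuousOn (E.continuousOn_density (mem_lengths.1 hl).2 hlM)).mul
    (regular_of_continuousOn (E.continuousOn_stringProd hlM hh))).mul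
      (E.regular_betheSet hq hν hl hs n)

/-- The kernel left after integrating over the inner contours. -/
def endKernel (q : ℂ) {p : ℕ} (l : Fin p → ℕ) (z : ℂ) (w : Fin p → ℂ) : ℂ :=
  ∏ a, (z - w a) / (z - q ^ l a * w a)

theorem continuousOn_endKernel {X : Type*} [TopologicalSpace X] {K : Set X} {p : ℕ}
    {l : Fin p → ℕ} {z : X → ℂ} {w : X → Fin p → ℂ} (hz : ContinuousOn z K)
    (hw : ContinuousOn w K) (hne : ∀ x ∈ K, ∀ a, z x ≠ q ^ l a * w x a) :
    ContinuousOn (fun x => endKernel q l (z x) (w x)) K := by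
  refine continuousOn_finsetProd _ fun a _ => ContinuousOn.div ?_ ?_ fun x hx =>
    sub_ne_zero.2 (hne x hx a)
  · exact hz.sub (continuousOn_pi.1 hw a)
  · exact hz.sub (continuousOn_const.mul (continuousOn_pi.1 hw a))

theorem Expandable.regular_endTerm_update (E : Expandable q ν γ C S) (hq : q ≠ 0) (hq1 : q ≠ 1)
    (hν : ν < 1) (hh : h ∈ Rat S) (n : Fin (m + 1) → ℤ) {p : ℕ} {l : Fin p → ℕ}
    (hl : l ∈ lengths m p) (b : Fin p) :
    Regular C (endTerm q ν h n (Function.update l b (l b + 1)) b) := by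
  have hlM : ∀ b, l b ≤ m + 1 := fun b => (le_of_mem_lengths hl b).trans (Nat.le_succ m)
  have h1 := E.regular_density_mul_prod_inv hq (mem_lengths.1 hl).2 hlM b
  have h2 := regular_of_continuousOn (E.continuousOn_stringProd hlM hh)
  have h3 := E.regular_betheSet hq hν hl (Nat.le_succ m) fun j => n j.succ
  have hg : (fun z => xi ν z ^ n 0 * h z) ∈ Rat S :=
    mul_mem (xi_zpow_mem_Rat E.one_mem E.nu_mem _) hh
  have h4 : Regular C fun w : Fin p → ℂ => (xi ν (q ^ l b * w b) ^ n 0 * h (q ^ l b * w b)) *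
      ∏ a, (q ^ l b * w b - w a) := by
    refine regular_of_continuousOn (ContinuousOn.mul ?_ (by fun_prop))
    have hc : ContinuousOn (fun z => xi ν z ^ n 0 * h z) ((fun w => q ^ l b * w) '' C.range) := by
      refine continuousOn_of_mem_Rat (fun p hp hp' => ?_) hg
      obtain ⟨w, hw, rfl⟩ := hp'
      exact E.strings _ (Nat.lt_succ_of_le (le_of_mem_lengths hl b)) w hw hp
    exact hc.comp (f := fun w : Fin p → ℂ => q ^ l b * w b) (by fun_prop)
      fun w hw => ⟨w b, hw b, rfl⟩
  refine (((h1.mul h2).mul h3).mul h4).congr fun w hw hi => ?_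
  rw [endTerm_update hq hq1 n hl b (E.generic hw hi)]
  ring

theorem Expandable.endTerm_insertNth (E : Expandable q ν γ C S) (hq : q ≠ 0) (hq1 : q ≠ 1)
    (n : Fin (m + 1) → ℤ) {p : ℕ} {l : Fin p → ℕ}
    (hl : l ∈ lengths m p) (b : Fin (p + 1)) {w : Fin (p + 1) → ℂ}
    (hw : w ∈ ranges fun _ : Fin (p + 1) => C) (hi : Function.Injective w) :
    endTerm q ν h n (b.insertNth 1 l : Fin (p + 1) → ℕ) b w =
      (density q l (fun j => w (b.succAbove j)) * stringProd q h l (fun j => w (b.succAbove j)) *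
        betheSet q ν (fun j => n j.succ) (stringSet q l fun j => w (b.succAbove j))) *
      (xi ν (w b) ^ n 0 * h (w b) * endKernel q l (w b) fun j => w (b.succAbove j)) := by
  have hw' : (b.insertNth (w b) fun j => w (b.succAbove j) : Fin (p + 1) → ℂ) = w :=
    Fin.insertNth_self_removeNth b w
  have := QHahn.endTerm_insertNth (h := h) (ν := ν) hq hq1 n hl b (z := w b)
    (w := fun j => w (b.succAbove j)) (by rw [hw']; exact E.generic hw hi)
  rw [hw'] at this
  exact this

theorem Expandable.regular_endTerm_insertNth (E : Expandable q ν γ C S) (hq : q ≠ 0) (hq1 : q ≠ 1)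
    (hν : ν < 1) (hh : h ∈ Rat S) (n : Fin (m + 1) → ℤ) {p : ℕ} {l : Fin p → ℕ}
    (hl : l ∈ lengths m p) (b : Fin (p + 1)) :
    Regular C (endTerm q ν h n (b.insertNth 1 l : Fin (p + 1) → ℕ) b) := by
  have h1 := (E.regular_term hq hν hh (Nat.le_succ m) (fun j => n j.succ) hl).comp_succAbove b
  have hg : (fun z => xi ν z ^ n 0 * h z) ∈ Rat S :=
    mul_mem (xi_zpow_mem_Rat E.one_mem E.nu_mem _) hh
  have h2 : ContinuousOn (fun w : Fin (p + 1) → ℂ => xi ν (w b) ^ n 0 * h (w b) *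
      endKernel q l (w b) fun j => w (b.succAbove j)) (ranges fun _ : Fin (p + 1) => C) := by
    refine ContinuousOn.mul ?_ (continuousOn_endKernel (by fun_prop) (by fun_prop) fun w hw a =>
      (E.pow_mul_ne ((mem_lengths.1 hl).2 a)
        ((le_of_mem_lengths hl a).trans (Nat.le_succ m)) (hw _) (hw _)).symm)
    have hc : ContinuousOn (fun z => xi ν z ^ n 0 * h z) C.range :=
      continuousOn_of_mem_Rat (fun p hp hp' => (E.poles p hp 0).2.1 hp') hg
    exact hc.comp (f := fun w : Fin (p + 1) → ℂ => w b) (by fun_prop) fun w hw => hw b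
  exact (h1.mul (regular_of_continuousOn h2)).congr fun w hw hi =>
    E.endTerm_insertNth hq hq1 n hl b hw hi

theorem Expandable.regular_endTerm (E : Expandable q ν γ C S) (hq : q ≠ 0) (hq1 : q ≠ 1)
    (hν : ν < 1) (hh : h ∈ Rat S) (n : Fin (m + 1) → ℤ) {p : ℕ} {l : Fin p → ℕ}
    (hl : l ∈ lengths (m + 1) p) (b : Fin p) : Regular C (endTerm q ν h n l b) := by
  by_cases hb : l b = 1
  · cases p with
    | zero => exact b.elim0
    | succ p =>
      have hins := Fin.insertNth_self_removeNth b l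
      rw [hb] at hins
      rw [← hins] at hl ⊢
      exact E.regular_endTerm_insertNth hq hq1 hν hh n ((insertNth_mem_lengths b).1 hl) b
  · have := E.regular_endTerm_update hq hq1 hν hh n (update_pred_mem_lengths b hl hb) b
    have h1 := (mem_lengths.1 hl).2 b
    simpa [Nat.sub_add_cancel h1] using this

end Succ

theorem multiIntegral_add_sum_of_regular {C : Contour} {r : ℝ} (h : C.IsCircle r) {p : ℕ}
    {ι : Type*} [Fintype ι] {f : (Fin p → ℂ) → ℂ} {g : ι → (Fin p → ℂ) → ℂ} (hf : Regular C f)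
    (hg : ∀ i, Regular C (g i)) :
    multiIntegral (fun _ => C) (fun w => f w + ∑ i, g i w) =
      multiIntegral (fun _ => C) f + ∑ i, multiIntegral (fun _ => C) (g i) := by
  have := multiIntegral_sum_of_regular h (Finset.univ : Finset (Option ι))
    (f := fun o => o.elim f g) fun o _ => by cases o with
      | none => exact hf
      | some i => exact hg i
  simpa only [Fintype.sum_option, Option.elim_none, Option.elim_some] using this

theorem pairKernel_cons (q : ℂ) {m : ℕ} (z : ℂ) (w : Fin m → ℂ) :
    pairKernel q (Fin.cons z w : Fin (m + 1) → ℂ) =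
      (∏ a, (z - w a) / (z - q * w a)) * pairKernel q w := by
  rw [pairKernel, prod_Iio_succ]
  simp only [Fin.cons_zero, Fin.cons_succ]
  rfl

section Step

variable {q : ℂ} {ν : ℝ} {m : ℕ} {γ : Fin (m + 1) → Contour} {C : Contour} {S : Set ℂ} {h : ℂ → ℂ}

theorem Expandable.continuousOn_integrand (E : Expandable q ν γ C S) (hq : q ≠ 0)
    (n : Fin (m + 1) → ℤ) (hh : h ∈ Rat S) :
    ContinuousOn (fun z : Fin (m + 1) → ℂ => pairKernel q z * ∏ j, (xi ν (z j) ^ n j * h (z j)))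
      (ranges γ) := by
  refine ContinuousOn.mul (continuousOn_finsetProd _ fun a _ => continuousOn_finsetProd _
    fun b hb => ContinuousOn.div (by fun_prop) (by fun_prop) fun z hz => sub_ne_zero.2 fun e => ?_)
    (continuousOn_finsetProd _ fun j _ => ?_)
  · refine (E.nested b a (Finset.mem_Iio.1 hb) (z b) (hz b)).1 ?_
    rw [e, mul_div_cancel_left₀ _ hq]
    exact hz a
  · have hg : (fun z => xi ν z ^ n j * h z) ∈ Rat S :=
      mul_mem (xi_zpow_mem_Rat E.one_mem E.nu_mem _) hh
    have hc : ContinuousOn (fun z => xi ν z ^ n j * h z) (γ j).range :=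
      continuousOn_of_mem_Rat (fun p hp hp' => (E.poles p hp j).1 hp') hg
    exact hc.comp (f := fun w : Fin (m + 1) → ℂ => w j) (by fun_prop) fun w hw => hw j

/-- Moving the outermost contour to `C`. -/
theorem Expandable.cint_endKernel (E : Expandable q ν γ C S) (hq : q ≠ 0) {g : ℂ → ℂ}
    (hg : g ∈ Rat S) {p : ℕ} {l : Fin p → ℕ} (hl : l ∈ lengths m p) {w : Fin p → ℂ}
    (hw : w ∈ ranges fun _ : Fin p => C) (hi : Function.Injective w) :
    cint (γ 0) (fun z => g z * endKernel q l z w) = cint C (fun z => g z * endKernel q l z w) +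
      ∑ b, (g (q ^ l b * w b) * (∏ a, (q ^ l b * w b - w a)) *
        ∏ a ∈ Finset.univ.erase b, (q ^ l b * w b - q ^ l a * w a)⁻¹) := by
  have hle := le_of_mem_lengths hl
  have h1 := (mem_lengths.1 hl).2
  have hH : (fun z => g z * ∏ a, (z - w a)) ∈ Rat S := by
    refine mul_mem hg ?_
    have e : (fun z => ∏ a, (z - w a)) = ∏ a, fun z => z - w a := by
      funext z; simp
    rw [e]
    exact Subalgebra.prod_mem _ fun a _ => sub_mem (id_mem_Rat S) (const_mem_subalgebra _ _)
  have hS : ∀ p ∈ S, p ∉ (γ 0).range ∪ C.range ∧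
      cint (γ 0) (fun z => (z - p)⁻¹) - cint C (fun z => (z - p)⁻¹) = 0 := by
    intro p hp
    obtain ⟨h1, h2, h3⟩ := E.poles p hp 0
    refine ⟨fun h => h.elim h1 h2, ?_⟩
    rw [← winding_eq_cint, ← winding_eq_cint, h3, sub_self]
  have hv : ∀ b, q ^ l b * w b ∉ (γ 0).range ∪ C.range ∧
      cint (γ 0) (fun z => (z - q ^ l b * w b)⁻¹) - cint C (fun z => (z - q ^ l b * w b)⁻¹) = 1 := by
    intro b
    have h2 := E.contains 0 (l b) (h1 b)
      (by have := hle b; simp only [Fin.val_zero]; omega) (w b) (hw b)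
    have h3 := E.avoids (l b) (h1 b) ((hle b).trans (Nat.le_succ m)) (w b) (hw b)
    refine ⟨fun h => h.elim h2.1 h3.1, ?_⟩
    rw [← winding_eq_cint, ← winding_eq_cint, h2.2, h3.2, sub_zero]
  -- For the difference of the two contours the poles in S have weight 0, while each q^(l_b) w_b is
  -- inside `γ 0` and outside C, so it has weight 1.
  have hres := (isContourFunctional_sub (γ 0) C).eq_sum_residues hS hH Finset.univ
    (v := fun b => q ^ l b * w b) (fun a _ b _ e => ((E.generic hw hi).eq_of_eq hq
      ((hle a).trans (Nat.le_succ m)) ((hle b).trans (Nat.le_succ m)) e).1)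
    fun b _ => ⟨(hv b).1, fun hb => by
      have := (hS _ hb).2
      rw [(hv b).2] at this
      exact one_ne_zero this, (hv b).2⟩
  have e : ∀ z, g z * endKernel q l z w =
      g z * (∏ a, (z - w a)) * ∏ a, (z - q ^ l a * w a)⁻¹ := fun z => by
    rw [endKernel, mul_assoc, ← Finset.prod_mul_distrib]
    rfl
  simp only [e]
  rw [← sub_eq_iff_eq_add']
  exact hres

/-- The right side does not involve the position b of the new string, as `sum_stringData_succ`
requires. -/
theorem Expandable.multiIntegral_insertNth (E : Expandable q ν γ C S) {r : ℝ} (hC : C.IsCircle r)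
    (hq : q ≠ 0) (hq1 : q ≠ 1) (hh : h ∈ Rat S) (n : Fin (m + 1) → ℤ) {p : ℕ}
    {l : Fin p → ℕ} (hl : l ∈ lengths m p) (b : Fin (p + 1)) {D : (Fin p → ℂ) → ℂ}
    (hD : ContinuousOn D (ranges fun _ : Fin p => C))
    (hDe : ∀ w ∈ ranges fun _ : Fin p => C, Function.Injective w →
      density q l w * stringProd q h l w * betheSet q ν (fun j => n j.succ) (stringSet q l w) =
        D w) :
    multiIntegral (fun _ => C) (endTerm q ν h n (b.insertNth 1 l : Fin (p + 1) → ℕ) b) =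
      multiIntegral (fun _ => C) fun w => cint C fun z =>
        D w * (xi ν z ^ n 0 * h z * endKernel q l z w) := by
  have hg : (fun z => xi ν z ^ n 0 * h z) ∈ Rat S :=
    mul_mem (xi_zpow_mem_Rat E.one_mem E.nu_mem _) hh
  rw [multiIntegral_congr_injective hC (g := fun w => D (fun j => w (b.succAbove j)) *
    (xi ν (w b) ^ n 0 * h (w b) * endKernel q l (w b) fun j => w (b.succAbove j)))
    fun w hw hi => ?_, multiIntegral_insertNth' (fun _ => C) b]
  · simp only [Fin.insertNth_apply_same, Fin.insertNth_apply_succAbove]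
  · have hDc : ContinuousOn (fun w : Fin (p + 1) → ℂ => D fun j => w (b.succAbove j))
        (ranges fun _ : Fin (p + 1) => C) := hD.comp (by fun_prop) fun w hw j => hw _
    refine hDc.mul (ContinuousOn.mul ?_
      (continuousOn_endKernel (by fun_prop) (by fun_prop) fun w hw a =>
      (E.pow_mul_ne ((mem_lengths.1 hl).2 a)
        ((le_of_mem_lengths hl a).trans (Nat.le_succ m)) (hw _) (hw _)).symm))
    have hc : ContinuousOn (fun z => xi ν z ^ n 0 * h z) C.range :=
      continuousOn_of_mem_Rat (fun p hp hp' => (E.poles p hp 0).2.1 hp') hg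
    exact hc.comp (f := fun w : Fin (p + 1) → ℂ => w b) (by fun_prop) fun w hw => hw b
  · rw [E.endTerm_insertNth hq hq1 n hl b hw hi, hDe _ (fun j => hw _)
      (hi.comp Fin.succAbove_right_injective)]

/-- Integration over the outermost contour of the contribution of given strings. -/
theorem Expandable.multiIntegral_step (E : Expandable q ν γ C S) {r : ℝ} (hC : C.IsCircle r)
    (hq : q ≠ 0) (hq1 : q ≠ 1) (hν : ν < 1) (hh : h ∈ Rat S) (n : Fin (m + 1) → ℤ) {p : ℕ}
    {l : Fin p → ℕ} (hl : l ∈ lengths m p) {D : (Fin p → ℂ) → ℂ}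
    (hD : ContinuousOn D (ranges fun _ : Fin p => C))
    (hDe : ∀ w ∈ ranges fun _ : Fin p => C, Function.Injective w →
      density q l w * stringProd q h l w * betheSet q ν (fun j => n j.succ) (stringSet q l w) =
        D w) :
    multiIntegral (fun _ => C) (fun w => cint (γ 0) fun z =>
        D w * (xi ν z ^ n 0 * h z * endKernel q l z w)) =
      multiIntegral (fun _ => C) (fun w => cint C fun z =>
        D w * (xi ν z ^ n 0 * h z * endKernel q l z w)) +
      ∑ b, multiIntegral (fun _ => C) (endTerm q ν h n (Function.update l b (l b + 1)) b) := by
  have hg : (fun z => xi ν z ^ n 0 * h z) ∈ Rat S :=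
    mul_mem (xi_zpow_mem_Rat E.one_mem E.nu_mem _) hh
  rw [← multiIntegral_add_sum_of_regular hC (regular_of_continuousOn ?_)
    fun b => E.regular_endTerm_update hq hq1 hν hh n hl b]
  · refine multiIntegral_congr_injective hC fun w hw hi => ?_
    rw [cint_const_mul, cint_const_mul, E.cint_endKernel hq hg hl hw hi, mul_add, Finset.mul_sum]
    congr 1
    refine Finset.sum_congr rfl fun b _ => ?_
    rw [endTerm_update hq hq1 n hl b (E.generic hw hi), hDe w hw hi]
  · refine continuousOn_cint (isCompact_ranges _) C (f := fun w z =>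
      D w * (xi ν z ^ n 0 * h z * endKernel q l z w)) ?_
    refine (hD.comp (f := Prod.fst) (by fun_prop) fun x hx => hx.1).mul (ContinuousOn.mul ?_
      (continuousOn_endKernel (by fun_prop) (by fun_prop) fun x hx a =>
      (E.pow_mul_ne ((mem_lengths.1 hl).2 a)
        ((le_of_mem_lengths hl a).trans (Nat.le_succ m)) (hx.1 _) hx.2).symm))
    have hc : ContinuousOn (fun z => xi ν z ^ n 0 * h z) C.range :=
      continuousOn_of_mem_Rat (fun p hp hp' => (E.poles p hp 0).2.1 hp') hg
    exact hc.comp (f := Prod.snd) (by fun_prop) fun x hx => hx.2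

end Step

/-- The residue expansion of a nested contour integral. -/
theorem multiIntegral_pairKernel {q : ℂ} (hq : q ≠ 0) (hq1 : q ≠ 1) {ν : ℝ} (hν : ν < 1)
    {C : Contour} {r : ℝ} (hC : C.IsCircle r) : ∀ {m : ℕ} {γ : Fin m → Contour} {S : Set ℂ}
    (_ : Expandable q ν γ C S) (n : Fin m → ℤ) {h : ℂ → ℂ} (_ : h ∈ Rat S),
    multiIntegral γ (fun z => pairKernel q z * ∏ j, (xi ν (z j) ^ n j * h (z j))) =
      ∑ x ∈ stringData m, (x.1.factorial : ℂ)⁻¹ * multiIntegral (fun _ => C) fun w =>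
        density q x.2 w * stringProd q h x.2 w * betheSet q ν n (stringSet q x.2 w) := by
  intro m
  induction m with
  | zero =>
    intro γ S _ n h _
    have h0 : lengths 0 0 = {default} := by
      ext l
      rw [mem_lengths]
      simp [Subsingleton.elim l default]
    rw [multiIntegral_zero_dim, stringData, Finset.sum_sigma, Finset.sum_range_one, h0,
      Finset.sum_singleton, multiIntegral_zero_dim]
    simp [pairKernel, density, stringProd, betheSet]
  | succ m ih =>
    intro γ S E n h hh
    have hg : (fun z => xi ν z ^ n 0 * h z) ∈ Rat S :=
      mul_mem (xi_zpow_mem_Rat E.one_mem E.nu_mem _) hh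
    set N : Fin m → ℤ := fun j => n j.succ with hN
    have hdata : ∀ x ∈ stringData m, x.2 ∈ lengths m x.1 := fun x hx => (Finset.mem_sigma.1 hx).2
    have hreg : ∀ x : Σ p, Fin p → ℕ, ∃ D : (Fin x.1 → ℂ) → ℂ, x ∈ stringData m →
        ContinuousOn D (ranges fun _ : Fin x.1 => C) ∧
        ∀ w ∈ ranges fun _ : Fin x.1 => C, Function.Injective w →
          density q x.2 w * stringProd q h x.2 w * betheSet q ν N (stringSet q x.2 w) = D w := by
      intro x
      by_cases hx : x ∈ stringData m
      · obtain ⟨D, h1, h2⟩ := E.regular_term hq hν hh (Nat.le_succ m) N (hdata x hx)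
        exact ⟨D, fun _ => ⟨h1, h2⟩⟩
      · exact ⟨0, fun hx' => absurd hx' hx⟩
    choose D hD using hreg
    set f : ∀ x : Σ p, Fin p → ℕ, ℂ → (Fin x.1 → ℂ) → ℂ := fun x z w =>
      D x w * (xi ν z ^ n 0 * h z * endKernel q x.2 z w) with hf
    have hfc : ∀ x ∈ stringData m, ContinuousOn (fun y : ℂ × (Fin x.1 → ℂ) => f x y.1 y.2)
        ((γ 0).range ×ˢ ranges fun _ : Fin x.1 => C) := by
      intro x hx
      refine ((hD x hx).1.comp (f := Prod.snd) (by fun_prop) fun y hy => hy.2).mul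
        (ContinuousOn.mul ?_ (continuousOn_endKernel (by fun_prop) (by fun_prop) fun y hy a => ?_))
      · have hc : ContinuousOn (fun z => xi ν z ^ n 0 * h z) (γ 0).range :=
          continuousOn_of_mem_Rat (fun p hp hp' => (E.poles p hp 0).1 hp') hg
        exact hc.comp (f := Prod.fst) (by fun_prop) fun y hy => hy.1
      · intro e
        have hle := le_of_mem_lengths (hdata x hx) a
        exact (E.contains 0 _ ((mem_lengths.1 (hdata x hx)).2 a)
          (by simp only [Fin.val_zero]; omega) _ (hy.2 a)).1 (e ▸ hy.1)
    have step1 : ∀ z ∈ (γ 0).range, multiIntegral (fun j => γ (Fin.succAbove 0 j)) (fun w =>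
        pairKernel q (Fin.insertNth 0 z w : Fin (m + 1) → ℂ) *
          ∏ j, (xi ν ((Fin.insertNth 0 z w : Fin (m + 1) → ℂ) j) ^ n j *
            h ((Fin.insertNth 0 z w : Fin (m + 1) → ℂ) j))) =
        ∑ x ∈ stringData m, (x.1.factorial : ℂ)⁻¹ * multiIntegral (fun _ => C) (f x z) := by
      intro z hz
      -- With z frozen, its interaction with each inner variable becomes part of the one-variable
      -- weight. For this reason the induction allows an arbitrary `h` in `Rat S` and a growing S.
      have hh' : (fun y => h y * ((z - y) / (z - q * y))) ∈ Rat (insert (z / q) S) :=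
        mul_mem (Rat_mono (subset_insert _ _) hh) (div_sub_mul_mem_Rat hq (Or.inl rfl))
      have e1 : ∀ w : Fin m → ℂ, pairKernel q (Fin.insertNth 0 z w : Fin (m + 1) → ℂ) *
          ∏ j, (xi ν ((Fin.insertNth 0 z w : Fin (m + 1) → ℂ) j) ^ n j *
            h ((Fin.insertNth 0 z w : Fin (m + 1) → ℂ) j)) =
          xi ν z ^ n 0 * h z * (pairKernel q w *
            ∏ j, (xi ν (w j) ^ N j * (h (w j) * ((z - w j) / (z - q * w j))))) := by
        intro w
        rw [Fin.insertNth_zero', pairKernel_cons, Fin.prod_univ_succ]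
        simp only [Fin.cons_zero, Fin.cons_succ, Finset.prod_mul_distrib, hN]
        ring
      simp only [e1, Fin.succAbove_zero]
      rw [multiIntegral_const_mul, ih (E.tail hq hz) N hh', Finset.mul_sum]
      refine Finset.sum_congr rfl fun x hx => ?_
      rw [mul_left_comm, ← multiIntegral_const_mul]
      congr 1
      refine multiIntegral_congr_injective hC fun w hw hi => ?_
      simp only [hf]
      rw [← (hD x hx).2 w hw hi]
      have e2 : stringProd q (fun y => h y * ((z - y) / (z - q * y))) x.2 w =
          stringProd q h x.2 w * endKernel q x.2 z w := by
        rw [stringProd, stringProd, endKernel, ← Finset.prod_mul_distrib]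
        refine Finset.prod_congr rfl fun b _ => ?_
        rw [Finset.prod_mul_distrib, prod_string_kernel ((mem_lengths.1 (hdata x hx)).2 b)]
        intro i hi1 hi2 e
        have hle := le_of_mem_lengths (hdata x hx) b
        exact (E.contains 0 i hi1 (by simp only [Fin.val_zero]; omega) _ (hw b)).1 (e ▸ hz)
      rw [e2]
      ring
    rw [QHahn.multiIntegral_insertNth γ 0 (E.continuousOn_integrand hq n hh), cint_congr step1,
      cint_sum]
    · have hT : ∀ x ∈ stringData (m + 1), multiIntegral (fun _ => C) (fun w =>
          density q x.2 w * stringProd q h x.2 w * betheSet q ν n (stringSet q x.2 w)) =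
          ∑ b, multiIntegral (fun _ => C) (endTerm q ν h n x.2 b) := by
        intro x hx
        have hl := (Finset.mem_sigma.1 hx).2
        rw [← multiIntegral_sum_of_regular hC _ fun b _ =>
          E.regular_endTerm hq hq1 hν hh n hl b]
        refine multiIntegral_congr_injective hC fun w hw hi => ?_
        rw [betheSet_stringSet hq ν (E.generic hw hi) (le_of_mem_lengths hl) (mem_lengths.1 hl).2,
          Finset.mul_sum]
        rfl
      have hT' : ∑ x ∈ stringData (m + 1), (x.1.factorial : ℂ)⁻¹ * multiIntegral (fun _ => C)
          (fun w => density q x.2 w * stringProd q h x.2 w * betheSet q ν n (stringSet q x.2 w)) =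
          ∑ x ∈ stringData (m + 1), (x.1.factorial : ℂ)⁻¹ *
            ∑ b, multiIntegral (fun _ => C) (endTerm q ν h n x.2 b) :=
        Finset.sum_congr rfl fun x hx => by rw [hT x hx]
      -- The terms of the Bethe recursion, one per end of a string, are regrouped according to
      -- whether that string is new or prolonged. This matches the two outcomes of moving `γ 0` to
      -- C.
      rw [hT', sum_stringData_succ m (fun p l b => multiIntegral (fun _ => C) (endTerm q ν h n l b))
          (fun p l => multiIntegral (fun _ => C) fun w => cint C fun z => f ⟨p, l⟩ z w)]
      · refine Finset.sum_congr rfl fun x hx => ?_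
        rw [cint_const_mul, cint_multiIntegral_swap _ _ (hfc x hx)]
        congr 1
        exact E.multiIntegral_step hC hq hq1 hν hh n (hdata x hx) (hD x hx).1 (hD x hx).2
      · intro p l hl b
        have hx : (⟨p, l⟩ : Σ p, Fin p → ℕ) ∈ stringData m := by
          refine Finset.mem_sigma.2 ⟨Finset.mem_range.2 ?_, hl⟩
          by_contra hlt
          rw [lengths_eq_empty (by simp only at hlt; omega)] at hl
          simp at hl
        exact E.multiIntegral_insertNth hC hq hq1 hh n hl b (hD _ hx).1 (hD _ hx).2
    · intro x hx
      exact continuousOn_const.mul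
        (continuousOn_multiIntegral (γ 0).isCompact_range _ (hfc x hx))

/-! ### The Cauchy determinant -/

theorem prod_prod_eq_diag_mul {k : ℕ} {M : Type*} [CommMonoid M] (h : Fin k → Fin k → M) :
    ∏ a, ∏ b, h a b = (∏ a, h a a) * ∏ a, ∏ b ∈ Finset.Iio a, (h a b * h b a) := by
  have h1 := prod_prod_eq_prod_Iio (fun a b => if a = b then 1 else h a b) fun a => if_pos rfl
  have h2 : ∀ a, ∏ b, h a b = h a a * ∏ b, if a = b then 1 else h a b := by
    intro a
    rw [← Finset.mul_prod_erase Finset.univ (h a) (Finset.mem_univ a),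
      ← Finset.mul_prod_erase Finset.univ (fun b => if a = b then 1 else h a b) (Finset.mem_univ a),
      if_pos rfl, one_mul]
    congr 1
    exact Finset.prod_congr rfl fun b hb => (if_neg (Finset.ne_of_mem_erase hb).symm).symm
  rw [Finset.prod_congr rfl fun a _ => h2 a, Finset.prod_mul_distrib, h1]
  congr 1
  refine Finset.prod_congr rfl fun a _ => ?_
  refine Finset.prod_congr rfl fun b hb => ?_
  have hne := (Finset.mem_Iio.1 hb).ne
  rw [if_neg hne.symm, if_neg hne]

theorem det_vandermonde_eq {p : ℕ} (v : Fin p → ℂ) :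
    (Matrix.vandermonde v).det = ∏ a, ∏ b ∈ Finset.Iio a, (v a - v b) := by
  rw [Matrix.det_vandermonde]
  exact Finset.prod_comm' (by simp)

open Polynomial in
-- With L_j = ∏_{b ≠ j} (X - y_b) and A its coefficient matrix, the Cauchy matrix is a diagonal
-- matrix times V(x) A. Evaluating at y instead makes V(y) A diagonal, which determines det A.
theorem det_cauchy {p : ℕ} (x y : Fin p → ℂ) (hy : Function.Injective y)
    (hxy : ∀ i j, x i ≠ y j) : (Matrix.of fun i j => 1 / (x i - y j)).det =
      (∏ a, ∏ b ∈ Finset.Iio a, ((x a - x b) * (y b - y a))) / ∏ i, ∏ j, (x i - y j) := by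
  set L : Fin p → ℂ[X] := fun j => ∏ b ∈ Finset.univ.erase j, (X - C (y b)) with hL
  set A : Matrix (Fin p) (Fin p) ℂ := Matrix.of fun i j => (L j).coeff i with hA
  have hdeg : ∀ j, (L j).natDegree < p := by
    intro j
    rw [hL, natDegree_prod_of_monic _ _ fun b _ => monic_X_sub_C _]
    simp only [natDegree_X_sub_C, Finset.sum_const, smul_eq_mul, mul_one,
      Finset.card_erase_of_mem (Finset.mem_univ j), Finset.card_univ, Fintype.card_fin]
    have := j.2
    omega
  have heval : ∀ v : Fin p → ℂ, Matrix.vandermonde v * A = Matrix.of fun i j => (L j).eval (v i) := by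
    intro v
    ext i j
    rw [Matrix.mul_apply, Matrix.of_apply, eval_eq_sum_range' (hdeg j),
      ← Fin.sum_univ_eq_sum_range fun n => (L j).coeff n * v i ^ n]
    refine Finset.sum_congr rfl fun n _ => ?_
    rw [Matrix.vandermonde_apply, hA, Matrix.of_apply, mul_comm]
  have hL' : ∀ j z, (L j).eval z = ∏ b ∈ Finset.univ.erase j, (z - y b) := by
    intro j z
    rw [hL, eval_prod]
    simp
  have hdiag : (Matrix.of fun i j => (L j).eval (y i)) =
      Matrix.diagonal fun j => ∏ b ∈ Finset.univ.erase j, (y j - y b) := by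
    ext i j
    rw [Matrix.of_apply, hL', Matrix.diagonal_apply]
    split_ifs with hij
    · rw [hij]
    · exact Finset.prod_eq_zero (Finset.mem_erase.2 ⟨hij, Finset.mem_univ i⟩) (sub_self _)
  have hprod : ∏ j, ∏ b ∈ Finset.univ.erase j, (y j - y b) =
      (∏ a, ∏ b ∈ Finset.Iio a, (y a - y b)) * ∏ a, ∏ b ∈ Finset.Iio a, (y b - y a) := by
    have h1 := prod_prod_eq_prod_Iio (fun a b => if a = b then 1 else y a - y b) fun a => if_pos rfl
    simp only [← Finset.prod_mul_distrib]
    have h2 : ∀ j, ∏ b ∈ Finset.univ.erase j, (y j - y b) =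
        ∏ b, if j = b then 1 else y j - y b := by
      intro j
      rw [← Finset.mul_prod_erase Finset.univ (fun b => if j = b then 1 else y j - y b)
        (Finset.mem_univ j), if_pos rfl, one_mul]
      exact Finset.prod_congr rfl fun b hb => (if_neg (Finset.ne_of_mem_erase hb).symm).symm
    simp only [h2]
    rw [h1]
    refine Finset.prod_congr rfl fun a _ => Finset.prod_congr rfl fun b hb => ?_
    have hne := (Finset.mem_Iio.1 hb).ne
    rw [if_neg hne.symm, if_neg hne]
  have hdetA : A.det = ∏ a, ∏ b ∈ Finset.Iio a, (y b - y a) := by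
    have h1 : (Matrix.vandermonde y * A).det = _ := congrArg Matrix.det ((heval y).trans hdiag)
    rw [Matrix.det_mul, Matrix.det_diagonal, hprod, det_vandermonde_eq] at h1
    refine mul_left_cancel₀ ?_ h1
    exact Finset.prod_ne_zero_iff.2 fun a _ => Finset.prod_ne_zero_iff.2 fun b hb =>
      sub_ne_zero.2 fun e => (Finset.mem_Iio.1 hb).ne' (hy e)
  have hfac : (Matrix.of fun i j => 1 / (x i - y j)) =
      Matrix.diagonal (fun i => (∏ j, (x i - y j))⁻¹) * (Matrix.vandermonde x * A) := by
    ext i j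
    rw [heval, Matrix.diagonal_mul, Matrix.of_apply, Matrix.of_apply, hL',
      ← Finset.mul_prod_erase Finset.univ (fun b => x i - y b) (Finset.mem_univ j)]
    have h1 := sub_ne_zero.2 (hxy i j)
    have h2 : ∏ b ∈ Finset.univ.erase j, (x i - y b) ≠ 0 :=
      Finset.prod_ne_zero_iff.2 fun b _ => sub_ne_zero.2 (hxy i b)
    field_simp
  rw [hfac, Matrix.det_mul, Matrix.det_mul, Matrix.det_diagonal, det_vandermonde_eq, hdetA,
    div_eq_inv_mul, ← Finset.prod_inv_distrib]
  congr 1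
  simp only [Finset.prod_mul_distrib]

theorem sq_sum_eq {p : ℕ} (l : Fin p → ℤ) :
    (∑ a, l a) ^ 2 = ∑ a, l a ^ 2 + 2 * ∑ a, ∑ b ∈ Finset.Iio a, l a * l b := by
  -- The sum over pairs is the product version read in `Multiplicative ℤ`.
  have h := prod_prod_eq_diag_mul (M := Multiplicative ℤ) fun a b => Multiplicative.ofAdd (l a * l b)
  have h' : ∑ a, ∑ b, l a * l b = ∑ a, l a * l a + ∑ a, ∑ b ∈ Finset.Iio a, (l a * l b + l b * l a) := h
  rw [sq, Finset.sum_mul_sum, h', Finset.mul_sum]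
  congr 1
  · exact Finset.sum_congr rfl fun a _ => (sq _).symm
  · refine Finset.sum_congr rfl fun a _ => ?_
    rw [Finset.mul_sum]
    exact Finset.sum_congr rfl fun b _ => by ring

/-- Since the lengths add up to m, the exponent of q is minus the sum of l_a l_b over pairs, giving
the powers in `pairFac`. The diagonal factors of the Cauchy denominator, with w^l, give `stringFac`;
the off-diagonal ones give the interactions. -/
theorem density_eq_det {q : ℂ} {m p : ℕ} {l : Fin p → ℕ} (hl : l ∈ lengths m p)
    {w : Fin p → ℂ} (hw : Generic q m w) :
    (1 - q) ^ m * (-1) ^ m * q ^ (((∑ j, (l j : ℤ) ^ 2) - (m : ℤ) ^ 2) / 2) *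
      (Matrix.of fun i j => 1 / (w i * q ^ l i - w j)).det * ∏ j, w j ^ l j = density q l w := by
  have hle := le_of_mem_lengths hl
  obtain ⟨hsum, h1⟩ := mem_lengths.1 hl
  have hexp : q ^ (((∑ j, (l j : ℤ) ^ 2) - (m : ℤ) ^ 2) / 2) =
      ∏ a, ∏ b ∈ Finset.Iio a, (q ^ (l a * l b))⁻¹ := by
    have e : ((∑ j, (l j : ℤ) ^ 2) - (m : ℤ) ^ 2) / 2 =
        -((∑ a, ∑ b ∈ Finset.Iio a, l a * l b : ℕ) : ℤ) := by
      have h2 := sq_sum_eq fun a => (l a : ℤ)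
      have h3 : (m : ℤ) = ∑ a, (l a : ℤ) := by rw [← hsum]; push_cast; rfl
      rw [h3, h2]
      push_cast
      rw [sub_add_cancel_left, ← mul_neg]
      exact Int.mul_ediv_cancel_left _ two_ne_zero
    rw [e, zpow_neg, zpow_natCast, ← Finset.prod_pow_eq_pow_sum, ← Finset.prod_inv_distrib]
    refine Finset.prod_congr rfl fun a _ => ?_
    rw [← Finset.prod_pow_eq_pow_sum, ← Finset.prod_inv_distrib]
  have hpow : ∀ c : ℂ, c ^ m = ∏ a, c ^ l a := fun c => by
    rw [Finset.prod_pow_eq_pow_sum, hsum]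
  have hxy : ∀ i j, w i * q ^ l i ≠ w j := fun i j => by
    rw [mul_comm]
    exact hw.2 i j _ (h1 i) (hle i)
  rw [det_cauchy _ _ hw.1 hxy, hexp, hpow, hpow, prod_prod_eq_diag_mul fun i j =>
    w i * q ^ l i - w j, density]
  have hs : ∀ a, stringFac q (l a) (w a) =
      (1 - q) ^ l a * (-1) ^ l a * (w a * q ^ l a - w a)⁻¹ * w a ^ l a := by
    intro a
    have hw0 := hw.ne_zero ((h1 a).trans (hle a)) a
    obtain ⟨d, hd⟩ := Nat.exists_eq_add_of_le' (h1 a)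
    have e1 : w a * q ^ l a - w a = w a * (q ^ l a - 1) := by ring
    have e2 : q ^ l a - 1 ≠ 0 := fun e => hxy a a (by linear_combination w a * e)
    rw [stringFac, e1, hd, Nat.add_sub_cancel, pow_succ (w a)]
    rw [hd] at e2
    generalize q ^ (d + 1) - 1 = B at e2 ⊢
    field_simp
  have hp : ∀ a, ∀ b ∈ Finset.Iio a, pairFac q (l a) (w a) (l b) (w b) =
      (q ^ (l a * l b))⁻¹ * ((w a * q ^ l a - w b * q ^ l b) * (w b - w a)) *
        ((w a * q ^ l a - w b) * (w b * q ^ l b - w a))⁻¹ := by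
    intro a b _
    rw [pairFac, mul_comm (q ^ l a) (w a), mul_comm (q ^ l b) (w b), div_eq_mul_inv]
    ring
  rw [Finset.prod_congr rfl fun a _ => hs a, Finset.prod_congr rfl fun a _ =>
    Finset.prod_congr rfl (hp a)]
  simp only [Finset.prod_mul_distrib, Finset.prod_inv_distrib, div_eq_mul_inv, mul_inv]
  ring

/-! ### From ordered string lengths to partitions -/

/-- The permutation that sorts a tuple in weakly decreasing order. -/
def sortDesc {p : ℕ} (l : Fin p → ℕ) : Equiv.Perm (Fin p) := Fin.revPerm.trans (Tuple.sort l)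

theorem antitone_comp_sortDesc {p : ℕ} (l : Fin p → ℕ) : Antitone (l ∘ sortDesc l) :=
  fun _ _ h => Tuple.monotone_sort l (Fin.rev_le_rev.2 h)

theorem comp_sortDesc_comp {p : ℕ} {l : Fin p → ℕ} (hl : Antitone l) (σ : Equiv.Perm (Fin p)) :
    (l ∘ σ) ∘ sortDesc (l ∘ σ) = l :=
  Tuple.unique_antitone (f := l) (σ := (sortDesc (l ∘ σ)).trans σ) (τ := Equiv.refl _)
    (antitone_comp_sortDesc (l ∘ σ)) hl

/-- The number of permutations that fix a tuple. -/
def clusterFactorial {p : ℕ} (l : Fin p → ℕ) : ℕ :=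
  ∏ i ∈ Finset.univ.image l, (Finset.univ.filter fun a => l a = i).card.factorial

theorem card_perm_comp_eq {p : ℕ} (l : Fin p → ℕ) (τ : Equiv.Perm (Fin p)) :
    (Finset.univ.filter fun σ : Equiv.Perm (Fin p) => l ∘ σ = l ∘ τ).card = clusterFactorial l := by
  have h := DomMulAct.stabilizer_card' l
  have e : clusterFactorial l =
      ∏ i ∈ Finset.univ.image l, (Fintype.card {a // l a = i}).factorial :=
    Finset.prod_congr rfl fun i _ => by rw [Fintype.card_subtype]
  rw [e, ← h, Fintype.card_subtype]
  refine Finset.card_nbij' (fun σ => σ * τ⁻¹) (fun σ => σ * τ) ?_ ?_ ?_ ?_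
  · intro σ hσ
    simp only [Finset.coe_filter, Finset.mem_univ, true_and, mem_ofPred_eq] at hσ ⊢
    funext a
    have := congrFun hσ (τ⁻¹ a)
    simpa using this
  · intro σ hσ
    simp only [Finset.coe_filter, Finset.mem_univ, true_and, mem_ofPred_eq] at hσ ⊢
    funext a
    exact congrFun hσ (τ a)
  · intro σ _; simp
  · intro σ _; simp

theorem comp_perm_mem_lengths {m p : ℕ} {l : Fin p → ℕ} (h : l ∈ lengths m p)
    (σ : Equiv.Perm (Fin p)) : l ∘ σ ∈ lengths m p := by
  rw [mem_lengths] at h ⊢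
  exact ⟨(Equiv.sum_comp σ l).trans h.1, fun b => h.2 (σ b)⟩

/-- Orbit counting: p! permutations act on a sorted tuple l, each rearrangement is reached
`clusterFactorial l` times, and I is constant on the orbit. -/
theorem sum_lengths {m p : ℕ} (I : (Fin p → ℕ) → ℂ)
    (hI : ∀ l, ∀ σ : Equiv.Perm (Fin p), I (l ∘ σ) = I l) :
    (p.factorial : ℂ)⁻¹ * ∑ l ∈ lengths m p, I l =
      ∑ l ∈ (lengths m p).filter fun l => Antitone l, (clusterFactorial l : ℂ)⁻¹ * I l := by
  have hmaps : ∀ l ∈ lengths m p, l ∘ sortDesc l ∈ (lengths m p).filter fun l => Antitone l :=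
    fun l hl => Finset.mem_filter.2 ⟨comp_perm_mem_lengths hl _, antitone_comp_sortDesc l⟩
  rw [← Finset.sum_fiberwise_of_maps_to hmaps, Finset.mul_sum]
  refine Finset.sum_congr rfl fun l hl => ?_
  rw [Finset.mem_filter] at hl
  have hc : ∑ x ∈ (lengths m p).filter (fun x => x ∘ sortDesc x = l), I x =
      ((lengths m p).filter fun x => x ∘ sortDesc x = l).card * I l := by
    rw [← nsmul_eq_mul]
    refine Finset.sum_eq_card_nsmul fun x hx => ?_
    rw [← (Finset.mem_filter.1 hx).2, hI]
  have hcard : p.factorial =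
      ((lengths m p).filter fun x => x ∘ sortDesc x = l).card * clusterFactorial l := by
    have h1 := Finset.card_eq_sum_card_fiberwise (s := (Finset.univ : Finset (Equiv.Perm (Fin p))))
      (t := (lengths m p).filter fun x => x ∘ sortDesc x = l)
      (f := fun σ : Equiv.Perm (Fin p) => l ∘ σ) fun σ _ =>
        Finset.mem_coe.2 (Finset.mem_filter.2
          ⟨comp_perm_mem_lengths hl.1 σ, comp_sortDesc_comp hl.2 σ⟩)
    rw [Finset.card_univ, Fintype.card_perm, Fintype.card_fin] at h1
    rw [h1, Finset.sum_const_nat fun x hx => ?_]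
    obtain ⟨_, hx⟩ := Finset.mem_filter.1 hx
    have hx' : x = l ∘ (sortDesc x).symm := by
      rw [← hx]
      funext a
      simp
    rw [hx']
    exact card_perm_comp_eq l _
  rw [hc, hcard]
  have hp : (((lengths m p).filter fun x => x ∘ sortDesc x = l).card * clusterFactorial l : ℕ) ≠ 0 :=
    hcard ▸ p.factorial_ne_zero
  have hp1 := Nat.cast_ne_zero (R := ℂ).2 (left_ne_zero_of_mul hp)
  have hp2 := Nat.cast_ne_zero (R := ℂ).2 (right_ne_zero_of_mul hp)
  push_cast
  field_simp

theorem blocksFun_mem_lengths {m : ℕ} (c : Composition m) : c.blocksFun ∈ lengths m c.length :=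
  mem_lengths.2 ⟨c.sum_blocksFun, c.one_le_blocksFun⟩

theorem clusterFactorial_blocksFun {m : ℕ} (c : Composition m) :
    clusterFactorial c.blocksFun = ∏ i ∈ Finset.Icc 1 m, (c.blocks.count i).factorial := by
  have hcount : ∀ i, (Finset.univ.filter fun a => c.blocksFun a = i).card = c.blocks.count i := by
    intro i
    rw [← Multiset.coe_count, ← c.ofFn_blocksFun, ← Fin.univ_val_map, Multiset.count_map]
    simp only [eq_comm (a := i)]
    rfl
  simp only [clusterFactorial, hcount]
  refine Finset.prod_subset (fun i hi => ?_) fun i _ hi => ?_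
  · obtain ⟨a, _, rfl⟩ := Finset.mem_image.1 hi
    exact Finset.mem_Icc.2 ⟨c.one_le_blocksFun a, le_of_mem_lengths (blocksFun_mem_lengths c) a⟩
  · rw [← hcount, Finset.card_eq_zero.2, Nat.factorial_zero]
    exact Finset.filter_eq_empty_iff.2 fun a _ e =>
      hi (Finset.mem_image.2 ⟨a, Finset.mem_univ a, e⟩)

theorem sum_stringData_eq_sum_partitions (m : ℕ) (I : ∀ p, (Fin p → ℕ) → ℂ)
    (hI : ∀ p l, ∀ σ : Equiv.Perm (Fin p), I p (l ∘ σ) = I p l) :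
    ∑ x ∈ stringData m, (x.1.factorial : ℂ)⁻¹ * I x.1 x.2 =
      ∑ c ∈ partitions m, (∏ i ∈ Finset.Icc 1 m, ((c.blocks.count i).factorial : ℂ))⁻¹ *
        I c.length c.blocksFun := by
  rw [stringData, Finset.sum_sigma]
  simp only [← Finset.mul_sum]
  rw [Finset.sum_congr rfl fun p _ => sum_lengths (I p) (hI p),
    ← Finset.sum_sigma (Finset.range (m + 1)) (fun p => (lengths m p).filter fun l => Antitone l)
      fun x => (clusterFactorial x.2 : ℂ)⁻¹ * I x.1 x.2]
  symm
  refine Finset.sum_bij (fun c _ => ⟨c.length, c.blocksFun⟩) (fun c hc => ?_) (fun c _ d _ h => ?_)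
    (fun x hx => ?_) fun c _ => ?_
  · exact Finset.mem_sigma.2 ⟨Finset.mem_range.2 (Nat.lt_succ_of_le c.length_le),
      Finset.mem_filter.2 ⟨blocksFun_mem_lengths c, (Finset.mem_filter.1 hc).2⟩⟩
  · have h' := congrArg (fun x : Σ p, Fin p → ℕ => List.ofFn x.2) h
    simp only [Composition.ofFn_blocksFun] at h'
    exact Composition.ext h'
  · obtain ⟨p, l⟩ := x
    obtain ⟨-, hl⟩ := Finset.mem_sigma.1 hx
    obtain ⟨hl, ha⟩ := Finset.mem_filter.1 hl
    obtain ⟨hs, h1⟩ := mem_lengths.1 hl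
    let c : Composition m := ⟨List.ofFn l, fun {i} hi => by
      obtain ⟨b, rfl⟩ := (List.mem_ofFn' _ _).1 hi
      exact h1 b, by rw [List.sum_ofFn]; exact hs⟩
    have e : (⟨c.length, c.blocksFun⟩ : Σ p, Fin p → ℕ) = ⟨p, l⟩ :=
      List.equivSigmaTuple.right_inv ⟨p, l⟩
    refine ⟨c, Finset.mem_filter.2 ⟨Finset.mem_univ _, ?_⟩, e⟩
    -- Monotonicity is transported along an equality of dependent pairs by generalizing the pair,
    -- since length and tuple change together.
    have : ∀ x : Σ p, Fin p → ℕ, (⟨p, l⟩ : Σ p, Fin p → ℕ) = x → Antitone x.2 := by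
      rintro x rfl
      exact ha
    exact this _ e.symm
  · simp only [clusterFactorial_blocksFun]
    push_cast
    rfl

/-! ### Nested contours are expandable -/

/-- The last contour serves as C, with poles 1 and ν⁻¹. Smallness of the disc keeps the strings off
these poles and off C; the chain of nestings makes the a-th contour contain q^c C for as many c as
there are contours after it. -/
theorem Nested.expandable {q : ℂ} {ν : ℝ} {k : ℕ} {γ : Fin (k + 1) → Contour} (hq : q ≠ 0)
    (h : Nested q ν γ) : Expandable q ν γ (γ (Fin.last k)) {p | p = 1 ∨ (ν : ℂ) * p = 1} := by
  obtain ⟨r, hr, hcirc⟩ := h.last_circle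
  have hC : (γ (Fin.last k)).IsCircle r := ⟨hr.1, hcirc _ (by simp)⟩
  have hball : ∀ w ∈ (γ (Fin.last k)).range, w ∈ Metric.closedBall (1 : ℂ) r := fun w hw => by
    rw [hC.range_eq] at hw
    exact Metric.sphere_subset_closedBall hw
  have hone : (1 : ℂ) ∈ Metric.closedBall (1 : ℂ) r := Metric.mem_closedBall_self hr.1.le
  have hpoles : ∀ p ∈ {p : ℂ | p = 1 ∨ (ν : ℂ) * p = 1}, ∀ j, p ∉ (γ j).range ∧
      (γ j).winding p = (γ (Fin.last k)).winding p := by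
    rintro p (rfl | hp) j
    · exact ⟨(h.contains_one j).1, (h.contains_one j).2.trans (h.contains_one _).2.symm⟩
    · exact ⟨(h.avoids_nu j hp).1, (h.avoids_nu j hp).2.trans (h.avoids_nu _ hp).2.symm⟩
  refine ⟨Or.inl rfl, fun p hp => Or.inr hp, fun p hp j => ⟨(hpoles p hp j).1,
    (hpoles p hp (Fin.last k)).1, (hpoles p hp j).2⟩, fun c hc w hw => ?_, fun a c h1 h2 w hw => ?_,
    fun c h1 h2 w hw => ?_, fun a b hab z hz => ?_, fun a ha z hz => ?_⟩
  · rintro (e | e)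
    · rcases Nat.eq_zero_or_pos c with rfl | hc0
      · rw [pow_zero, one_mul] at e
        exact (h.contains_one _).1 (e ▸ hw)
      · exact hr.2.1 c (Finset.mem_Icc.2 ⟨hc0, hc.le⟩) w (hball w hw) (e ▸ hone)
    · exact hr.2.2 c (Finset.mem_range.2 hc) w (hball w hw) e
  · induction c, h1 using Nat.le_induction generalizing a with
    | base =>
      rw [pow_one]
      exact h.nested a (Fin.last k) (by rw [Fin.lt_def, Fin.val_last]; omega) w hw
    | succ c h1 ih =>
      have h3 : (a : ℕ) + 1 < k + 1 := by omega
      rw [pow_succ', mul_assoc]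
      exact contains_mul_of_nested hq (h.nested a ⟨a + 1, h3⟩ (by rw [Fin.lt_def]; simp))
        (ih ⟨a + 1, h3⟩ (by simp only; omega))
  · exact hC.avoids (hr.2.1 c (Finset.mem_Icc.2 ⟨h1, h2⟩) w (hball w hw))
  · exact avoids_div_of_nested hq (h.nested a b hab) hz
  · exact avoids_div_of_nested hq (h.nested a (Fin.last k) (by rw [Fin.lt_def, Fin.val_last]; omega)) hz

/-! ### The Plancherel formula -/

theorem stringSet_comp_perm (q : ℂ) {p : ℕ} (l : Fin p → ℕ) (w : Fin p → ℂ)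
    (σ : Equiv.Perm (Fin p)) : stringSet q (l ∘ σ) (w ∘ σ) = stringSet q l w := by
  ext z
  simp only [mem_stringSet, Function.comp_apply]
  exact σ.exists_congr_left.trans (by simp)

theorem stringProd_comp_perm (q : ℂ) (h : ℂ → ℂ) {p : ℕ} (l : Fin p → ℕ) (w : Fin p → ℂ)
    (σ : Equiv.Perm (Fin p)) : stringProd q h (l ∘ σ) (w ∘ σ) = stringProd q h l w :=
  Equiv.prod_comp σ fun b => ∏ i ∈ Finset.range (l b), h (q ^ i * w b)

/-- Because G is symmetric, it may be evaluated at z ∘ σ inside the σ-th term, where its monomials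
merge with those of the Bethe sum. -/
theorem sum_bethe_of_mem_Cz (q : ℂ) {ν : ℝ} {k : ℕ} {G : (Fin k → ℂ) → ℂ} (hG : G ∈ Cz ν k)
    {P : (Fin k → ℤ) →₀ ℂ} (hP : ∀ z ∈ specDomain ν k, G z = laurentEval ν P z) (n : Fin k → ℤ)
    {z : Fin k → ℂ} (hz : z ∈ specDomain ν k) :
    ∑ m ∈ P.support, P m * bethe q ν (m + n) z = G z * bethe q ν n z := by
  have hσ : ∀ σ : Equiv.Perm (Fin k),
      G z = ∑ m ∈ P.support, P m * ∏ j, xi ν (z (σ j)) ^ m j := fun σ => by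
    rw [← hG.1 σ z, hP (z ∘ σ) fun j => hz (σ j)]
    rfl
  simp only [bethe, Finset.mul_sum]
  rw [Finset.sum_comm]
  refine Finset.sum_congr rfl fun σ _ => ?_
  rw [hσ σ, Finset.sum_mul]
  refine Finset.sum_congr rfl fun m _ => ?_
  simp only [Pi.add_apply, zpow_add₀ (xi_ne_zero (hz _).1 (hz _).2), Finset.prod_mul_distrib]
  ring

section Plancherel

variable {q : ℂ} {ν : ℝ} {k : ℕ} {γ : Fin (k + 1) → Contour}

theorem inverse_eq_sum_monomial (h : Nested q ν γ) {G : (Fin (k + 1) → ℂ) → ℂ}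
    {P : (Fin (k + 1) → ℤ) →₀ ℂ} (hP : ∀ z ∈ specDomain ν (k + 1), G z = laurentEval ν P z)
    (n : WeylChamber (k + 1)) :
    inverse q ν γ G n = ∑ m ∈ P.support, P m * multiIntegral γ fun z => pairKernel q z *
      ∏ j, (xi ν (z j) ^ (m + -n.1) j * phi ν (z j)) := by
  have hc : ∀ m ∈ P.support, ContinuousOn (fun z : Fin (k + 1) → ℂ => P m * (pairKernel q z *
      ∏ j, (xi ν (z j) ^ (m + -n.1) j * phi ν (z j)))) (ranges γ) := fun m _ => by
    simp only [mul_comm _ (phi ν _)]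
    exact continuousOn_const.mul (((continuousOn_pairKernel q ν (k + 1)).mono
      h.ranges_subset_kernelDomain).mul ((continuousOn_monomial ν _).mono h.ranges_subset))
  simp only [← multiIntegral_const_mul]
  rw [← multiIntegral_sum _ hc]
  refine multiIntegral_congr fun z hz => ?_
  have hz' := h.ranges_subset hz
  rw [prod_Ioi_eq_pairKernel, hP z hz', laurentEval, Finsupp.sum, Finset.mul_sum]
  refine Finset.sum_congr rfl fun m _ => ?_
  simp only [Pi.add_apply, zpow_add₀ (xi_ne_zero (hz' _).1 (hz' _).2), Finset.prod_mul_distrib,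
    Pi.neg_apply, phi]
  ring

/-- The integrand over strings of lengths `l` that represents the inverse transform. -/
def stringIntegrand (q : ℂ) (ν : ℝ) {m : ℕ} (P : (Fin m → ℤ) →₀ ℂ) (n : Fin m → ℤ) {p : ℕ}
    (l : Fin p → ℕ) (w : Fin p → ℂ) : ℂ :=
  ∑ d ∈ P.support, P d * (density q l w * stringProd q (phi ν) l w *
    betheSet q ν (d + n) (stringSet q l w))

theorem stringIntegrand_comp_perm (q : ℂ) (ν : ℝ) {m : ℕ} (P : (Fin m → ℤ) →₀ ℂ) (n : Fin m → ℤ)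
    {p : ℕ} (l : Fin p → ℕ) (w : Fin p → ℂ) (σ : Equiv.Perm (Fin p)) :
    stringIntegrand q ν P n (l ∘ σ) (w ∘ σ) = stringIntegrand q ν P n l w := by
  simp only [stringIntegrand, density_comp_perm, stringProd_comp_perm, stringSet_comp_perm]

theorem Nested.exists_isCircle (h : Nested q ν γ) : ∃ r, (γ (Fin.last k)).IsCircle r :=
  let ⟨r, hr, hcirc⟩ := h.last_circle
  ⟨r, hr.1, hcirc _ (by simp)⟩

/-- The residue expansion is applied to each monomial of P separately. Symmetry of G plays no role
yet; it enters in `plancherel_integrand`, where the Bethe sums are recombined into G times a left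
eigenfunction. -/
theorem inverse_eq_sum_partitions (hq : q ≠ 0) (hq1 : q ≠ 1) (hν : ν < 1) (h : Nested q ν γ)
    {G : (Fin (k + 1) → ℂ) → ℂ} {P : (Fin (k + 1) → ℤ) →₀ ℂ}
    (hP : ∀ z ∈ specDomain ν (k + 1), G z = laurentEval ν P z) (n : WeylChamber (k + 1)) :
    inverse q ν γ G n = ∑ c ∈ partitions (k + 1),
      (∏ i ∈ Finset.Icc 1 (k + 1), ((c.blocks.count i).factorial : ℂ))⁻¹ *
        multiIntegral (fun _ => γ (Fin.last k)) (stringIntegrand q ν P (-n.1) c.blocksFun) := by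
  obtain ⟨r, hC⟩ := h.exists_isCircle
  have E := h.expandable hq
  have hphi := phi_mem_Rat E.one_mem E.nu_mem
  rw [inverse_eq_sum_monomial h hP, ← sum_stringData_eq_sum_partitions (k + 1) fun p l =>
    multiIntegral (fun _ => γ (Fin.last k)) (stringIntegrand q ν P (-n.1) l)]
  · have h1 : ∀ m ∈ P.support, P m * multiIntegral γ (fun z => pairKernel q z *
        ∏ j, (xi ν (z j) ^ (m + -n.1) j * phi ν (z j))) = _ := fun m _ =>
      congrArg (P m * ·) (multiIntegral_pairKernel hq hq1 hν hC E (m + -n.1) hphi)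
    rw [Finset.sum_congr rfl h1]
    simp only [Finset.mul_sum]
    rw [Finset.sum_comm]
    refine Finset.sum_congr rfl fun x hx => ?_
    unfold stringIntegrand
    rw [multiIntegral_sum_of_regular hC _ fun m _ =>
      (E.regular_term hq hν hphi le_rfl (m + -n.1) (Finset.mem_sigma.1 hx).2).const_mul (P m),
      Finset.mul_sum]
    refine Finset.sum_congr rfl fun m _ => ?_
    rw [multiIntegral_const_mul]
    ring
  · intro p l σ
    rw [← multiIntegral_comp_perm _ (stringIntegrand q ν P (-n.1) (l ∘ σ)) σ]
    simp only [stringIntegrand_comp_perm]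

theorem stringProd_phi (q : ℂ) (ν : ℝ) {p : ℕ} (l : Fin p → ℕ) (w : Fin p → ℂ) :
    ∏ j, 1 / (qPoch (w j) q (l j) * qPoch (ν * w j) q (l j)) = stringProd q (phi ν) l w := by
  refine Finset.prod_congr rfl fun j _ => ?_
  rw [qPoch, qPoch, ← Finset.prod_mul_distrib, one_div, ← Finset.prod_inv_distrib]
  refine Finset.prod_congr rfl fun i _ => ?_
  rw [phi, one_div, mul_comm (q ^ i), mul_assoc (ν : ℂ)]

theorem plancherel_integrand (hq : q ≠ 0) (hν : ν < 1) {C : Contour} {S : Set ℂ}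
    (E : Expandable q ν γ C S) {G : (Fin (k + 1) → ℂ) → ℂ} (hG : G ∈ Cz ν (k + 1))
    {P : (Fin (k + 1) → ℤ) →₀ ℂ} (hP : ∀ z ∈ specDomain ν (k + 1), G z = laurentEval ν P z)
    (n : WeylChamber (k + 1)) (c : Composition (k + 1)) {w : Fin c.length → ℂ}
    (hw : w ∈ ranges fun _ : Fin c.length => C) (hi : Function.Injective w) :
    plancherelDensity q c w *
      (∏ j, 1 / (qPoch (w j) q (c.blocksFun j) * qPoch (ν * w j) q (c.blocksFun j))) *
      G (strings q c w) * eigenL q ν n (strings q c w) =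
    (∏ i ∈ Finset.Icc 1 (k + 1), ((c.blocks.count i).factorial : ℂ))⁻¹ *
      stringIntegrand q ν P (-n.1) c.blocksFun w := by
  have hl := blocksFun_mem_lengths c
  have hw' := E.generic hw hi
  have hinj : Function.Injective (strings q c w) :=
    hw'.injective_strings hq (le_of_mem_lengths hl) c.blocksFinEquiv.symm
  have hmem : strings q c w ∈ specDomain ν (k + 1) :=
    E.strings_mem_specDomain (le_of_mem_lengths hl) c.blocksFinEquiv.symm hw
  have himg : Finset.univ.image (strings q c w) = stringSet q c.blocksFun w :=
    image_eq_stringSet q c.blocksFinEquiv.symm w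
  rw [eigenL_eq, extendDiag_bethe_of_injective hν q 1 _ hmem hinj, one_mul, mul_assoc _ (G _),
    stringProd_phi]
  have hb : G (strings q c w) * bethe q ν (fun j => -n.1 j) (strings q c w) =
      ∑ m ∈ P.support, P m * betheSet q ν (m + -n.1) (stringSet q c.blocksFun w) := by
    rw [← himg]
    simp only [betheSet_image q ν _ hinj]
    exact (sum_bethe_of_mem_Cz q hG hP (-n.1) hmem).symm
  have hd : plancherelDensity q c w =
      (∏ i ∈ Finset.Icc 1 (k + 1), ((c.blocks.count i).factorial : ℂ))⁻¹ *
        density q c.blocksFun w := by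
    rw [← density_eq_det hl hw', plancherelDensity]
    ring
  rw [hb, hd, stringIntegrand, Finset.mul_sum, Finset.mul_sum]
  refine Finset.sum_congr rfl fun m _ => ?_
  ring

theorem regular_sum {C : Contour} {p : ℕ} {ι : Type*} (s : Finset ι) {f : ι → (Fin p → ℂ) → ℂ}
    (hf : ∀ i ∈ s, Regular C (f i)) : Regular C fun w => ∑ i ∈ s, f i w := by
  choose! F hF hfF using hf
  exact ⟨fun w => ∑ i ∈ s, F i w, continuousOn_finsetSum _ hF, fun w hw hi =>
    Finset.sum_congr rfl fun i his => hfF i his w hw hi⟩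

theorem regular_stringIntegrand (hq : q ≠ 0) (hν : ν < 1) {C : Contour} {S : Set ℂ}
    (E : Expandable q ν γ C S) (P : (Fin (k + 1) → ℤ) →₀ ℂ) (n : Fin (k + 1) → ℤ) {p : ℕ}
    {l : Fin p → ℕ} (hl : l ∈ lengths (k + 1) p) : Regular C (stringIntegrand q ν P n l) :=
  regular_sum _ fun d _ => (E.regular_term hq hν (phi_mem_Rat E.one_mem E.nu_mem) le_rfl (d + n)
    hl).const_mul (P d)

/-- The inverse transform is the spectral pairing with the left eigenfunctions. -/
theorem pairC_sum_eigenL (hq : q ≠ 0) (hq1 : q ≠ 1) (hν : ν < 1) (h : Nested q ν γ)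
    {G : (Fin (k + 1) → ℂ) → ℂ} (hG : G ∈ Cz ν (k + 1)) (s : Finset (WeylChamber (k + 1)))
    (a : WeylChamber (k + 1) → ℂ) :
    pairC q ν (γ (Fin.last k)) G (∑ n ∈ s, a n • eigenL q ν n) =
      ∑ n ∈ s, a n * inverse q ν γ G n := by
  obtain ⟨r, hC⟩ := h.exists_isCircle
  have E := h.expandable hq
  obtain ⟨P, hP⟩ := hG.2.1
  simp only [inverse_eq_sum_partitions hq hq1 hν h hP, Finset.mul_sum]
  rw [Finset.sum_comm]
  refine Finset.sum_congr rfl fun c _ => ?_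
  simp only [← multiIntegral_const_mul]
  rw [← multiIntegral_sum_of_regular hC _ fun n _ =>
    ((regular_stringIntegrand hq hν E P (-n.1) (blocksFun_mem_lengths c)).const_mul _).const_mul _]
  refine multiIntegral_congr_injective hC fun w hw hi => ?_
  simp only [← plancherel_integrand hq hν E hG hP _ c hw hi, Finset.sum_apply, Pi.smul_apply,
    smul_eq_mul]
  rw [Finset.mul_sum]
  exact Finset.sum_congr rfl fun n _ => by ring

theorem eigenL_eq_smul_eigenR (hq : q ≠ 0) (hq1 : ‖q‖ < 1) (hν0 : 0 ≤ ν) (hν : ν < 1) {k : ℕ}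
    (n : WeylChamber k) :
    eigenL q ν n = ((-1) ^ k * ((1 - q) ^ k)⁻¹ * (stat q ν n)⁻¹) • eigenR q ν (reflPt n) := by
  funext z
  exact (congrFun (swap_eigenR hq hq1 hν0 hν z) n).symm

/-- Reindexing by the reflection moves S from g to the eigenfunctions, `stat` being invariant, and
there it turns right ones into left ones. -/
theorem direct_swapW (hq : q ≠ 0) (hq1 : ‖q‖ < 1) (hν0 : 0 ≤ ν) (hν : ν < 1) {k : ℕ}
    (g : Wc k) {s : Finset (WeylChamber k)} (hs : ∀ n, g.1 n ≠ 0 → n ∈ s) :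
    direct q ν k (swapW q ν k g) = ∑ n ∈ s, g.1 n • eigenL q ν n := by
  have hsw : ∀ n, (swapW q ν k g).1 n =
      (-1) ^ k * ((1 - q) ^ k)⁻¹ * (stat q ν n)⁻¹ * g.1 (reflPt n) := fun _ => rfl
  have hinj : Function.Injective (reflPt (k := k)) := fun a b e => by
    rw [← reflPt_reflPt a, e, reflPt_reflPt]
  rw [direct_eq_sum q ν _ (s := s.image reflPt) fun n hn => ?_,
    Finset.sum_image fun a _ b _ e => hinj e]
  · refine Finset.sum_congr rfl fun n _ => ?_
    rw [hsw, eigenL_eq_smul_eigenR hq hq1 hν0 hν, reflPt_reflPt, stat_reflPt, smul_smul, mul_comm]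
  · refine Finset.mem_image.2 ⟨reflPt n, hs _ fun e => hn ?_, reflPt_reflPt n⟩
    rw [hsw, e, mul_zero]

theorem plancherel (hq : q ≠ 0) (hq1 : ‖q‖ < 1) (hν0 : 0 ≤ ν) (hν : ν < 1) (h : Nested q ν γ)
    (f g : Wc (k + 1)) :
    pairW f.1 g.1 = pairC q ν (γ (Fin.last k)) (direct q ν (k + 1) f)
      (direct q ν (k + 1) (swapW q ν (k + 1) g)) := by
  have hq1' : q ≠ 1 := fun e => by simp [e] at hq1
  have hs : ∀ n, g.1 n ≠ 0 → n ∈ Set.Finite.toFinset g.2 := fun n hn =>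
    (Set.Finite.mem_toFinset _).2 hn
  rw [direct_swapW hq hq1 hν0 hν g hs, pairC_sum_eigenL hq hq1' hν h (direct_mem_Cz hq hν f), pairW,
    finsum_eq_sum_of_support_subset (s := Set.Finite.toFinset g.2) _ fun n hn =>
      Finset.mem_coe.2 (hs n (right_ne_zero_of_mul hn))]
  refine Finset.sum_congr rfl fun n _ => ?_
  rw [inverse_direct hq hq1 hν0 hν h, mul_comm]

end Plancherel

end

end QHahn

/-- The spatial Plancherel formula for the q-Hahn eigenfunctions. -/
theorem theorem3p2 (k : ℕ) (hk : 1 ≤ k) (q : ℂ) (hq0 : q ≠ 0) (hq1 : ‖q‖ < 1)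
    (ν : ℝ) (hν0 : 0 ≤ ν) (hν1 : ν < 1)
    (γ : Fin k → QHahn.Contour) (hγ : QHahn.Nested q ν γ) :
    -- the direct transform takes values in the symmetric Laurent polynomials,
    (∀ f : QHahn.Wc k, QHahn.direct q ν k f ∈ QHahn.Cz ν k) ∧
    -- and is an isomorphism onto its image, whose inverse is the inverse transform;
    (∃ e : QHahn.Wc k ≃ₗ[ℂ] LinearMap.range (QHahn.direct q ν k),
      (∀ f, (e f : (Fin k → ℂ) → ℂ) = QHahn.direct q ν k f) ∧
      ∀ G, (e.symm G : QHahn.WeylChamber k → ℂ) = QHahn.inverse q ν γ G) ∧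
    -- the composition of the two transforms is the identity;
    (∀ (f : QHahn.Wc k) (n : QHahn.WeylChamber k),
      QHahn.inverse q ν γ (QHahn.direct q ν k f) n = (f : QHahn.WeylChamber k → ℂ) n) ∧
    -- the operator `swap` turns right eigenfunctions into left ones,
    (∀ z ∈ QHahn.specDomain ν k,
      QHahn.swap q ν k (fun n => QHahn.eigenR q ν n z) = fun n => QHahn.eigenL q ν n z) ∧
    -- and the direct transform intertwines the two bilinear pairings up to `swap`.
    (∀ f g : QHahn.Wc k,
      QHahn.pairW (f : QHahn.WeylChamber k → ℂ) (g : QHahn.WeylChamber k → ℂ) =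
        QHahn.pairC q ν (γ ⟨k - 1, Nat.sub_lt hk Nat.one_pos⟩)
          (QHahn.direct q ν k f) (QHahn.direct q ν k (QHahn.swapW q ν k g))) := by
  have hinv : ∀ f n, QHahn.inverse q ν γ (QHahn.direct q ν k f) n = f.1 n :=
    QHahn.inverse_direct hq0 hq1 hν0 hν1 hγ
  have hinj : Function.Injective (QHahn.direct q ν k) := fun f g e =>
    Subtype.ext (funext fun n => by rw [← hinv f n, ← hinv g n, e])
  refine ⟨QHahn.direct_mem_Cz hq0 hν1, ⟨LinearEquiv.ofInjective _ hinj, fun f => rfl, fun G => ?_⟩,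
    hinv, fun z _ => QHahn.swap_eigenR hq0 hq1 hν0 hν1 z, ?_⟩
  · obtain ⟨f, rfl⟩ := (LinearEquiv.ofInjective _ hinj).surjective G
    rw [LinearEquiv.symm_apply_apply]
    exact funext fun n => (hinv f n).symm
  · obtain ⟨k, rfl⟩ := Nat.exists_eq_add_of_le' hk
    exact QHahn.plancherel hq0 hq1 hν0 hν1 hγ
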